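/- Let $\mathbb{F}_q$ be the finite field with $q$ elements, $A=\mathbb{F}_q[T]$, $k=\mathbb{F}_q(T)$, $\bar k$ an algebraic closure of $k$, and let $\tau$ be the map $z\mapsto z^q$. Write $\log=\log_q$, $\log_+ D=\max\{\log_q D,1\}$ and $\log\log_+ D=\max\{\log_q\log_q D,1\}$. *Heights.* Normalize the places of $k$ by $v=\deg_T(l)\,v_l$ for $l\in A$ monic irreducible and $v_\infty=-\deg_T$. For a finite extension $K/k$, each place $w$ of $K$ extends one of these valuations $v$, and $n_w=e_wf_w$ is its local degree ($e_w$ the ramification index, $f_w$ the inertia degree of $w|v$). For $y_1,\dots,y_n\in K$ put $h(y_1,\dots,y_n)=\frac1{[K:k]}\sum_w n_w\max_i\{0,-w(y_i)\}$; for $x\in\bar k$ this gives $h(x)$ (with $K=k(x)$). *Drinfeld modules.* Let $\Phi:A\to\bar k\{\tau\}$ be a Drinfeld module of rank $d\ge1$, i.e. the homomorphism of $\mathbb{F}_q$-algebras with $\Phi(T)=\sum_{i=0}^d a_i\tau^i$, where $a_i\in\bar k$, $a_0=T$, $a_d\ne0$. Put $k(\Phi)=k(a_1,\dots,a_d)$,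 $c(\Phi)=[k(\Phi):k]$, $h(\Phi)=h(a_0,\dots,a_d)$ (computed in $k(\Phi)$) and $\hat h(x)=\lim_{n\to\infty}q^{-dn}h(\Phi(T^n)(x))$ for $x\in\bar k$. A point $x\in\bar k$ is torsion if $\Phi(a)(x)=0$ for some $a\in A\setminus\{0\}$. *Condition RV.* A monic irreducible $l\in A$ is RV (for $\Phi$) if for every place $w$ of $k(\Phi)$ above $l$: all $w(a_i)\ge0$; $\Phi(l)(X)\equiv X^{q^{d\deg_T l}}$ modulo the maximal ideal of the valuation ring of $w$; and $w$ has inertia degree $1$ over $l$. For real $0<r\le1$, $\Phi$ is of type RV$(r)$ if for every integer $N\ge1$ there are at least $\frac{1}{2r}\frac{q^{rN}}{N}$ RV polynomials $l$ of degree $N$; it is of type RV$(r)^*$ if this holds for all sufficiently large $N$. **Theorem.** Let $0<r\le 1$ and put $\alpha=h(\Phi)c(\Phi)$, $$c_0=35000\,d\,h(\Phi)^3c(\Phi)^3q^{d+r\alpha},$$ $$C_0=\min\Big\{q^{-5d(2(d+1)h(\Phi)+1)\left((q^{q+d+1}-1)c(\Phi)\right)^2},\ \frac{\alpha}{384\,r\,q^d\,c_0^{\,4\alpha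 d/r+1}}\Big\},$$ $$\mu=2+\frac{d\alpha}{r},\qquad \kappa=1+\frac{3d\alpha}{r},\qquad \lambda=1+\frac{2d\alpha}{r}.$$ Consider the inequality $$\hat h(x)\ \ge\ C\,\frac{(\log\log_+D)^{\mu}}{D\,D_{p.i.}^{\lambda}\,(\log_+D)^{\kappa}},\qquad(\ast)$$ for $x\in\bar k$, where $D=[k(x):k]$ and $D_{p.i.}=[k(x):k]_{p.i.}$ is the inseparable degree. 1. If $\Phi$ is of type RV$(r)$, then $(\ast)$ holds with $C=C_0$ for every non-torsion $x\in\bar k$ with $D_{p.i.}>1$. 2. If $\Phi$ is of type RV$(r)^*$, then there is a constant $0<C\le C_0$ (independent of $x$) such that $(\ast)$ holds for every non-torsion $x\in\bar k$ with $D_{p.i.}>1$. -/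

import Mathlib

open scoped NNReal Polynomial

noncomputable section

namespace DrinfeldLehmer

/-! ### Places and heights over the rational function field `k = F(T)`, with `F` a finite field

A place `v` is represented by the multiplicative valuation `|x|_v = q ^ (-v x)`, so that the
additive value is `v x = -log_q |x|_v`. -/

section Places

variable (F : Type*) [Field F] [Fintype F]

lemma one_lt_card : (1 : ℝ≥0) < (Fintype.card F : ℝ≥0) := by
  exact_mod_cast Fintype.one_lt_card

variable {F} in
lemma one_lt_card_pow {l : F[X]} (hl : Irreducible l) :
    (1 : ℝ≥0) < (Fintype.card F : ℝ≥0) ^ l.natDegree :=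
  one_lt_pow₀ (one_lt_card F) hl.natDegree_pos.ne'

/-- The place at infinity of `F(T)`: `v x = -deg_T x`. -/
def inftyPlace : Valuation (RatFunc F) ℝ≥0 :=
  open scoped Classical in
  (RatFunc.inftyValuation F).map (WithZeroMulInt.toNNReal (one_lt_card F).ne_zero)
    (WithZeroMulInt.toNNReal_strictMono (one_lt_card F)).monotone

variable {F} in
/-- The maximal ideal `(l)` of `F[T]`, for `l` irreducible. -/
def primeOf (l : F[X]) (hl : Irreducible l) : IsDedekindDomain.HeightOneSpectrum F[X] where
  asIdeal := Ideal.span {l}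
  isPrime := (Ideal.span_singleton_prime hl.ne_zero).2 hl.prime
  ne_bot := by simpa using hl.ne_zero

variable {F} in
/-- The place of `F(T)` attached to an irreducible `l`: `v x = deg_T l * v_l x`. -/
def finitePlace (l : F[X]) (hl : Irreducible l) : Valuation (RatFunc F) ℝ≥0 :=
  ((primeOf l hl).valuation (RatFunc F)).map
    (WithZeroMulInt.toNNReal (one_lt_card_pow hl).ne_zero)
    (WithZeroMulInt.toNNReal_strictMono (one_lt_card_pow hl)).monotone

/-- The normalized places of `k = F(T)`. -/
def IsBasePlace (v : Valuation (RatFunc F) ℝ≥0) : Prop :=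
  v = inftyPlace F ∨ ∃ (l : F[X]) (hl : Irreducible l), v = finitePlace l hl

variable (K : Type*) [Field K] [Algebra (RatFunc F) K]

/-- The places of `K`, each normalized so as to extend a normalized place of `k`. -/
def Place : Type _ :=
  {w : Valuation K ℝ≥0 // IsBasePlace F (w.comap (algebraMap (RatFunc F) K))}

namespace Place

variable {F K} (w : Place F K)

/-- The place of `k` below `w`. -/
def base : Valuation (RatFunc F) ℝ≥0 := w.1.comap (algebraMap (RatFunc F) K)

instance : w.base.HasExtension w.1 := ⟨Valuation.IsEquiv.refl⟩

/-- The ramification index `e_w`: the index of the value group of `k` in that of `K`. -/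
def ramificationIdx : ℕ :=
  (Units.map (w.base : RatFunc F →* ℝ≥0)).range.relIndex (Units.map (w.1 : K →* ℝ≥0)).range

/-- The inertia degree `f_w`: the degree of the residue field extension. -/
def inertiaDeg : ℕ :=
  Module.finrank (IsLocalRing.ResidueField w.base.valuationSubring)
    (IsLocalRing.ResidueField w.1.valuationSubring)

/-- The local degree `n_w = e_w f_w`. -/
def localDegree : ℕ := w.ramificationIdx * w.inertiaDeg

/-- The additive value `w y`, for `y ≠ 0` (and `0`, in place of `∞`, for `y = 0`). -/
def val (y : K) : ℝ := -Real.logb (Fintype.card F) (w.1 y)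

end Place

variable {K} in
/-- The logarithmic height of the affine point `(y_i)`, i.e. of `[1 : y_1 : ⋯ : y_n]`, with
coordinates in the finite extension `K` of `k`:
`[K : k]⁻¹ * ∑_w n_w * max_i {0, -w(y_i)}`. -/
def height {ι : Type*} (y : ι → K) : ℝ :=
  (Module.finrank (RatFunc F) K : ℝ)⁻¹ *
    ∑ᶠ w : Place F K, (w.localDegree : ℝ) * ⨆ i, max 0 (-w.val (y i))

open IntermediateField in
variable {K} in
/-- The Weil height of `x ∈ k̄`, computed in `k(x)`. -/
def weilHeight (x : K) : ℝ :=
  height F (fun _ : Unit => AdjoinSimple.gen (RatFunc F) x)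

end Places

/-! ### Drinfeld modules -/

/-- A Drinfeld module of rank `d ≥ 1` over the algebraic closure `Ω` of `k = F(T)`, given by the
coefficients of `Φ(T) = a_0 + a_1 τ + ⋯ + a_d τ ^ d`, where `a_0 = T` and `a_d ≠ 0`. -/
structure DrinfeldModule (F : Type*) [Field F] [Fintype F] (Ω : Type*) [Field Ω]
    [Algebra (RatFunc F) Ω] (d : ℕ) where
  coeff : Fin (d + 1) → Ω
  rank_pos : 0 < d
  coeff_zero : coeff 0 = algebraMap (RatFunc F) Ω RatFunc.X
  coeff_last : coeff (Fin.last d) ≠ 0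

namespace DrinfeldModule

variable {F : Type*} [Field F] [Fintype F] {Ω : Type*} [Field Ω] [Algebra (RatFunc F) Ω]
  {d : ℕ} (Φ : DrinfeldModule F Ω d)

section Action

variable [Algebra F Ω]

/-- The algebra homomorphism `Φ : F[T] → Ω{τ}` with `Φ(T) = ∑ a_i τ ^ i`. Here `τ` is the
`q`-Frobenius, and the elements of `Ω{τ}` are regarded as `F`-linear endomorphisms of `Ω`. -/
def action : F[X] →ₐ[F] Module.End F Ω :=
  Polynomial.aeval (∑ i : Fin (d + 1),
    LinearMap.mulLeft F (Φ.coeff i) * (FiniteField.frobeniusAlgHom F Ω).toLinearMap ^ (i : ℕ))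

/-- `x` is a torsion point if `Φ(a)(x) = 0` for some `a ≠ 0`. -/
def IsTorsion (x : Ω) : Prop := ∃ a : F[X], a ≠ 0 ∧ Φ.action a x = 0

/-- The canonical height `ĥ(x) = lim h(Φ(T ^ n)(x)) / q ^ (d n)`. -/
def canonicalHeight (x : Ω) : ℝ :=
  Filter.limUnder Filter.atTop fun n : ℕ =>
    weilHeight F (Φ.action (Polynomial.X ^ n) x) / (Fintype.card F : ℝ) ^ (d * n)

end Action

/-- The field of coefficients `k(Φ) = k(a_1, …, a_d)`. -/
def coeffField : IntermediateField (RatFunc F) Ω :=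
  IntermediateField.adjoin (RatFunc F) (Set.range Φ.coeff)

/-- The coefficients `a_i` as elements of `k(Φ)`. -/
def coeff' (i : Fin (d + 1)) : Φ.coeffField :=
  ⟨Φ.coeff i, IntermediateField.subset_adjoin _ _ ⟨i, rfl⟩⟩

/-- `c(Φ) = [k(Φ) : k]`. -/
def coeffDegree : ℕ := Module.finrank (RatFunc F) Φ.coeffField

/-- The height `h(Φ)` of the Drinfeld module. -/
def moduleHeight : ℝ := height F Φ.coeff'

/-- Property RV of a monic irreducible `l`: for every place `w` of `k(Φ)` above `l`,
the coefficients of `Φ` are `w`-integral, `Φ(l)(X) ≡ X ^ (q ^ (d * deg l))` modulo `w`, and `w` has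
inertia degree `1` over `l`. The polynomial `P` below is the additive polynomial `Φ(l)(X)`; it is
determined by its values, as `Ω` is infinite. -/
def IsRVPrime [Algebra F Ω] (l : F[X]) : Prop :=
  l.Monic ∧ ∃ hl : Irreducible l, ∀ w : Place F Φ.coeffField, w.base = finitePlace l hl →
    (∀ i, Φ.coeff' i ∈ w.1.valuationSubring) ∧
    (∃ P : w.1.valuationSubring[X],
      (∀ x : Ω, P.eval₂ ((algebraMap Φ.coeffField Ω).comp w.1.valuationSubring.subtype) x =
        Φ.action l x) ∧
      P.map (IsLocalRing.residue w.1.valuationSubring) =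
        Polynomial.X ^ (Fintype.card F ^ (d * l.natDegree))) ∧
    w.inertiaDeg = 1

variable [Algebra F Ω]

/-- The number of monic irreducible polynomials of degree `N` with property RV. -/
def rvCount (N : ℕ) : ℕ := {l : F[X] | l.natDegree = N ∧ Φ.IsRVPrime l}.ncard

/-- Type RV(r, c₁). -/
def IsRVWith (r c₁ : ℝ) : Prop :=
  ∀ N : ℕ, 0 < N → c₁ * ((Fintype.card F : ℝ) ^ (r * N) / N) ≤ Φ.rvCount N

/-- Type RV(r, c₁)*. -/
def IsRVStarWith (r c₁ : ℝ) : Prop :=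
  ∃ N₀ : ℕ, 0 < N₀ ∧
    ∀ N : ℕ, N₀ ≤ N → c₁ * ((Fintype.card F : ℝ) ^ (r * N) / N) ≤ Φ.rvCount N

/-- Type RV(r), i.e. RV(r, 1/(2r)). -/
def IsRV (r : ℝ) : Prop := Φ.IsRVWith r (1 / (2 * r))

/-- Type RV(r)*, i.e. RV(r, 1/(2r))*. -/
def IsRVStar (r : ℝ) : Prop := Φ.IsRVStarWith r (1 / (2 * r))

end DrinfeldModule

/-! ### The constants and the lower bound -/

section Bound

variable {F : Type*} [Field F] [Fintype F] {Ω : Type*} [Field Ω] [Algebra (RatFunc F) Ω]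
  {d : ℕ} (Φ : DrinfeldModule F Ω d) (r : ℝ)

/-- `c₀ = 35000 d h(Φ)³ c(Φ)³ q ^ (d + r h(Φ) c(Φ))`. -/
def c₀ : ℝ :=
  35000 * d * Φ.moduleHeight ^ 3 * (Φ.coeffDegree : ℝ) ^ 3 *
    (Fintype.card F : ℝ) ^ (d + r * Φ.moduleHeight * Φ.coeffDegree : ℝ)

/-- The explicit constant `C₀`. -/
def C₀ : ℝ :=
  min
    ((Fintype.card F : ℝ) ^ (-(5 * d * (2 * (d + 1) * Φ.moduleHeight + 1) *
      (((Fintype.card F : ℝ) ^ (Fintype.card F + d + 1) - 1) * Φ.coeffDegree) ^ 2) : ℝ))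
    (Φ.moduleHeight * Φ.coeffDegree /
      (384 * r * (Fintype.card F : ℝ) ^ d *
        c₀ Φ r ^ (4 * Φ.moduleHeight * Φ.coeffDegree * d / r + 1 : ℝ)))

/-- `μ = 2 + (d / r) h(Φ) c(Φ)`. -/
def μ : ℝ := 2 + d / r * Φ.moduleHeight * Φ.coeffDegree

/-- `κ = 1 + (3 d / r) h(Φ) c(Φ)`. -/
def κ : ℝ := 1 + 3 * d / r * Φ.moduleHeight * Φ.coeffDegree

/-- `λ = 1 + (2 d / r) h(Φ) c(Φ)`. -/
def lam : ℝ := 1 + 2 * d / r * Φ.moduleHeight * Φ.coeffDegree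

/-- `log₊ D = max {log_q D, 1}`. -/
def logPlus (q : ℕ) (D : ℝ) : ℝ := max (Real.logb q D) 1

/-- `loglog₊ D = max {log_q log_q D, 1}`. -/
def logLogPlus (q : ℕ) (D : ℝ) : ℝ := max (Real.logb q (Real.logb q D)) 1

/-- `D = [k(x) : k]`. -/
def degree (F : Type*) [Field F] {Ω : Type*} [Field Ω] [Algebra (RatFunc F) Ω] (x : Ω) : ℕ :=
  Module.finrank (RatFunc F) (IntermediateField.adjoin (RatFunc F) {x})

/-- The inseparable degree `D_{p.i.} = [k(x) : k]_{p.i.}`. -/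
def insepDegree (F : Type*) [Field F] {Ω : Type*} [Field Ω] [Algebra (RatFunc F) Ω] (x : Ω) : ℕ :=
  Field.finInsepDegree (RatFunc F) (IntermediateField.adjoin (RatFunc F) {x})

/-- `(loglog₊ D) ^ μ / (D * D_{p.i.} ^ λ * (log₊ D) ^ κ)`. -/
def heightBound (x : Ω) : ℝ :=
  logLogPlus (Fintype.card F) (degree F x) ^ μ Φ r /
    (degree F x * (insepDegree F x : ℝ) ^ lam Φ r *
      logPlus (Fintype.card F) (degree F x) ^ κ Φ r)

end Bound

end DrinfeldLehmer

end

open scoped NNReal Polynomial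

set_option linter.unusedSectionVars false

noncomputable section

namespace DrinfeldLehmer

/-! ### Extension of rank one valuations to algebraic extensions -/

section Extension

/-! Write `P` for the inseparable degree of `x`, `ℓ` for `log₊ D`, `c` for `c(Φ)`, `α = h(Φ) c`, `b
= d / r`, and `δ` for the number of conjugates of `x` over `k(Φ)`, so that `δ P ≤ D`. The argument
is of Dobrowolski type, with a Vandermonde determinant in place of an auxiliary function.

Take `s` RV primes `l` of one degree `N`, and consider `L = (m + s) δ` points: every conjugate `z`
of `x`, repeated `m = P t` times, and every `Φ(l)(z)`. The product of their nonzero differences,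
corrected by some leading coefficients, is a nonzero element `u` of a finite extension of `k`, so
its logarithmic absolute values average to zero by the product formula. The proof bounds `log |u|`
from above at every place.

At an arbitrary place the differences form a Vandermonde determinant, which may be computed with any
polynomials of degrees `0, …, L - 1`. Choosing for degree `n` the product of the `Φ(T ^ k)(X)` to
the digits of `n` in base `q ^ d` makes the bound depend on the heights of the `Φ(T ^ k)` of the
points, that is, on `ĥ` up to a bounded error for each of the roughly `log L` values of `k`.
Repeated points are first separated by a perturbation inside a disc on which these polynomials stay
bounded; each coincidence costs minus the logarithm of the radius (`prod_max_radius_le`,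
`sum_logb_diff_le`). As `x` is not torsion and the chosen `Φ(l)` are injective on the conjugates,
only the copies of one conjugate coincide.

At a place above `l` there is a gain. The polynomial `f = ∏ (X - z) ^ P` has coefficients in `k(Φ)`.
Inertia degree one makes these (once scaled to be integral) congruent to their `Q`-th powers, `Q = q
^ (d N)`, and `Φ(l)(z) ≡ z ^ Q`; hence `f(Φ(l)(z)) ≡ f(z) ^ Q = 0` (`IsRVPrime.exists_gain`). Since
`m = P t`, this gains `t N / c` for each `z`.

Summing over all places gives `main_inequality`. With `t` and then `s` large enough, the gain
absorbs both error terms (`le_canonicalHeight`), and the least admissible `N` yields `D P ^ (1 + 2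
b) ℓ ^ (3 b) ĥ(x) ≥ const` (`heightConstant_le`). The exponents of the theorem carry an extra factor
`α ≥ 1` and a spare power of `ℓ`, which swallows the powers of `loglog₊ D`, so this suffices once
the constants are compared (`heightBound_mul_le`, `C₀_le_heightConstant`).

A preliminary task is to turn the heights, defined through `e_w f_w`, into averages over embeddings
into `Ω` (`height_eq`). The fields involved may be inseparable, so the required formula `e_w f_w =
[K : k]_i · #{embeddings inducing w}` is read off from the norm of a local parameter. This needs
finiteness of integral closures, which comes from finiteness of Frobenius. -/

lemma Valuation.exists_extension_of_complete {K : Type*} [NontriviallyNormedField K]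
    [IsUltrametricDist K] [CompleteSpace K] (L : Type*) [Field L] [Algebra K L]
    [Algebra.IsAlgebraic K L] :
    ∃ w : Valuation L ℝ≥0, ∀ x : K, (w (algebraMap K L x) : ℝ) = ‖x‖ := by
  refine ⟨{ toFun := fun x => (spectralMulAlgNorm K L x).toNNReal
            map_zero' := by simp
            map_one' := by simp
            map_mul' := fun x y => by rw [map_mul, Real.toNNReal_mul (apply_nonneg _ x)]
            map_add_le_max' := fun x y => ?_ }, fun x => ?_⟩
  · have hm : Monotone Real.toNNReal := fun _ _ h => Real.toNNReal_le_toNNReal h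
    rw [← hm.map_max]
    exact Real.toNNReal_le_toNNReal (isNonarchimedean_spectralNorm (K := K) x y)
  · exact (Real.coe_toNNReal _ (apply_nonneg _ _)).trans (spectralNorm_extends x)

/-- Embed `k` into its completion `C`, extend the norm of `C` to an algebraic closure by the
spectral norm, and restrict along an embedding of `Ω`. Nontriviality of `v` makes `C` a nontrivially
normed field. -/
theorem Valuation.exists_extension {k : Type*} [Field k] (v : Valuation k ℝ≥0)
    (hv : ∃ x, x ≠ 0 ∧ v x < 1) (Ω : Type*) [Field Ω] [Algebra k Ω]
    [Algebra.IsAlgebraic k Ω] :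
    ∃ w : Valuation Ω ℝ≥0, w.comap (algebraMap k Ω) = v := by
  let a : AbsoluteValue k ℝ :=
    { toFun := fun x => v x
      map_mul' := fun x y => by simp
      nonneg' := fun x => NNReal.coe_nonneg _
      eq_zero' := fun x => by simp
      add_le' := fun x y => by
        have := v.map_add x y
        rw [← NNReal.coe_add, NNReal.coe_le_coe]
        exact this.trans (max_le (by simp) (by simp)) }
  have ha : IsNonarchimedean a := fun x y => by
    change ((v (x + y) : ℝ≥0) : ℝ) ≤ max ((v x : ℝ≥0) : ℝ) ((v y : ℝ≥0) : ℝ)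
    rw [← NNReal.coe_max, NNReal.coe_le_coe]
    exact v.map_add x y
  let C := a.Completion
  have hultra : IsUltrametricDist (WithAbs a) :=
    IsUltrametricDist.isUltrametricDist_of_isNonarchimedean_norm fun x y => ha x.ofAbs y.ofAbs
  have : IsUltrametricDist C := by
    refine IsUltrametricDist.isUltrametricDist_of_forall_norm_add_le_max_norm fun x y => ?_
    induction x, y using UniformSpace.Completion.induction_on₂ with
    | hp => exact isClosed_le (by fun_prop) (by fun_prop)
    | ih x y =>
      rw [← UniformSpace.Completion.coe_add]
      exact (UniformSpace.Completion.norm_coe (x + y)).trans_le ((ha x.ofAbs y.ofAbs).trans_eq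
        (congrArg₂ max (UniformSpace.Completion.norm_coe x).symm
          (UniformSpace.Completion.norm_coe y).symm))
  obtain ⟨x, hx0, hx⟩ := hv
  let ι : k →+* C := UniformSpace.Completion.coeRingHom.comp (WithAbs.equiv a).symm.toRingHom
  have hι : ∀ y : k, ‖ι y‖ = v y := fun y => UniformSpace.Completion.norm_coe (WithAbs.toAbs a y)
  let _ : NontriviallyNormedField C :=
    { (inferInstance : NormedField C) with
      non_trivial := ⟨ι x⁻¹, by
        rw [hι, map_inv₀, NNReal.coe_inv]
        exact (one_lt_inv₀ (by simpa [pos_iff_ne_zero] using hx0)).2 (by exact_mod_cast hx)⟩ }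
  obtain ⟨w, hw⟩ := Valuation.exists_extension_of_complete (K := C) (AlgebraicClosure C)
  let _ : Algebra k (AlgebraicClosure C) := ((algebraMap C (AlgebraicClosure C)).comp ι).toAlgebra
  let φ : Ω →ₐ[k] AlgebraicClosure C := IsAlgClosed.lift
  refine ⟨w.comap φ.toRingHom, ?_⟩
  ext y
  have h1 : φ (algebraMap k Ω y) = algebraMap C (AlgebraicClosure C) (ι y) := φ.commutes y
  change ((w (φ (algebraMap k Ω y)) : ℝ≥0) : ℝ) = v y
  rw [h1, hw, hι]

end Extension

/-! ### The places of the rational function field -/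

section BasePlaces

variable (F : Type*) [Field F] [Fintype F]

/-- The normalized places of `F(T)`. -/
abbrev BasePlace : Type _ := {v : Valuation (RatFunc F) ℝ≥0 // IsBasePlace F v}

/-- The place at infinity as an element of `BasePlace`. -/
def BasePlace.infty : BasePlace F := ⟨inftyPlace F, Or.inl rfl⟩

variable {F}

/-- The finite place attached to `l` as an element of `BasePlace`. -/
def BasePlace.finite (l : F[X]) (hl : Irreducible l) : BasePlace F :=
  ⟨finitePlace l hl, Or.inr ⟨l, hl, rfl⟩⟩

lemma toNNReal_exp {b : ℝ≥0} (hb : b ≠ 0) (n : ℤ) :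
    WithZeroMulInt.toNNReal hb (WithZero.exp n) = b ^ n := by
  rw [WithZeroMulInt.toNNReal_neg_apply hb WithZero.exp_ne_zero]
  rfl

lemma exists_uniformizer_of_map {k : Type*} [Field k] (g : Valuation k (WithZero (Multiplicative ℤ)))
    {b : ℝ≥0} (hb : 1 < b) {π : k} (hπ : g π = WithZero.exp (-1 : ℤ)) (v : Valuation k ℝ≥0)
    (hv : ∀ x, v x = WithZeroMulInt.toNNReal hb.ne_zero (g x)) :
    v π ≠ 0 ∧ v π < 1 ∧ ∀ x ≠ 0, ∃ n : ℤ, v x = v π ^ n := by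
  have h1 : v π = b⁻¹ := by rw [hv, hπ, toNNReal_exp, zpow_neg_one]
  refine ⟨by simpa [h1] using hb.ne_zero, by simpa [h1] using inv_lt_one_of_one_lt₀ hb,
    fun x hx => ?_⟩
  obtain ⟨n, hn⟩ : ∃ n : ℤ, g x = WithZero.exp n :=
    ⟨WithZero.log (g x), (WithZero.exp_log (by simpa using hx)).symm⟩
  exact ⟨-n, by rw [hv, hn, toNNReal_exp, h1, inv_zpow', neg_neg]⟩

open scoped Classical in
lemma inftyPlace_apply (x : RatFunc F) : inftyPlace F x =
    WithZeroMulInt.toNNReal (one_lt_card F).ne_zero (RatFunc.inftyValuation F x) := by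
  unfold inftyPlace
  rfl

lemma inftyPlace_of_ne_zero {x : RatFunc F} (hx : x ≠ 0) :
    inftyPlace F x = (Fintype.card F : ℝ≥0) ^ x.intDegree := by
  classical
  rw [inftyPlace_apply, RatFunc.inftyValuation_apply, RatFunc.inftyValuation_of_nonzero F hx,
    toNNReal_exp]

lemma finitePlace_apply (l : F[X]) (hl : Irreducible l) (x : RatFunc F) :
    finitePlace l hl x = WithZeroMulInt.toNNReal (one_lt_card_pow hl).ne_zero
      ((primeOf l hl).valuation (RatFunc F) x) := rfl

lemma finitePlace_self (l : F[X]) (hl : Irreducible l) :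
    finitePlace l hl (algebraMap F[X] (RatFunc F) l) =
      ((Fintype.card F : ℝ≥0) ^ l.natDegree)⁻¹ := by
  rw [finitePlace_apply, IsDedekindDomain.HeightOneSpectrum.valuation_of_algebraMap,
    IsDedekindDomain.HeightOneSpectrum.intValuation_singleton (primeOf l hl) hl.ne_zero rfl,
    toNNReal_exp, zpow_neg_one]

lemma finitePlace_polynomial_le_one (l : F[X]) (hl : Irreducible l) (a : F[X]) :
    finitePlace l hl (algebraMap F[X] (RatFunc F) a) ≤ 1 := by
  rw [finitePlace_apply, WithZeroMulInt.toNNReal_le_one_iff (one_lt_card_pow hl)]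
  exact IsDedekindDomain.HeightOneSpectrum.valuation_le_one _ _

lemma finitePlace_polynomial_eq_one {l : F[X]} (hl : Irreducible l) {a : F[X]} (h : ¬ l ∣ a) :
    finitePlace l hl (algebraMap F[X] (RatFunc F) a) = 1 := by
  rw [finitePlace_apply, WithZeroMulInt.toNNReal_eq_one_iff _ _ (one_lt_card_pow hl).ne',
    IsDedekindDomain.HeightOneSpectrum.valuation_eq_one_iff_notMem]
  change a ∉ Ideal.span {l}
  rwa [Ideal.mem_span_singleton]

lemma IsBasePlace.exists_uniformizer {v : Valuation (RatFunc F) ℝ≥0} (hv : IsBasePlace F v) :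
    ∃ π, v π ≠ 0 ∧ v π < 1 ∧ ∀ x ≠ 0, ∃ n : ℤ, v x = v π ^ n := by
  classical
  rcases hv with rfl | ⟨l, hl, rfl⟩
  · exact ⟨1 / RatFunc.X, exists_uniformizer_of_map (RatFunc.inftyValuation F) (one_lt_card F)
      (RatFunc.inftyValuation.X_inv F) _ fun x => by rw [inftyPlace_apply]⟩
  · obtain ⟨π, hπ⟩ := (primeOf l hl).valuation_exists_uniformizer (RatFunc F)
    exact ⟨π, exists_uniformizer_of_map _ (one_lt_card_pow hl) hπ _ fun x => rfl⟩

lemma finitePlace_eq_of_associated {l l' : F[X]} (hl : Irreducible l) (hl' : Irreducible l')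
    (h : Associated l l') : finitePlace l hl = finitePlace l' hl' := by
  obtain ⟨u, rfl⟩ := h
  obtain ⟨c, hc, hu⟩ := Polynomial.isUnit_iff.1 u.isUnit
  have h1 : primeOf l hl = primeOf (l * (u : F[X])) hl' := by
    ext1
    exact (Ideal.span_singleton_mul_right_unit u.isUnit l).symm
  have h2 : (l * (u : F[X])).natDegree = l.natDegree := by
    rw [← hu, Polynomial.natDegree_mul_C hc.ne_zero]
  ext x
  simp only [finitePlace_apply, h1, h2]

lemma finitePlace_ne_inftyPlace {l : F[X]} (hl : Irreducible l) :
    finitePlace l hl ≠ inftyPlace F := by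
  intro h
  have h1 := finitePlace_polynomial_le_one l hl Polynomial.X
  rw [h, RatFunc.algebraMap_X, inftyPlace_of_ne_zero RatFunc.X_ne_zero, RatFunc.intDegree_X,
    zpow_one] at h1
  exact h1.not_gt (one_lt_card F)

lemma BasePlace.finite_ne_one_polynomial {a : F[X]} (ha : a ≠ 0) :
    {v : BasePlace F | v.1 (algebraMap F[X] (RatFunc F) a) ≠ 1}.Finite := by
  classical
  have hfin : (insert (BasePlace.infty F) (Set.range fun l : {l : F[X] //
      l ∈ (UniqueFactorizationMonoid.normalizedFactors a).toFinset} => BasePlace.finite l.1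
        (UniqueFactorizationMonoid.irreducible_of_normalized_factor l.1
          (Multiset.mem_toFinset.1 l.2)))).Finite := (Set.finite_range _).insert _
  refine hfin.subset ?_
  rintro ⟨v, rfl | ⟨l, hl, rfl⟩⟩ h
  · exact Or.inl rfl
  · right
    have hdvd : l ∣ a := by
      by_contra h'
      exact h (finitePlace_polynomial_eq_one hl h')
    obtain ⟨l', hl', hass⟩ :=
      UniqueFactorizationMonoid.exists_mem_normalizedFactors_of_dvd ha hl hdvd
    exact ⟨⟨l', Multiset.mem_toFinset.2 hl'⟩,
      Subtype.ext (finitePlace_eq_of_associated _ _ hass.symm)⟩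

lemma BasePlace.finite_ne_one {x : RatFunc F} (hx : x ≠ 0) :
    {v : BasePlace F | v.1 x ≠ 1}.Finite := by
  refine ((finite_ne_one_polynomial (RatFunc.num_ne_zero hx)).union
    (finite_ne_one_polynomial x.denom_ne_zero)).subset ?_
  intro v hv
  by_contra h
  simp only [Set.mem_union, Set.mem_ofPred_eq, not_or, not_not] at h
  refine hv ?_
  rw [← RatFunc.num_div_denom x, map_div₀, h.1, h.2, div_one]

/-- The additive value of `x` at `v`, with the opposite sign. -/
def BasePlace.log (v : BasePlace F) (x : RatFunc F) : ℝ :=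
  Real.logb (Fintype.card F) (v.1 x)

lemma BasePlace.log_mul (v : BasePlace F) {x y : RatFunc F} (hx : x ≠ 0) (hy : y ≠ 0) :
    v.log (x * y) = v.log x + v.log y := by
  unfold BasePlace.log
  rw [map_mul, NNReal.coe_mul, Real.logb_mul (by simpa using hx) (by simpa using hy)]

lemma BasePlace.finite_support_log {x : RatFunc F} (hx : x ≠ 0) :
    (Function.support fun v : BasePlace F => v.log x).Finite := by
  refine (BasePlace.finite_ne_one hx).subset fun v hv h => hv ?_
  simp [BasePlace.log, h]

lemma finsum_log_mul {x y : RatFunc F} (hx : x ≠ 0) (hy : y ≠ 0) :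
    ∑ᶠ v : BasePlace F, v.log (x * y) =
      ∑ᶠ v : BasePlace F, v.log x + ∑ᶠ v : BasePlace F, v.log y := by
  rw [← finsum_add_distrib (BasePlace.finite_support_log hx) (BasePlace.finite_support_log hy)]
  exact finsum_congr fun v => v.log_mul hx hy

lemma one_lt_card_real (F : Type*) [Field F] [Fintype F] : (1 : ℝ) < Fintype.card F := by
  exact_mod_cast Fintype.one_lt_card

/-- Only infinity and `l` itself contribute: `deg l` and `-deg l`. -/
lemma finsum_log_irreducible {l : F[X]} (hl : Irreducible l) :
    ∑ᶠ v : BasePlace F, v.log (algebraMap F[X] (RatFunc F) l) = 0 := by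
  classical
  have hne : BasePlace.infty F ≠ BasePlace.finite l hl := fun h =>
    finitePlace_ne_inftyPlace hl (congrArg Subtype.val h).symm
  have hl0 : algebraMap F[X] (RatFunc F) l ≠ 0 := by simpa using hl.ne_zero
  have hq := one_lt_card_real F
  rw [finsum_eq_sum_of_support_subset (s := {BasePlace.infty F, BasePlace.finite l hl}),
    Finset.sum_pair hne]
  · simp only [BasePlace.log, BasePlace.infty, BasePlace.finite, finitePlace_self,
      inftyPlace_of_ne_zero hl0, RatFunc.intDegree_polynomial]
    push_cast
    rw [zpow_natCast, Real.logb_inv, add_neg_cancel]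
  · rintro ⟨v, rfl | ⟨l', hl', rfl⟩⟩ hv
    · simp [BasePlace.infty]
    · simp only [Finset.coe_insert, Finset.coe_singleton, Set.mem_insert_iff,
        Set.mem_singleton_iff]
      right
      by_cases h : l' ∣ l
      · exact Subtype.ext (finitePlace_eq_of_associated _ _ (hl'.associated_of_dvd hl h))
      · refine absurd ?_ hv
        simp [BasePlace.log, finitePlace_polynomial_eq_one hl' h]

lemma finsum_log_polynomial {a : F[X]} (ha : a ≠ 0) :
    ∑ᶠ v : BasePlace F, v.log (algebraMap F[X] (RatFunc F) a) = 0 := by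
  induction a using UniqueFactorizationMonoid.induction_on_prime with
  | h₁ => exact absurd rfl ha
  | h₂ u hu =>
    have h : ∀ v : BasePlace F, v.log (algebraMap F[X] (RatFunc F) u) = 0 := by
      rintro ⟨v, rfl | ⟨l, hl, rfl⟩⟩
      · simp [BasePlace.log, inftyPlace_of_ne_zero ((map_ne_zero_iff _
          (IsFractionRing.injective F[X] (RatFunc F))).2 ha), Polynomial.natDegree_eq_zero_of_isUnit hu]
      · simp [BasePlace.log, finitePlace_polynomial_eq_one hl fun h => hl.not_isUnit
          (isUnit_of_dvd_unit h hu)]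
    simp [h]
  | h₃ a l ha' hl ih =>
    rw [map_mul, finsum_log_mul (by simpa using hl.ne_zero) (by simpa using ha'), ih ha',
      finsum_log_irreducible hl.irreducible, add_zero]

/-- The product formula for `F(T)`. -/
theorem finsum_log_eq_zero {x : RatFunc F} (hx : x ≠ 0) : ∑ᶠ v : BasePlace F, v.log x = 0 := by
  have h1 := finsum_log_mul hx (y := algebraMap F[X] (RatFunc F) x.denom)
    (by simpa using x.denom_ne_zero)
  have h2 : x * algebraMap F[X] (RatFunc F) x.denom = algebraMap F[X] (RatFunc F) x.num := by
    rw [← eq_div_iff (by simpa using x.denom_ne_zero), RatFunc.num_div_denom]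
  rw [h2, finsum_log_polynomial (RatFunc.num_ne_zero hx),
    finsum_log_polynomial x.denom_ne_zero] at h1
  linarith

/-- Sort the monomials by exponent modulo `p` and take `p`-th roots of the coefficients, which exist
as `F` is perfect. The degree bound on the `c i` is what gives integrality at infinity. -/
lemma exists_sum_X_pow_mul_pow (p : ℕ) [hp : Fact p.Prime] [CharP F p] (n : ℕ) {a : F[X]}
    (ha : a.natDegree ≤ n) :
    ∃ c : Fin p → F[X], a = ∑ i : Fin p, Polynomial.X ^ (i : ℕ) * c i ^ p ∧
      ∀ i, c i = 0 ∨ i + p * (c i).natDegree ≤ n := by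
  classical
  have hp0 := hp.out.pos
  rw [a.as_sum_range_C_mul_X_pow]
  refine Finset.sum_induction _ (fun a : F[X] => ∃ c : Fin p → F[X],
    a = ∑ i : Fin p, Polynomial.X ^ (i : ℕ) * c i ^ p ∧
      ∀ i, c i = 0 ∨ i + p * (c i).natDegree ≤ n) ?_ ?_ ?_
  · rintro a b ⟨c, hc, hc'⟩ ⟨e, he, he'⟩
    refine ⟨fun i => c i + e i, ?_, fun i => ?_⟩
    · rw [hc, he, ← Finset.sum_add_distrib]
      exact Finset.sum_congr rfl fun i _ => by rw [add_pow_char, mul_add]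
    · rcases hc' i with h | h
      · simpa [h] using he' i
      · rcases he' i with h' | h'
        · exact Or.inr (by simpa [h'] using h)
        · right
          rcases max_cases (c i).natDegree (e i).natDegree with hm | hm <;>
          · have := Polynomial.natDegree_add_le (c i) (e i)
            rw [hm.1] at this
            exact (Nat.add_le_add_left (Nat.mul_le_mul_left p this) _).trans (by assumption)
  · exact ⟨fun _ => 0, by simp [hp0.ne'], fun _ => Or.inl rfl⟩
  · intro j hj
    have hjn : j ≤ n := by
      have := Finset.mem_range.1 hj
      omega
    refine ⟨fun i => if (i : ℕ) = j % p then
      Polynomial.monomial (j / p) ((frobeniusEquiv F p).symm (a.coeff j)) else 0, ?_, fun i => ?_⟩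
    · rw [Finset.sum_eq_single ⟨j % p, Nat.mod_lt _ hp0⟩]
      · simp only [if_true]
        rw [Polynomial.monomial_pow, ← frobenius_def p, frobenius_apply_frobeniusEquiv_symm,
          ← Polynomial.C_mul_X_pow_eq_monomial, mul_left_comm, ← pow_add, mul_comm (j / p) p,
          Nat.mod_add_div]
      · intro i _ hi
        dsimp only
        rw [if_neg fun h => hi (Fin.ext h), zero_pow hp0.ne', mul_zero]
      · simp
    · dsimp only
      split_ifs with h
      · right
        refine le_trans (Nat.add_le_add_left (Nat.mul_le_mul_left p
          (Polynomial.natDegree_monomial_le _)) _) ?_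
        rw [h, Nat.mod_add_div]
        exact hjn
      · exact Or.inl rfl

/-- The Frobenius endomorphism of the valuation ring of a place of `F(T)` is finite. -/
lemma IsBasePlace.exists_sum_mul_pow (p : ℕ) [hp : Fact p.Prime] [CharP F p]
    {v : Valuation (RatFunc F) ℝ≥0} (hv : IsBasePlace F v) :
    ∃ b : Fin p → RatFunc F, (∀ i, v (b i) ≤ 1) ∧ ∀ a, v a ≤ 1 →
      ∃ c : Fin p → RatFunc F, (∀ i, v (c i) ≤ 1) ∧ a = ∑ i, b i * c i ^ p := by
  have hp0 := hp.out.pos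
  -- Write `a / s = a s ^ (p - 1) / s ^ p`, so that the denominator is a `p`-th power.
  have key : ∀ a s : F[X], s ≠ 0 → ∀ c : Fin p → F[X],
      a * s ^ (p - 1) = ∑ i : Fin p, Polynomial.X ^ (i : ℕ) * c i ^ p →
      algebraMap F[X] (RatFunc F) a / algebraMap F[X] (RatFunc F) s =
        ∑ i : Fin p, RatFunc.X ^ (i : ℕ) *
          (algebraMap F[X] (RatFunc F) (c i) / algebraMap F[X] (RatFunc F) s) ^ p := by
    intro a s hs c h
    have hs' : algebraMap F[X] (RatFunc F) s ≠ 0 := by simpa using hs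
    have h1 := congrArg (algebraMap F[X] (RatFunc F)) h
    simp only [map_mul, map_pow, map_sum, RatFunc.algebraMap_X] at h1
    have h2 : ∑ i : Fin p, RatFunc.X ^ (i : ℕ) *
          (algebraMap F[X] (RatFunc F) (c i) / algebraMap F[X] (RatFunc F) s) ^ p =
        (∑ i : Fin p, RatFunc.X ^ (i : ℕ) * algebraMap F[X] (RatFunc F) (c i) ^ p) /
          algebraMap F[X] (RatFunc F) s ^ p := by
      rw [Finset.sum_div]
      exact Finset.sum_congr rfl fun i _ => by rw [div_pow, mul_div_assoc]
    rw [h2, ← h1, div_eq_div_iff hs' (pow_ne_zero _ hs'), mul_assoc, mul_comm (_ ^ (p - 1)),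
      ← pow_succ', Nat.sub_add_cancel hp0]
  rcases hv with rfl | ⟨l, hl, rfl⟩
  · have hX : inftyPlace F RatFunc.X = Fintype.card F := by
      rw [inftyPlace_of_ne_zero RatFunc.X_ne_zero, RatFunc.intDegree_X, zpow_one]
    have hX0 : (RatFunc.X : RatFunc F) ≠ 0 := RatFunc.X_ne_zero
    -- The generators `X ^ i` are not integral at infinity, so those with `i ≠ 0` are divided by `X
    -- ^ p` and the coefficient is multiplied by `X`. It stays integral because `i > 0` makes the
    -- degree inequality strict.
    refine ⟨fun i => if (i : ℕ) = 0 then 1 else RatFunc.X ^ ((i : ℤ) - p), fun i => ?_,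
      fun a ha => ?_⟩
    · dsimp only
      split_ifs with h
      · simp
      · rw [map_zpow₀, hX]
        exact zpow_le_one_of_nonpos₀ (one_lt_card F).le (by have := i.2; omega)
    · by_cases ha0 : a = 0
      · exact ⟨fun _ => 0, by simp, by simp [ha0, hp0.ne']⟩
      have hdeg : a.num.natDegree ≤ a.denom.natDegree := by
        rw [inftyPlace_of_ne_zero ha0] at ha
        have : a.intDegree ≤ 0 := by
          by_contra! h
          exact ha.not_gt (one_lt_zpow₀ (one_lt_card F) h)
        unfold RatFunc.intDegree at this
        omega
      obtain ⟨c, hc, hc'⟩ := exists_sum_X_pow_mul_pow p (p * a.denom.natDegree)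
        (a := a.num * a.denom ^ (p - 1)) (by
          refine Polynomial.natDegree_mul_le.trans ?_
          rw [Polynomial.natDegree_pow]
          calc _ ≤ a.denom.natDegree + (p - 1) * a.denom.natDegree := by gcongr
            _ = (1 + (p - 1)) * a.denom.natDegree := by ring
            _ = _ := by rw [Nat.add_sub_cancel' hp0])
      have hk := key _ _ a.denom_ne_zero c hc
      rw [RatFunc.num_div_denom] at hk
      have hs0 : algebraMap F[X] (RatFunc F) a.denom ≠ 0 := by simpa using a.denom_ne_zero
      refine ⟨fun i => if (i : ℕ) = 0 then
          algebraMap F[X] (RatFunc F) (c i) / algebraMap F[X] (RatFunc F) a.denom else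
          RatFunc.X * (algebraMap F[X] (RatFunc F) (c i) / algebraMap F[X] (RatFunc F) a.denom),
        fun i => ?_, ?_⟩
      · dsimp only
        by_cases hci : c i = 0
        · simp [hci]
        have hci' : algebraMap F[X] (RatFunc F) (c i) ≠ 0 := by simpa using hci
        have hle := (hc' i).resolve_left hci
        have hval : inftyPlace F (algebraMap F[X] (RatFunc F) (c i) /
            algebraMap F[X] (RatFunc F) a.denom) =
            (Fintype.card F : ℝ≥0) ^ (((c i).natDegree : ℤ) - a.denom.natDegree) := by
          rw [inftyPlace_of_ne_zero (div_ne_zero hci' hs0), RatFunc.intDegree_div hci' hs0,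
            RatFunc.intDegree_polynomial, RatFunc.intDegree_polynomial]
        split_ifs with h
        · rw [hval]
          refine zpow_le_one_of_nonpos₀ (one_lt_card F).le ?_
          have : (c i).natDegree ≤ a.denom.natDegree :=
            Nat.le_of_mul_le_mul_left (by omega) hp0
          omega
        · rw [map_mul, hval, hX, ← zpow_one_add₀ (one_lt_card F).ne_zero]
          refine zpow_le_one_of_nonpos₀ (one_lt_card F).le ?_
          have : (c i).natDegree < a.denom.natDegree :=
            Nat.lt_of_mul_lt_mul_left (a := p) (by omega)
          omega
      · conv_lhs => rw [hk]
        refine Finset.sum_congr rfl fun i _ => ?_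
        dsimp only
        split_ifs with h
        · rw [h, pow_zero]
        · rw [mul_pow, ← mul_assoc, ← zpow_natCast RatFunc.X p, ← zpow_add₀ hX0, sub_add_cancel,
            zpow_natCast]
  · refine ⟨fun i => RatFunc.X ^ (i : ℕ), fun i => ?_, fun a ha => ?_⟩
    · dsimp only
      rw [← RatFunc.algebraMap_X, ← map_pow]
      exact finitePlace_polynomial_le_one l hl _
    · rw [finitePlace_apply, WithZeroMulInt.toNNReal_le_one_iff (one_lt_card_pow hl)] at ha
      obtain ⟨n, s, hns⟩ := (primeOf l hl).exists_primeCompl_mul_eq_of_integer a ha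
      have hs : ¬ l ∣ s := fun h => s.2 (Ideal.mem_span_singleton.2 h)
      have hs0 : (s : F[X]) ≠ 0 := fun h => hs (h ▸ dvd_zero l)
      obtain ⟨c, hc, -⟩ := exists_sum_X_pow_mul_pow p _ (le_refl (n * (s : F[X]) ^ (p - 1)).natDegree)
      have hk := key _ _ hs0 c hc
      refine ⟨fun i => algebraMap F[X] (RatFunc F) (c i) / algebraMap F[X] (RatFunc F) s,
        fun i => ?_, ?_⟩
      · dsimp only
        rw [map_div₀, finitePlace_polynomial_eq_one hl hs, div_one]
        exact finitePlace_polynomial_le_one l hl _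
      · rw [← hk, eq_div_iff (by simpa using hs0)]
        exact hns

end BasePlaces

/-! ### Finiteness of integral closures -/

section IntegralClosure

/-- Through `ψ`, `B` becomes an `A`-submodule of `C`, which is Noetherian because `φ` is finite. -/
lemma finite_of_semilinear_injective {A B C : Type*} [CommRing A] [IsNoetherianRing A]
    [AddCommGroup B] [Module A B] [CommRing C] {φ : A →+* C} (hφ : φ.Finite) (ψ : B →+ C)
    (hψ : Function.Injective ψ) (h : ∀ (a : A) (b : B), ψ (a • b) = φ a * ψ b) :
    Module.Finite A B := by
  algebraize [φ]
  have : IsNoetherian A C := isNoetherian_of_isNoetherianRing_of_finite A C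
  let f : B →ₗ[A] C := { ψ with map_smul' := fun a b => (h a b).trans (Algebra.smul_def a _).symm }
  have : IsNoetherian A B := isNoetherian_of_injective f hψ
  infer_instance

lemma ringHom_finite_of_forall_eq_sum {A C : Type*} [CommRing A] [CommRing C] {φ : A →+* C}
    {ι : Type*} [Fintype ι] (b : ι → C) (hb : ∀ x, ∃ c : ι → A, x = ∑ i, b i * φ (c i)) :
    φ.Finite := by
  algebraize [φ]
  refine Module.Finite.of_surjective (Fintype.linearCombination A b) fun x => ?_
  obtain ⟨c, hc⟩ := hb x
  refine ⟨c, ?_⟩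
  rw [Fintype.linearCombination_apply, hc]
  exact Finset.sum_congr rfl fun i _ => by rw [Algebra.smul_def, mul_comm]; rfl

lemma iterateFrobenius_finite {A : Type*} [CommRing A] (p : ℕ) [ExpChar A p]
    (hfrob : (frobenius A p).Finite) (n : ℕ) : (iterateFrobenius A p n).Finite := by
  induction n with
  | zero => exact RingHom.Finite.of_surjective _ fun x => ⟨x, by simp⟩
  | succ n ih =>
    have : iterateFrobenius A p (n + 1) = (frobenius A p).comp (iterateFrobenius A p n) := by
      ext x
      simp [iterateFrobenius_def, frobenius_def, pow_succ, pow_mul]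
    rw [this]
    exact hfrob.comp ih

/-- In the separable closure `S` of `K` in `L` finiteness is classical. A power `p ^ n` maps `L`
into `S`, and the integral closure in `L` injectively into that in `S`. This map is semilinear over
the `n`-th iterate of Frobenius, which is finite by assumption. -/
theorem integralClosure_finite_of_frobenius_finite {A K L : Type*} [CommRing A] [IsDomain A]
    [IsIntegrallyClosed A] [IsNoetherianRing A] [Field K] [Algebra A K] [IsFractionRing A K]
    [Field L] [Algebra K L] [Algebra A L] [IsScalarTower A K L] [FiniteDimensional K L] (p : ℕ)
    [ExpChar A p] [ExpChar K p] (hfrob : (frobenius A p).Finite) :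
    Module.Finite A (integralClosure A L) := by
  let S := separableClosure K L
  have hS : Module.Finite A (integralClosure A S) := IsIntegralClosure.finite A K S _
  have : IsScalarTower A S L := IsScalarTower.of_algebraMap_eq fun a => rfl
  have : ExpChar S p := expChar_of_injective_algebraMap (algebraMap K S).injective p
  have : ExpChar L p := expChar_of_injective_algebraMap (algebraMap K L).injective p
  let n := IsPurelyInseparable.exponent S L
  let ψ₀ : L →+* S := IsPurelyInseparable.iterateFrobenius S L p (le_refl n)
  have hψ₀ : ∀ x, (algebraMap S L) (ψ₀ x) = x ^ p ^ n := fun x =>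
    IsPurelyInseparable.algebraMap_iterateFrobenius S p (le_refl n) x
  have hInt : ∀ x : integralClosure A L, ψ₀ x ∈ integralClosure A S := fun x => by
    rw [mem_integralClosure_iff]
    rw [← isIntegral_algHom_iff (IsScalarTower.toAlgHom A S L) (algebraMap S L).injective]
    change IsIntegral A (algebraMap S L (ψ₀ x))
    rw [hψ₀]
    exact IsIntegral.pow x.2 _
  let ψ : integralClosure A L →+* integralClosure A S :=
    (ψ₀.comp (integralClosure A L).val.toRingHom).codRestrict (integralClosure A S) hInt
  refine finite_of_semilinear_injective
    (φ := (algebraMap A (integralClosure A S)).comp (iterateFrobenius A p n)) ?_ ψ.toAddMonoidHom ?_ ?_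
  · refine RingHom.Finite.comp ?_ (iterateFrobenius_finite p hfrob n)
    exact RingHom.finite_algebraMap.2 hS
  · intro x y hxy
    have h1 : ψ₀ x = ψ₀ y := congrArg Subtype.val hxy
    exact Subtype.ext (ψ₀.injective h1)
  · intro a x
    apply Subtype.ext
    apply (algebraMap S L).injective
    change algebraMap S L (ψ₀ ((a • x : integralClosure A L) : L)) =
      algebraMap S L (algebraMap A S (a ^ p ^ n) * ψ₀ x)
    rw [hψ₀, map_mul, hψ₀, ← IsScalarTower.algebraMap_apply, map_pow]
    simp [Algebra.smul_def, mul_pow]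

end IntegralClosure

/-! ### Norms and lengths over discrete valuation rings -/

/-- In a Smith basis for the ideal `(u)` the coefficients are powers of `ϖ` up to units: their
product is the norm, and the sum of the exponents is the length of the quotient. -/
lemma exists_associated_norm_pow_length {A B : Type*} [CommRing A] [IsDomain A]
    [IsDiscreteValuationRing A] [CommRing B] [IsDomain B] [Algebra A B] [Module.Finite A B]
    [Module.Free A B] {ϖ : A} (hϖ : Irreducible ϖ) {u : B} (hu : u ≠ 0) :
    ∃ n : ℕ, Associated (Algebra.norm A u) (ϖ ^ n) ∧
      Module.length A (B ⧸ Ideal.span {u}) = n := by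
  classical
  let b := Module.Free.chooseBasis A B
  have hI : Ideal.span {u} ≠ ⊥ := by simpa using hu
  have ha := fun i => IsDiscreteValuationRing.associated_pow_irreducible
    (Ideal.smithCoeffs_ne_zero b _ hI i) hϖ
  choose m hm using ha
  refine ⟨∑ i, m i, ?_, ?_⟩
  · refine (associated_norm_prod_smith b hu).trans ?_
    rw [← Finset.prod_pow_eq_pow_sum]
    exact Associated.prod _ _ _ fun i _ => hm i
  · rw [((Ideal.span {u}).quotientEquivPiSpan b hI).length_eq, Module.length_pi_of_fintype]
    push_cast
    refine Finset.sum_congr rfl fun i _ => ?_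
    have h1 : Ideal.span {Ideal.smithCoeffs b _ hI i} = IsLocalRing.maximalIdeal A ^ m i := by
      rw [hϖ.maximalIdeal_eq, Ideal.span_singleton_pow]
      exact Ideal.span_singleton_eq_span_singleton.2 (hm i)
    rw [h1]
    exact IsDiscreteValuationRing.length_quotient_pow_maximalIdeal A (m i)

/-! ### Extensions of a discrete valuation to a finite extension -/

section LocalDegree

variable {k K : Type*} [Field k] [Field K] [Algebra k K]

/-- `π` is a uniformizer of `v`. -/
def IsUnif (v : Valuation k ℝ≥0) (π : k) : Prop :=
  v π ≠ 0 ∧ v π < 1 ∧ ∀ x ≠ 0, ∃ n : ℤ, v x = v π ^ n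

variable {v : Valuation k ℝ≥0} {π : k}

lemma IsUnif.exists_nat (hπ : IsUnif v π) {x : k} (hx : x ≠ 0) (h : v x ≤ 1) :
    ∃ n : ℕ, v x = v π ^ n := by
  obtain ⟨n, hn⟩ := hπ.2.2 x hx
  rcases Int.eq_nat_or_neg n with ⟨m, rfl | rfl⟩
  · exact ⟨m, by simpa using hn⟩
  · refine ⟨0, ?_⟩
    rcases Nat.eq_zero_or_pos m with rfl | hm
    · simpa using hn
    · rw [hn, zpow_neg, zpow_natCast] at h
      exact absurd h (not_le.2 ((one_lt_inv₀ (pow_pos (pos_iff_ne_zero.2 hπ.1) m)).2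
        (pow_lt_one₀ zero_le hπ.2.1 hm.ne')))

/-- A uniformizer, as an element of the valuation ring. -/
def IsUnif.toInt (hπ : IsUnif v π) : v.valuationSubring := ⟨π, hπ.2.1.le⟩

lemma isUnit_valuationSubring_iff (x : v.valuationSubring) : IsUnit x ↔ v (x : k) = 1 :=
  (Valuation.valuationSubring.integers v).isUnit_iff_valuation_eq_one

lemma IsUnif.associated (hπ : IsUnif v π) {x : v.valuationSubring} (hx : x ≠ 0) :
    ∃ n : ℕ, Associated (hπ.toInt ^ n) x := by
  obtain ⟨n, hn⟩ := hπ.exists_nat (x := (x : k)) (by simpa using hx) x.2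
  refine ⟨n, ?_⟩
  have hπ0 : π ≠ 0 := fun h => hπ.1 (by simp [h])
  have h1 : v ((x : k) / π ^ n) = 1 := by
    rw [map_div₀, map_pow, hn, div_self (pow_ne_zero _ hπ.1)]
  let y : v.valuationSubring := ⟨(x : k) / π ^ n, h1.le⟩
  have hy : IsUnit y := (isUnit_valuationSubring_iff y).2 h1
  refine ⟨hy.unit, ?_⟩
  apply Subtype.ext
  change π ^ n * ((x : k) / π ^ n) = x
  field_simp

lemma IsUnif.irreducible (hπ : IsUnif v π) : Irreducible hπ.toInt := by
  have hπ0 : π ≠ 0 := fun h => hπ.1 (by simp [h])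
  refine ⟨fun h => hπ.2.1.ne ((isUnit_valuationSubring_iff _).1 h), fun a b hab => ?_⟩
  have hab' : π = (a : k) * b := congrArg Subtype.val hab
  have ha : (a : k) ≠ 0 := fun h => hπ0 (by simp [hab', h])
  have hb : (b : k) ≠ 0 := fun h => hπ0 (by simp [hab', h])
  obtain ⟨n, hn⟩ := hπ.exists_nat ha a.2
  obtain ⟨m, hm⟩ := hπ.exists_nat hb b.2
  have h1 : v π ^ 1 = v π ^ (n + m) := by
    rw [pow_one, pow_add, ← hn, ← hm, ← map_mul, ← hab']
  have h2 := pow_right_injective₀ (pos_iff_ne_zero.2 hπ.1) hπ.2.1.ne h1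
  rcases Nat.eq_zero_or_pos n with rfl | h
  · exact Or.inl ((isUnit_valuationSubring_iff _).2 (by simpa using hn))
  · have : m = 0 := by omega
    subst this
    exact Or.inr ((isUnit_valuationSubring_iff _).2 (by simpa using hm))

lemma IsUnif.isDiscreteValuationRing (hπ : IsUnif v π) :
    IsDiscreteValuationRing v.valuationSubring :=
  IsDiscreteValuationRing.ofHasUnitMulPowIrreducibleFactorization
    ⟨hπ.toInt, hπ.irreducible, fun {_} hx => hπ.associated hx⟩

lemma hasExtension_of_eq {w : Valuation K ℝ≥0} (hw : ∀ x, w (algebraMap k K x) = v x) :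
    v.HasExtension w :=
  ⟨fun x y => by simp only [Valuation.comap_apply, hw]⟩

lemma le_one_of_mem_integralClosure {w : Valuation K ℝ≥0} (hw : ∀ x, w (algebraMap k K x) = v x)
    (b : integralClosure v.valuationSubring K) : w (b : K) ≤ 1 := by
  have := hasExtension_of_eq hw
  exact (Valuation.valuationSubring.integers w).isIntegral_iff_v_le_one.1
    (IsIntegral.tower_top (A := w.valuationSubring) b.2)

/-- The prime ideal of the integral closure attached to an extension of the valuation. -/
def centerIdeal {w : Valuation K ℝ≥0} (hw : ∀ x, w (algebraMap k K x) = v x) :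
    Ideal (integralClosure v.valuationSubring K) where
  carrier := {b | w (b : K) < 1}
  zero_mem' := by simp
  add_mem' := fun {a b} ha hb => (w.map_add (a : K) b).trans_lt (max_lt ha hb)
  smul_mem' := fun a b hb => by
    change w ((a : K) * b) < 1
    rw [map_mul]
    exact mul_lt_one_of_nonneg_of_lt_one_right (le_one_of_mem_integralClosure hw a) zero_le hb

lemma mem_centerIdeal {w : Valuation K ℝ≥0} (hw : ∀ x, w (algebraMap k K x) = v x)
    {b : integralClosure v.valuationSubring K} : b ∈ centerIdeal hw ↔ w (b : K) < 1 := Iff.rfl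

lemma val_eq_one_of_notMem {w : Valuation K ℝ≥0} (hw : ∀ x, w (algebraMap k K x) = v x)
    {b : integralClosure v.valuationSubring K} (hb : b ∉ centerIdeal hw) : w (b : K) = 1 :=
  le_antisymm (le_one_of_mem_integralClosure hw b) (not_lt.1 hb)

lemma centerIdeal_isPrime {w : Valuation K ℝ≥0} (hw : ∀ x, w (algebraMap k K x) = v x) :
    (centerIdeal hw).IsPrime := by
  refine ⟨fun h => ?_, fun {a b} hab => ?_⟩
  · have : (1 : integralClosure v.valuationSubring K) ∈ centerIdeal hw := h ▸ Submodule.mem_top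
    simp [mem_centerIdeal] at this
  · by_contra! h
    have h1 : w ((a * b : integralClosure v.valuationSubring K) : K) = w (a : K) * w (b : K) := by
      push_cast
      exact map_mul _ _ _
    rw [mem_centerIdeal, h1, val_eq_one_of_notMem hw h.1, val_eq_one_of_notMem hw h.2] at hab
    simp at hab

section Finite

variable [FiniteDimensional k K] [Module.Finite v.valuationSubring (integralClosure v.valuationSubring K)]

lemma integralClosure_isDedekindDomain (hπ : IsUnif v π) :
    IsDedekindDomain (integralClosure v.valuationSubring K) := by
  have := hπ.isDiscreteValuationRing
  have : IsNoetherianRing (integralClosure v.valuationSubring K) :=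
    IsNoetherianRing.of_finite v.valuationSubring _
  have : IsIntegrallyClosed (integralClosure v.valuationSubring K) :=
    integralClosure.isIntegrallyClosedOfFiniteExtension k
  have : Ring.DimensionLEOne (integralClosure v.valuationSubring K) :=
    Ring.DimensionLEOne.of_isIntegral v.valuationSubring _
  exact { }

/-- A nonzero prime lies over the maximal ideal of the discrete valuation ring below, so there are
finitely many primes, and a Dedekind domain with finitely many primes is principal. -/
lemma integralClosure_isPrincipalIdealRing (hπ : IsUnif v π) :
    IsPrincipalIdealRing (integralClosure v.valuationSubring K) := by
  have := hπ.isDiscreteValuationRing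
  have := integralClosure_isDedekindDomain (K := K) hπ
  refine IsPrincipalIdealRing.of_finite_primes ?_
  have hfin := IsDedekindDomain.primesOver_finite
    (IsLocalRing.maximalIdeal v.valuationSubring) (integralClosure v.valuationSubring K)
  refine (hfin.insert ⊥).subset fun P hP => ?_
  by_cases hP0 : P = ⊥
  · exact Or.inl hP0
  · right
    have : P.IsPrime := hP
    have : P.IsMaximal := Ideal.IsPrime.isMaximal hP hP0
    refine ⟨hP, ⟨?_⟩⟩
    exact (IsLocalRing.eq_maximalIdeal (Ideal.IsMaximal.under v.valuationSubring P)).symm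

end Finite

end LocalDegree

/-! ### Local parameters, ramification index and residue degree of an extension of valuations -/

section LocalDegree

variable {k K : Type*} [Field k] [Field K] [Algebra k K]
variable {v : Valuation k ℝ≥0} {π : k}

/-- If the value group of `v` is generated by `g ^ e` and that of `w` by `g`, the index is `e`. -/
lemma relIndex_zpowers_pow {G : Type*} [Group G] {g : G} (hg : ∀ n : ℤ, g ^ n = 1 → n = 0) (e : ℕ) :
    (Subgroup.zpowers (g ^ e)).relIndex (Subgroup.zpowers g) = e := by
  have hinj : Function.Injective (zpowersHom G g) := by
    rw [injective_iff_map_eq_one]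
    intro n hn
    exact hg _ hn
  have h1 : Subgroup.zpowers g = (⊤ : Subgroup (Multiplicative ℤ)).map (zpowersHom G g) := by
    ext y
    constructor
    · rintro ⟨n, rfl⟩
      exact ⟨Multiplicative.ofAdd n, trivial, rfl⟩
    · rintro ⟨n, -, rfl⟩
      exact ⟨n.toAdd, rfl⟩
  have h2 : Subgroup.zpowers (g ^ e) =
      (Subgroup.zpowers (Multiplicative.ofAdd (e : ℤ))).map (zpowersHom G g) := by
    rw [MonoidHom.map_zpowers]
    simp
  rw [h1, h2, Subgroup.relIndex_map_map_of_injective _ _ hinj, Subgroup.relIndex_top_right]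
  exact Int.index_zmultiples e

lemma unitsMap_range_eq_zpowers (w : Valuation K ℝ≥0) {u : K} (hu : u ≠ 0)
    (h : ∀ x ≠ 0, ∃ n : ℤ, w x = w u ^ n) :
    (Units.map (w : K →* ℝ≥0)).range = Subgroup.zpowers (Units.map (w : K →* ℝ≥0) (Units.mk0 u hu)) := by
  ext y
  simp only [MonoidHom.mem_range, Subgroup.mem_zpowers_iff]
  constructor
  · rintro ⟨x, rfl⟩
    obtain ⟨n, hn⟩ := h x x.ne_zero
    refine ⟨n, Units.ext ?_⟩
    simpa using hn.symm
  · rintro ⟨n, rfl⟩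
    exact ⟨Units.mk0 u hu ^ n, map_zpow _ _ _⟩

/-- The ramification index of an extension of valuations. -/
lemma ramification_eq {k K : Type*} [Field k] [Field K] {v : Valuation k ℝ≥0} {π : k} (w : Valuation K ℝ≥0) (hπ : IsUnif v π) {u : K}
    (hu0 : w u ≠ 0) (hu1 : w u < 1) (h : ∀ x ≠ 0, ∃ n : ℤ, w x = w u ^ n) {e : ℕ} (he : w u ^ e = v π) :
    (Units.map (v : k →* ℝ≥0)).range.relIndex (Units.map (w : K →* ℝ≥0)).range = e := by
  have hu : u ≠ 0 := fun h => hu0 (by simp [h])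
  have hπ0 : π ≠ 0 := fun h => hπ.1 (by simp [h])
  rw [unitsMap_range_eq_zpowers w hu h, unitsMap_range_eq_zpowers v hπ0 hπ.2.2]
  have h1 : Units.map (v : k →* ℝ≥0) (Units.mk0 π hπ0) =
      Units.map (w : K →* ℝ≥0) (Units.mk0 u hu) ^ e := Units.ext (by simpa using he.symm)
  rw [h1]
  refine relIndex_zpowers_pow (fun n hn => ?_) e
  have h2 : w u ^ n = 1 := by simpa using congrArg Units.val hn
  exact (zpow_eq_one_iff_right₀ zero_le hu1.ne).1 h2

section Finite

variable [FiniteDimensional k K] [Module.Finite v.valuationSubring (integralClosure v.valuationSubring K)]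

theorem exists_generator_centerIdeal (hπ : IsUnif v π) {w : Valuation K ℝ≥0}
    (hw : ∀ x, w (algebraMap k K x) = v x) :
    ∃ u : integralClosure v.valuationSubring K, Prime u ∧ centerIdeal hw = Ideal.span {u} := by
  have := integralClosure_isPrincipalIdealRing (K := K) hπ
  obtain ⟨u, hu⟩ := (IsPrincipalIdealRing.principal (centerIdeal hw)).principal
  refine ⟨u, ?_, hu⟩
  have hp := centerIdeal_isPrime hw
  rw [hu] at hp
  refine (Ideal.span_singleton_prime ?_).1 hp
  rintro rfl
  have h1 : algebraMap v.valuationSubring (integralClosure v.valuationSubring K) hπ.toInt ∈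
      centerIdeal hw := by
    rw [mem_centerIdeal]
    exact (hw π).trans_lt hπ.2.1
  rw [hu] at h1
  have h2 := congrArg Subtype.val (zero_dvd_iff.1 (Ideal.mem_span_singleton.1 h1))
  have h3 : algebraMap k K π = 0 := h2
  exact hπ.1 (by simp [(map_eq_zero _).1 h3])

/-- Once `w` is known at `u`, this factorization determines it everywhere, as `b` and `s` are
`w`-units. -/
lemma exists_zpow_mul_div (hπ : IsUnif v π) {w : Valuation K ℝ≥0}
    (hw : ∀ x, w (algebraMap k K x) = v x) {u : integralClosure v.valuationSubring K} (hu : Prime u)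
    (hu' : centerIdeal hw = Ideal.span {u}) {x : K} (hx : x ≠ 0) :
    ∃ (n : ℤ) (b s : integralClosure v.valuationSubring K), b ∉ centerIdeal hw ∧
      s ∉ centerIdeal hw ∧ x = (u : K) ^ n * (b : K) / s := by
  have := integralClosure_isDedekindDomain (K := K) hπ
  have : IsFractionRing (integralClosure v.valuationSubring K) K :=
    IsIntegralClosure.isFractionRing_of_finite_extension v.valuationSubring k K _
  have hu0 : (u : K) ≠ 0 := by simpa using hu.ne_zero
  have key : ∀ a : integralClosure v.valuationSubring K, a ≠ 0 →
      ∃ (n : ℕ) (b : integralClosure v.valuationSubring K), b ∉ centerIdeal hw ∧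
        a = u ^ n * b := by
    intro a ha
    obtain ⟨n, b, hb, hab⟩ := WfDvdMonoid.max_power_factor ha hu.irreducible
    exact ⟨n, b, by rwa [hu', Ideal.mem_span_singleton], hab⟩
  obtain ⟨a, s, hs, rfl⟩ := IsFractionRing.div_surjective (A := integralClosure v.valuationSubring K) x
  have hs0 : s ≠ 0 := nonZeroDivisors.ne_zero hs
  have ha0 : a ≠ 0 := by
    rintro rfl
    simp at hx
  obtain ⟨n, b, hb, rfl⟩ := key a ha0
  obtain ⟨m, t, ht, rfl⟩ := key s hs0
  refine ⟨n - m, b, t, hb, ht, ?_⟩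
  change ((u ^ n * b : integralClosure v.valuationSubring K) : K) /
    ((u ^ m * t : integralClosure v.valuationSubring K) : K) = _
  push_cast
  rw [zpow_sub₀ hu0, zpow_natCast, zpow_natCast, mul_div_mul_comm]
  ring

/-- The map from the integral closure to the residue field of `w` has kernel `(u)`. It is onto: a
unit of `w` is a fraction `b / s` with `s` outside the centre, and `s` is invertible modulo the
centre because that ideal is maximal. -/
lemma residue_equiv (hπ : IsUnif v π) {w : Valuation K ℝ≥0}
    (hw : ∀ x, w (algebraMap k K x) = v x) [v.HasExtension w]
    {u : integralClosure v.valuationSubring K} (hu : Prime u)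
    (hu' : centerIdeal hw = Ideal.span {u}) :
    Nonempty ((integralClosure v.valuationSubring K ⧸ Ideal.span {u}) ≃ₗ[v.valuationSubring]
      IsLocalRing.ResidueField w.valuationSubring) := by
  have hD := integralClosure_isDedekindDomain (K := K) hπ
  let ι : integralClosure v.valuationSubring K →ₐ[v.valuationSubring] w.valuationSubring :=
    { toFun := fun b => ⟨b, le_one_of_mem_integralClosure hw b⟩
      map_one' := rfl
      map_mul' := fun _ _ => rfl
      map_zero' := rfl
      map_add' := fun _ _ => rfl
      commutes' := fun _ => rfl }
  let f : integralClosure v.valuationSubring K →ₐ[v.valuationSubring]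
      IsLocalRing.ResidueField w.valuationSubring :=
    (IsScalarTower.toAlgHom v.valuationSubring w.valuationSubring _).comp ι
  have hfι : ∀ b, f b = IsLocalRing.residue w.valuationSubring (ι b) := fun _ => rfl
  have hres : ∀ y : w.valuationSubring, IsLocalRing.residue w.valuationSubring y = 0 ↔
      w (y : K) < 1 := by
    intro y
    rw [IsLocalRing.residue_eq_zero_iff, IsLocalRing.mem_maximalIdeal, mem_nonunits_iff,
      isUnit_valuationSubring_iff]
    exact ⟨fun h => lt_of_le_of_ne y.2 h, fun h => h.ne⟩
  have hker : Ideal.span {u} = RingHom.ker f.toRingHom := by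
    rw [← hu']
    ext b
    rw [mem_centerIdeal, RingHom.mem_ker]
    exact (hres (ι b)).symm
  have hsurj : Function.Surjective f := by
    intro y
    obtain ⟨x, rfl⟩ := IsLocalRing.residue_surjective y
    by_cases hx1 : w (x : K) < 1
    · exact ⟨0, by rw [map_zero, (hres x).2 hx1]⟩
    have hx1' : w (x : K) = 1 := le_antisymm x.2 (not_lt.1 hx1)
    have hx0 : (x : K) ≠ 0 := by
      intro h
      simp [h] at hx1'
    obtain ⟨n, b, s, hb, hs, hxe⟩ := exists_zpow_mul_div hπ hw hu hu' hx0
    have huw : w (u : K) < 1 := by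
      rw [← mem_centerIdeal hw, hu']
      exact Ideal.mem_span_singleton_self u
    have hu0 : w (u : K) ≠ 0 := by simpa using hu.ne_zero
    have hn : n = 0 := by
      rw [hxe, map_div₀, map_mul, map_zpow₀, val_eq_one_of_notMem hw hb, val_eq_one_of_notMem hw hs,
        mul_one, div_one] at hx1'
      exact (zpow_eq_one_iff_right₀ zero_le huw.ne).1 hx1'
    have hmax : (centerIdeal hw).IsMaximal :=
      Ideal.IsPrime.isMaximal (centerIdeal_isPrime hw) (by
        rw [hu']
        simpa using hu.ne_zero)
    obtain ⟨t, ht⟩ := Ideal.IsMaximal.exists_inv hmax hs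
    obtain ⟨c, hc, hct⟩ := ht
    refine ⟨b * t, ?_⟩
    rw [hfι, ← sub_eq_zero, ← map_sub, hres]
    have hs0 : w (s : K) = 1 := val_eq_one_of_notMem hw hs
    have hs0' : (s : K) ≠ 0 := by
      intro h
      simp [h] at hs0
    have hct' : (t : K) * s + c = 1 := by exact_mod_cast congrArg Subtype.val hct
    have h3 : ((ι (b * t) - x : w.valuationSubring) : K) = - (b * c : K) / s := by
      change (b : K) * t - x = _
      rw [hxe, hn, zpow_zero, one_mul, eq_div_iff hs0', sub_mul, div_mul_cancel₀ _ hs0']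
      linear_combination (b : K) * hct'
    rw [h3, map_div₀, Valuation.map_neg, map_mul, hs0, div_one, val_eq_one_of_notMem hw hb, one_mul]
    exact hc
  let g : (integralClosure v.valuationSubring K ⧸ Ideal.span {u}) ≃ₐ[v.valuationSubring]
      IsLocalRing.ResidueField w.valuationSubring :=
    (Ideal.quotientEquivAlgOfEq v.valuationSubring hker).trans
      (Ideal.quotientKerAlgEquivOfSurjective hsurj)
  exact ⟨g.toLinearEquiv⟩

/-- A generator of the prime ideal attached to an extension `w` of `v` has value less than `1` at
`w` only, and its norm computes the local degree of `w`. -/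
theorem exists_local_parameter (hπ : IsUnif v π) {w : Valuation K ℝ≥0}
    (hw : ∀ x, w (algebraMap k K x) = v x) [v.HasExtension w] :
    ∃ u : K, w u ≠ 0 ∧ w u < 1 ∧ (∀ x ≠ 0, ∃ n : ℤ, w x = w u ^ n) ∧
      (∀ w' : Valuation K ℝ≥0, (∀ x, w' (algebraMap k K x) = v x) →
        w' u ≤ 1 ∧ (w' u < 1 → w' = w)) ∧
      w u ^ (Units.map (v : k →* ℝ≥0)).range.relIndex (Units.map (w : K →* ℝ≥0)).range = v π ∧
      v (Algebra.norm k u) = v π ^ Module.finrank (IsLocalRing.ResidueField v.valuationSubring)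
        (IsLocalRing.ResidueField w.valuationSubring) ∧
      Module.finrank (IsLocalRing.ResidueField v.valuationSubring)
        (IsLocalRing.ResidueField w.valuationSubring) ≠ 0 := by
  have hDVR := hπ.isDiscreteValuationRing
  have hD := integralClosure_isDedekindDomain (K := K) hπ
  obtain ⟨u, hu, hu'⟩ := exists_generator_centerIdeal hπ hw
  have huw : w (u : K) < 1 := by
    rw [← mem_centerIdeal hw, hu']
    exact Ideal.mem_span_singleton_self u
  have hu0 : w (u : K) ≠ 0 := by simpa using hu.ne_zero
  have hval : ∀ w' : Valuation K ℝ≥0, ∀ hw' : (∀ x, w' (algebraMap k K x) = v x),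
      centerIdeal hw' = Ideal.span {u} → ∀ (n : ℤ) (b s : integralClosure v.valuationSubring K),
      b ∉ centerIdeal hw → s ∉ centerIdeal hw → w' ((u : K) ^ n * (b : K) / s) = w' u ^ n := by
    intro w' hw' h n b s hb hs
    rw [hu', ← h] at hb hs
    rw [map_div₀, map_mul, map_zpow₀, val_eq_one_of_notMem hw' hb, val_eq_one_of_notMem hw' hs,
        mul_one, div_one]
  have hπ0 : algebraMap k K π ≠ 0 := by
    rw [map_ne_zero]
    exact fun h => hπ.1 (by simp [h])
  obtain ⟨e, b, s, hb, hs, hπe⟩ := exists_zpow_mul_div hπ hw hu hu' hπ0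
  have he : ∀ w' : Valuation K ℝ≥0, ∀ hw' : (∀ x, w' (algebraMap k K x) = v x),
      centerIdeal hw' = Ideal.span {u} → w' u ^ e = v π := by
    intro w' hw' h
    rw [← hw', hπe, hval w' hw' h e b s hb hs]
  have hgen : ∀ x ≠ 0, ∃ n : ℤ, w x = w u ^ n := by
    intro x hx
    obtain ⟨n, b, s, hb, hs, hxe⟩ := exists_zpow_mul_div hπ hw hu hu' hx
    exact ⟨n, by rw [hxe, hval w hw hu' n b s hb hs]⟩
  have he0 : 0 < e := by
    by_contra! h
    have h1 := he w hw hu'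
    have h2 : 1 ≤ w (u : K) ^ e := one_le_zpow_of_nonpos₀ (pos_iff_ne_zero.2 hu0) huw.le h
    exact (h1 ▸ h2).not_gt hπ.2.1
  obtain ⟨e, rfl⟩ := Int.eq_ofNat_of_zero_le he0.le
  simp only [zpow_natCast] at he
  refine ⟨u, hu0, huw, hgen, fun w' hw' => ⟨le_one_of_mem_integralClosure hw' u, fun h => ?_⟩, ?_, ?_⟩
  · have hmax : (centerIdeal hw).IsMaximal :=
      Ideal.IsPrime.isMaximal (centerIdeal_isPrime hw) (by
        rw [hu']
        simpa using hu.ne_zero)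
    -- If `w' u < 1`, the centre of `w'` contains the maximal ideal `(u)`, so the two centres agree.
    have hcc : centerIdeal hw = centerIdeal hw' := by
      refine hmax.eq_of_le (centerIdeal_isPrime hw').ne_top ?_
      rw [hu', Ideal.span_singleton_le_iff_mem]
      exact h
    -- Both values have `e`-th power `v π`, with `e > 0`.
    have h1 : w' (u : K) = w u :=
      (pow_left_inj₀ zero_le zero_le (by exact_mod_cast he0.ne')).1
        ((he w' hw' (hcc ▸ hu')).trans (he w hw hu').symm)
    ext x
    by_cases hx : x = 0
    · simp [hx]
    obtain ⟨n, b, s, hb, hs, hxe⟩ := exists_zpow_mul_div hπ hw hu hu' hx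
    rw [hxe, hval w hw hu' n b s hb hs, hval w' hw' (hcc ▸ hu') n b s hb hs, h1]
  · rw [ramification_eq w hπ hu0 huw hgen (he w hw hu'), he w hw hu']
  · obtain ⟨g⟩ := residue_equiv hπ hw hu hu'
    have : Module.IsTorsionFree v.valuationSubring K := .trans_faithfulSMul _ k K
    have : Module.IsTorsionFree v.valuationSubring (integralClosure v.valuationSubring K) :=
      IsIntegralClosure.isTorsionFree v.valuationSubring K
    have : Module.Free v.valuationSubring (integralClosure v.valuationSubring K) :=
      Module.free_of_finite_type_torsion_free'
    obtain ⟨n, hn, hlen⟩ := exists_associated_norm_pow_length hπ.irreducible hu.ne_zero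
    have hfin : Module.Finite (IsLocalRing.ResidueField v.valuationSubring)
        (IsLocalRing.ResidueField w.valuationSubring) := by
      have : Module.Finite v.valuationSubring (IsLocalRing.ResidueField w.valuationSubring) :=
        Module.Finite.equiv g
      exact Module.Finite.of_restrictScalars_finite v.valuationSubring _ _
    have hf : Module.finrank (IsLocalRing.ResidueField v.valuationSubring)
        (IsLocalRing.ResidueField w.valuationSubring) = n := by
      have h1 : Module.length (IsLocalRing.ResidueField v.valuationSubring)
          (IsLocalRing.ResidueField w.valuationSubring) = n := by
        rw [← hlen, g.length_eq]
        exact (Module.length_eq_of_surjective (IsLocalRing.residue_surjective)).symm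
      rw [Module.length_eq_finrank] at h1
      exact_mod_cast h1
    have hloc : IsLocalization (Algebra.algebraMapSubmonoid (integralClosure v.valuationSubring K)
        (nonZeroDivisors v.valuationSubring)) K :=
      IsIntegralClosure.isLocalization v.valuationSubring k K _
    have hnorm := Algebra.norm_localization v.valuationSubring (Rₘ := k) (Sₘ := K)
      (nonZeroDivisors v.valuationSubring) u
    change Algebra.norm k (u : K) = _ at hnorm
    refine ⟨?_, Module.finrank_pos.ne'⟩
    rw [hf, hnorm]
    obtain ⟨y, hy⟩ := hn
    have hy1 : v ((y : v.valuationSubring) : k) = 1 := (isUnit_valuationSubring_iff _).1 y.isUnit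
    have := congrArg (fun z : v.valuationSubring => v (z : k)) hy
    simp only [map_mul, MulMemClass.coe_mul, hy1, mul_one] at this
    refine this.trans ?_
    change v (π ^ n) = _
    rw [map_pow]

end Finite

end LocalDegree

/-! ### Norms in possibly inseparable extensions -/

section Norm

variable {k K Ω : Type*} [Field k] [Field K] [Algebra k K] [FiniteDimensional k K]
  [Field Ω] [Algebra k Ω]

open IntermediateField in
-- The minimal polynomial of `u` is a power of `X - u`, so every factor in the product defining the
-- norm is `u`.
lemma algebraMap_norm_of_isPurelyInseparable [IsPurelyInseparable k K] (u : K) :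
    algebraMap k K (Algebra.norm k u) = u ^ Module.finrank k K := by
  obtain ⟨n, hn⟩ := IsPurelyInseparable.minpoly_eq_X_sub_C_pow k (ringExpChar k) u
  have hu : IsIntegral k u := IsIntegral.of_finite k u
  have hdeg : (minpoly k u).natDegree = ringExpChar k ^ n := by
    rw [← Polynomial.natDegree_map (algebraMap k K), hn, Polynomial.natDegree_pow,
      Polynomial.natDegree_X_sub_C, mul_one]
  have hsplit : ((minpoly k u).map (algebraMap k K)).Splits := by
    rw [hn]
    exact (Polynomial.Splits.X_sub_C u).pow _
  rw [Algebra.norm_eq_prod_roots K hsplit, Polynomial.aroots, hn, Polynomial.roots_pow,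
    Polynomial.roots_X_sub_C, Multiset.nsmul_singleton, Multiset.prod_replicate, ← pow_mul, ← hdeg,
    ← IntermediateField.adjoin.finrank hu, Module.finrank_mul_finrank]

/-- Take the norm down to the separable closure `S`, where it is a power of `u`, and then the
product over the embeddings of `S`. Each of these extends uniquely to `K`. -/
theorem algebraMap_norm_eq_prod_pow_finInsepDegree [IsAlgClosed Ω] (u : K) :
    algebraMap k Ω (Algebra.norm k u) = (∏ σ : K →ₐ[k] Ω, σ u) ^ Field.finInsepDegree k K := by
  let S := separableClosure k K
  let r : (K →ₐ[k] Ω) → (S →ₐ[k] Ω) := fun σ => σ.comp S.val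
  have hr : Function.Bijective r := by
    obtain ⟨hinj, hsurj⟩ := IsPurelyInseparable.bijective_comp_algebraMap S K Ω
    constructor
    · intro σ τ h
      have : σ.toRingHom = τ.toRingHom := hinj (by
        ext x
        exact DFunLike.congr_fun h x)
      ext x
      exact DFunLike.congr_fun this x
    · intro τ
      obtain ⟨g, hg⟩ := hsurj τ.toRingHom
      have hg' : ∀ x : S, g (algebraMap S K x) = τ x := fun x => DFunLike.congr_fun hg x
      refine ⟨{ g with commutes' := fun a => ?_ }, ?_⟩
      · have := hg' (algebraMap k S a)
        rw [τ.commutes] at this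
        exact this
      · ext x
        exact hg' x
  have h1 : algebraMap S K (Algebra.norm S u) = u ^ Module.finrank S K :=
    algebraMap_norm_of_isPurelyInseparable u
  rw [← Algebra.norm_norm (S := S), Algebra.norm_eq_prod_embeddings k Ω,
    ← (Equiv.ofBijective r hr).prod_comp, ← Finset.prod_pow]
  refine Finset.prod_congr rfl fun σ _ => ?_
  change σ (algebraMap S K (Algebra.norm S u)) = _
  rw [h1, map_pow]
  rfl

end Norm

/-! ### Local degrees and embeddings -/

section Embeddings

variable {F : Type*} [Field F] [Fintype F]

lemma IsBasePlace.integralClosure_finite {v : Valuation (RatFunc F) ℝ≥0} (hv : IsBasePlace F v)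
    (K : Type*) [Field K] [Algebra (RatFunc F) K] [FiniteDimensional (RatFunc F) K] :
    Module.Finite v.valuationSubring (integralClosure v.valuationSubring K) := by
  obtain ⟨p, hp⟩ := CharP.exists F
  have hp' : Fact p.Prime := ⟨CharP.char_is_prime F p⟩
  have : CharP (RatFunc F) p := charP_of_injective_algebraMap (algebraMap F (RatFunc F)).injective p
  have : CharP v.valuationSubring p :=
    v.valuationSubring.subtype.charP Subtype.val_injective p
  obtain ⟨π, hπ⟩ := hv.exists_uniformizer
  have := IsUnif.isDiscreteValuationRing (v := v) hπ
  refine integralClosure_finite_of_frobenius_finite (K := RatFunc F) p ?_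
  obtain ⟨b, hb, h⟩ := hv.exists_sum_mul_pow p
  refine ringHom_finite_of_forall_eq_sum (fun i => (⟨b i, hb i⟩ : v.valuationSubring)) fun x => ?_
  obtain ⟨c, hc, hx⟩ := h x x.2
  refine ⟨fun i => ⟨c i, hc i⟩, Subtype.ext ?_⟩
  refine hx.trans ?_
  push_cast
  rfl

variable (Ω : Type*) [Field Ω] [Algebra (RatFunc F) Ω] [Algebra.IsAlgebraic (RatFunc F) Ω]

lemma BasePlace.exists_ext (v : BasePlace F) :
    ∃ w : Valuation Ω ℝ≥0, w.comap (algebraMap (RatFunc F) Ω) = v.1 := by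
  obtain ⟨π, hπ0, hπ1, -⟩ := v.2.exists_uniformizer
  exact Valuation.exists_extension v.1 ⟨π, fun h => hπ0 (by simp [h]), hπ1⟩ Ω

/-- A chosen extension of the place `v` to `Ω`. -/
def BasePlace.ext (v : BasePlace F) : Valuation Ω ℝ≥0 := (v.exists_ext Ω).choose

lemma BasePlace.ext_algebraMap (v : BasePlace F) (x : RatFunc F) :
    v.ext Ω (algebraMap (RatFunc F) Ω x) = v.1 x :=
  DFunLike.congr_fun (v.exists_ext Ω).choose_spec x

variable {Ω}
variable {K : Type*} [Field K] [Algebra (RatFunc F) K]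

/-- The place of `K` obtained from `v` and an embedding of `K` into `Ω`. -/
def placeOf (v : BasePlace F) (σ : K →ₐ[RatFunc F] Ω) : Place F K :=
  ⟨(v.ext Ω).comap σ.toRingHom, by
    convert v.2
    ext x
    change (v.ext Ω (σ (algebraMap (RatFunc F) K x)) : ℝ) = _
    rw [σ.commutes, v.ext_algebraMap Ω]⟩

lemma placeOf_apply (v : BasePlace F) (σ : K →ₐ[RatFunc F] Ω) (y : K) :
    (placeOf v σ).1 y = v.ext Ω (σ y) := rfl

lemma placeOf_base (v : BasePlace F) (σ : K →ₐ[RatFunc F] Ω) : (placeOf v σ).base = v.1 := by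
  ext x
  change (v.ext Ω (σ (algebraMap (RatFunc F) K x)) : ℝ) = _
  rw [σ.commutes, v.ext_algebraMap Ω]

variable [IsAlgClosed Ω] [FiniteDimensional (RatFunc F) K]

-- Let `u` be a local parameter at `w`, of value one at every other place above `v`. As the product
-- of the conjugates of `u`, raised to the inseparable degree, the norm has value `w u` to the power
-- (inseparable degree) × (number of embeddings inducing `w`). It also has value `v π ^ f = w u ^ (e
-- f)`, and `w u < 1` allows the exponents to be compared.
open scoped Classical in
theorem Place.localDegree_eq (w : Place F K) (v : BasePlace F) (hv : w.base = v.1) :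
    w.localDegree = Field.finInsepDegree (RatFunc F) K *
      (Finset.univ.filter fun σ : K →ₐ[RatFunc F] Ω => placeOf v σ = w).card ∧
    w.localDegree ≠ 0 := by
  obtain ⟨π, hπ⟩ := v.2.exists_uniformizer
  rw [← hv] at hπ
  have hfin := v.2.integralClosure_finite K
  rw [← hv] at hfin
  obtain ⟨u, hu0, hu1, -, huniq, he, hf, hf0⟩ := exists_local_parameter (v := w.base) (w := w.1) hπ
    (fun x => rfl)
  change w.1 u ^ w.ramificationIdx = w.base π at he
  change w.base (Algebra.norm (RatFunc F) u) = w.base π ^ w.inertiaDeg at hf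
  have he0 : w.ramificationIdx ≠ 0 := by
    intro h
    rw [h, pow_zero] at he
    exact hπ.2.1.ne he.symm
  have hplace : ∀ σ : K →ₐ[RatFunc F] Ω, v.ext Ω (σ u) = if placeOf v σ = w then w.1 u else 1 := by
    intro σ
    have h1 := huniq (placeOf v σ).1 (fun x => by
      change (placeOf v σ).base x = w.base x
      rw [placeOf_base, hv])
    split_ifs with h
    · rw [← placeOf_apply, h]
    · exact le_antisymm h1.1 (not_lt.1 fun h' => h (Subtype.ext (h1.2 h')))
  have hnorm : w.base (Algebra.norm (RatFunc F) u) = w.1 u ^ (Field.finInsepDegree (RatFunc F) K *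
      (Finset.univ.filter fun σ : K →ₐ[RatFunc F] Ω => placeOf v σ = w).card) := by
    rw [hv, ← v.ext_algebraMap Ω, algebraMap_norm_eq_prod_pow_finInsepDegree, map_pow, map_prod,
      Finset.prod_congr rfl fun σ _ => hplace σ, Finset.prod_ite, Finset.prod_const,
      Finset.prod_const_one, mul_one, ← pow_mul, mul_comm]
  refine ⟨?_, mul_ne_zero he0 hf0⟩
  refine pow_right_injective₀ (pos_iff_ne_zero.2 hu0) hu1.ne ?_
  change w.1 u ^ (w.ramificationIdx * w.inertiaDeg) = _
  rw [pow_mul, he, ← hf, hnorm]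

lemma Place.exists_eq_placeOf (w : Place F K) (v : BasePlace F) (hv : w.base = v.1) :
    ∃ σ : K →ₐ[RatFunc F] Ω, placeOf v σ = w := by
  classical
  obtain ⟨h1, h2⟩ := w.localDegree_eq (Ω := Ω) v hv
  by_contra! h
  rw [h1, Finset.card_eq_zero.2 (Finset.filter_eq_empty_iff.2 fun σ _ => h σ), mul_zero] at h2
  exact h2 rfl

end Embeddings

/-! ### Valuations of polynomial values -/

section PolynomialValues

variable {Ω : Type*} [Field Ω] (w : Valuation Ω ℝ≥0)

lemma val_eval_le {P : Polynomial Ω} {B : ℝ≥0} (hB : ∀ i, w (P.coeff i) ≤ B) {n : ℕ}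
    (hn : P.natDegree ≤ n) (z : Ω) : w (P.eval z) ≤ B * max 1 (w z) ^ n := by
  rw [Polynomial.eval_eq_sum_range' (Nat.lt_succ_of_le hn)]
  refine Valuation.map_sum_le w fun i hi => ?_
  rw [map_mul, map_pow]
  refine mul_le_mul' (hB i) ?_
  calc w z ^ i ≤ max 1 (w z) ^ i := by gcongr; exact le_max_right _ _
    _ ≤ max 1 (w z) ^ n := pow_le_pow_right₀ (le_max_left _ _) (by
      have := Finset.mem_range.1 hi
      omega)

/-- If `|z| > 1`, the leading term `z ^ n` of a monic integral polynomial strictly dominates all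
others. -/
lemma val_le_one_of_root {P : Polynomial Ω} (hP : P.Monic) (hB : ∀ i, w (P.coeff i) ≤ 1) {z : Ω}
    (hz : P.eval z = 0) : w z ≤ 1 := by
  by_contra! h
  have hd : 0 < P.natDegree := by
    by_contra! h0
    rw [Polynomial.eq_one_of_monic_natDegree_zero hP (by omega)] at hz
    simp at hz
  have h1 : z ^ P.natDegree = - P.eraseLead.eval z := by
    have := congrArg (Polynomial.eval z) P.eraseLead_add_monomial_natDegree_leadingCoeff
    rw [Polynomial.eval_add, hz, Polynomial.eval_monomial, hP.leadingCoeff, one_mul] at this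
    exact eq_neg_of_add_eq_zero_right this
  have h2 := val_eval_le w (P := P.eraseLead) (B := 1) (fun i => by
    rw [Polynomial.eraseLead_coeff]
    split_ifs
    · simp
    · exact hB i) (Polynomial.eraseLead_natDegree_le P) z
  rw [← Valuation.map_neg, ← h1, map_pow, one_mul, max_eq_right h.le] at h2
  exact h2.not_gt (pow_lt_pow_right₀ h (by omega))

end PolynomialValues

/-! ### Heights as averages over embeddings -/

section Heights

variable {F : Type*} [Field F] [Fintype F]
variable {Ω : Type*} [Field Ω] [Algebra (RatFunc F) Ω] [Algebra.IsAlgebraic (RatFunc F) Ω]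

variable (F) in
-- Outside the places where some coefficient of the minimal polynomial of `z` is not integral, `z`
-- is integral.
lemma BasePlace.finite_one_lt_ext (z : Ω) : {v : BasePlace F | 1 < v.ext Ω z}.Finite := by
  have hInt : IsIntegral (RatFunc F) z := Algebra.IsIntegral.isIntegral z
  have hfin : (⋃ i ∈ Finset.range ((minpoly (RatFunc F) z).natDegree + 1),
      {v : BasePlace F | 1 < v.1 ((minpoly (RatFunc F) z).coeff i)}).Finite := by
    refine Set.Finite.biUnion (Finset.finite_toSet _) fun i _ => ?_
    by_cases h : (minpoly (RatFunc F) z).coeff i = 0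
    · simp [h]
    · exact (BasePlace.finite_ne_one h).subset fun v hv => hv.ne'
  refine hfin.subset fun v hv => ?_
  by_contra h
  simp only [Set.mem_iUnion, not_exists, Set.mem_ofPred_eq, not_lt] at h
  change 1 < v.ext Ω z at hv
  refine absurd hv (not_lt.2 ?_)
  refine val_le_one_of_root (v.ext Ω) ((minpoly.monic hInt).map (algebraMap (RatFunc F) Ω))
    (fun i => ?_) (by rw [Polynomial.eval_map_algebraMap, minpoly.aeval])
  rw [Polynomial.coeff_map, v.ext_algebraMap Ω]
  by_cases hi : i ∈ Finset.range ((minpoly (RatFunc F) z).natDegree + 1)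
  · exact h i hi
  · rw [Polynomial.coeff_eq_zero_of_natDegree_lt (by
      rw [Finset.mem_range] at hi
      omega), map_zero]
    exact zero_le

variable (F) in
/-- The positive part of the logarithm of the absolute value. -/
def logp (q : ℕ) (a : ℝ≥0) : ℝ := max 0 (Real.logb q a)

variable {K : Type*} [Field K] [Algebra (RatFunc F) K] [IsAlgClosed Ω]
  [FiniteDimensional (RatFunc F) K]

lemma logp_nonneg (q : ℕ) (a : ℝ≥0) : 0 ≤ logp q a := le_max_left _ _

lemma logp_of_le_one {q : ℕ} (hq : 1 < q) {a : ℝ≥0} (ha : a ≤ 1) : logp q a = 0 := by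
  refine max_eq_left (Real.logb_nonpos (by exact_mod_cast hq) a.2 (by exact_mod_cast ha))

variable (Ω) in
/-- The height of a point as an average over the embeddings into `Ω`. -/
theorem height_eq {ι : Type*} [Finite ι] (y : ι → K) :
    height F y = (Field.finSepDegree (RatFunc F) K : ℝ)⁻¹ * ∑ᶠ v : BasePlace F,
      ∑ σ : K →ₐ[RatFunc F] Ω, ⨆ i, logp (Fintype.card F) (v.ext Ω (σ (y i))) := by
  classical
  set φ : Place F K → ℝ := fun w => ⨆ i, logp (Fintype.card F) (w.1 (y i)) with hφ
  have hφ' : ∀ w : Place F K, (⨆ i, max 0 (-w.val (y i))) = φ w := fun w => by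
    simp only [hφ, logp, Place.val, neg_neg]
  have hfin : (⋃ (σ : K →ₐ[RatFunc F] Ω) (i : ι), {v : BasePlace F | 1 < v.ext Ω (σ (y i))}).Finite :=
    Set.finite_iUnion fun σ => Set.finite_iUnion fun i => BasePlace.finite_one_lt_ext F _
  set S : Finset (BasePlace F) := hfin.toFinset with hS
  have hzero : ∀ v ∉ S, ∀ σ : K →ₐ[RatFunc F] Ω, φ (placeOf v σ) = 0 := by
    intro v hv σ
    simp only [hS, Set.Finite.mem_toFinset, Set.mem_iUnion, not_exists, Set.mem_ofPred_eq,
      not_lt] at hv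
    simp only [hφ, placeOf_apply]
    simp [logp_of_le_one Fintype.one_lt_card (hv σ _)]
  set T : Finset (Place F K) :=
    (S ×ˢ (Finset.univ : Finset (K →ₐ[RatFunc F] Ω))).image fun t => placeOf t.1 t.2 with hT
  have hL : ∑ᶠ w : Place F K, (w.localDegree : ℝ) * φ w = ∑ w ∈ T, (w.localDegree : ℝ) * φ w := by
    refine finsum_eq_sum_of_support_subset _ fun w hw => ?_
    obtain ⟨σ, hσ⟩ := w.exists_eq_placeOf (Ω := Ω) ⟨w.base, w.2⟩ rfl
    rw [Finset.mem_coe, hT, Finset.mem_image]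
    refine ⟨(⟨w.base, w.2⟩, σ), ?_, hσ⟩
    rw [Finset.mem_product]
    refine ⟨?_, Finset.mem_univ _⟩
    by_contra h
    refine hw ?_
    dsimp only
    rw [← hσ, hzero _ h σ, mul_zero]
  have hR : ∑ᶠ v : BasePlace F, ∑ σ : K →ₐ[RatFunc F] Ω, φ (placeOf v σ) =
      ∑ v ∈ S, ∑ σ : K →ₐ[RatFunc F] Ω, φ (placeOf v σ) := by
    refine finsum_eq_sum_of_support_subset _ fun v hv => ?_
    by_contra h
    exact hv (Finset.sum_eq_zero fun σ _ => hzero v h σ)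
  -- Group the pairs `(v, σ)` by the place they induce: the fibre above `w` has as many elements as
  -- the local degree divided by the inseparable degree.
  have hmain : ∑ w ∈ T, (w.localDegree : ℝ) * φ w = (Field.finInsepDegree (RatFunc F) K : ℝ) *
      ∑ v ∈ S, ∑ σ : K →ₐ[RatFunc F] Ω, φ (placeOf v σ) := by
    rw [← Finset.sum_product', ← Finset.sum_fiberwise_of_maps_to (t := T)
      (g := fun t : BasePlace F × (K →ₐ[RatFunc F] Ω) => placeOf t.1 t.2)
      (fun t ht => Finset.mem_image_of_mem _ ht), Finset.mul_sum]
    refine Finset.sum_congr rfl fun w hw => ?_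
    obtain ⟨⟨v, σ⟩, hvσ, rfl⟩ := Finset.mem_image.1 hw
    rw [Finset.mem_product] at hvσ
    have hb := placeOf_base v σ
    rw [((placeOf v σ).localDegree_eq (Ω := Ω) v hb).1, Finset.sum_congr rfl
      (g := fun _ => φ (placeOf v σ)) (fun t ht => by rw [(Finset.mem_filter.1 ht).2]),
      Finset.sum_const, nsmul_eq_mul, Nat.cast_mul, mul_assoc]
    congr 3
    refine Finset.card_nbij' (fun τ => (v, τ)) (fun t => t.2) ?_ ?_ ?_ ?_
    · intro τ hτ
      simpa [hvσ.1] using hτ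
    · rintro ⟨v', τ⟩ hτ
      simp only [Finset.coe_filter, Finset.mem_product, Finset.mem_univ, and_true,
        Set.mem_ofPred_eq, true_and] at hτ ⊢
      have : v' = v := Subtype.ext (by rw [← placeOf_base v' τ, hτ.2, hb])
      rw [← this]
      rw [← this] at hτ
      exact hτ.2
    · intro τ _
      rfl
    · rintro ⟨v', τ⟩ hτ
      simp only [Finset.coe_filter, Finset.mem_product, Finset.mem_univ, and_true,
        Set.mem_ofPred_eq] at hτ
      have : v' = v := Subtype.ext (by rw [← placeOf_base v' τ, hτ.2, hb])
      rw [this]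
  unfold height
  simp only [hφ']
  rw [hL, hmain, ← hR]
  have hdeg : (Module.finrank (RatFunc F) K : ℝ) = Field.finSepDegree (RatFunc F) K *
      Field.finInsepDegree (RatFunc F) K := by
    exact_mod_cast (Field.finSepDegree_mul_finInsepDegree (RatFunc F) K).symm
  have h0 : (Module.finrank (RatFunc F) K : ℝ) ≠ 0 := by
    exact_mod_cast (Module.finrank_pos (R := RatFunc F) (M := K)).ne'
  rw [hdeg] at h0 ⊢
  have := right_ne_zero_of_mul h0
  rw [mul_inv, mul_assoc, inv_mul_cancel_left₀ this]
  simp only [hφ, placeOf_apply]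

end Heights

/-! ### Averages over the places of a finite extension -/

section Average

variable {F : Type*} [Field F] [Fintype F]
variable {Ω : Type*} [Field Ω] [Algebra (RatFunc F) Ω] [Algebra.IsAlgebraic (RatFunc F) Ω]
  [IsAlgClosed Ω]

instance normal_of_isAlgClosed : Normal (RatFunc F) Ω :=
  normal_iff.2 fun x => ⟨Algebra.IsIntegral.isIntegral x, IsAlgClosed.splits _⟩

variable (M : IntermediateField (RatFunc F) Ω)

/-- Pairs of a place of `k` and an embedding of `M`: the places of `M`, with repetitions. -/
abbrev GPlace := BasePlace F × (M →ₐ[RatFunc F] Ω)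

variable {M}

/-- A valuation of `Ω` inducing the given place of `M`. -/
def GPlace.val (p : GPlace M) : Valuation Ω ℝ≥0 :=
  (p.1.ext Ω).comap (p.2.liftNormal Ω).toRingHom

lemma GPlace.val_apply (p : GPlace M) (y : Ω) : p.val y = p.1.ext Ω (p.2.liftNormal Ω y) := rfl

lemma GPlace.val_coe (p : GPlace M) (y : M) : p.val (y : Ω) = p.1.ext Ω (p.2 y) := by
  rw [p.val_apply]
  exact congrArg _ (p.2.liftNormal_commutes Ω y)

lemma GPlace.val_algebraMap (p : GPlace M) (y : RatFunc F) :
    p.val (algebraMap (RatFunc F) Ω y) = p.1.1 y := by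
  rw [p.val_apply, AlgHom.commutes, p.1.ext_algebraMap Ω]

variable [FiniteDimensional (RatFunc F) M]

/-- The normalized sum over the places of `M` above the places in `S`. -/
def avg (S : Finset (BasePlace F)) (φ : GPlace M → ℝ) : ℝ :=
  (Fintype.card (M →ₐ[RatFunc F] Ω) : ℝ)⁻¹ * ∑ v ∈ S, ∑ τ, φ (v, τ)

variable {S : Finset (BasePlace F)} {φ ψ : GPlace M → ℝ}

lemma avg_mono (h : ∀ p : GPlace M, p.1 ∈ S → φ p ≤ ψ p) : avg S φ ≤ avg S ψ := by
  unfold avg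
  gcongr with v hv τ
  exact h _ hv

lemma avg_add : avg S (fun p => φ p + ψ p) = avg S φ + avg S ψ := by
  simp only [avg, Finset.sum_add_distrib, mul_add]

lemma avg_const_mul (a : ℝ) : avg S (fun p => a * φ p) = a * avg S φ := by
  simp only [avg, ← Finset.mul_sum]
  ring

lemma avg_sub : avg S (fun p => φ p - ψ p) = avg S φ - avg S ψ := by
  simp only [avg, Finset.sum_sub_distrib, mul_sub]

lemma avg_sum {ι : Type*} (s : Finset ι) (f : ι → GPlace M → ℝ) :
    avg S (fun p => ∑ i ∈ s, f i p) = ∑ i ∈ s, avg S (f i) := by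
  classical
  induction s using Finset.induction_on with
  | empty => simp [avg]
  | insert a s ha ih => simp only [Finset.sum_insert ha, avg_add, ih]

lemma card_algHom_ne_zero : (Fintype.card (M →ₐ[RatFunc F] Ω) : ℝ) ≠ 0 := by
  have : Nonempty (M →ₐ[RatFunc F] Ω) := ⟨M.val⟩
  exact_mod_cast Fintype.card_ne_zero

open scoped Classical in
lemma avg_ite_eq {v : BasePlace F} (hv : v ∈ S) (a : ℝ) :
    avg S (fun p : GPlace M => if p.1 = v then a else 0) = a := by
  unfold avg
  rw [Finset.sum_eq_single v]
  · simp only [if_true, Finset.sum_const, Finset.card_univ, nsmul_eq_mul]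
    rw [inv_mul_cancel_left₀ card_algHom_ne_zero]
  · intro u _ hu
    simp [hu]
  · exact fun h => absurd hv h

/-- The product formula. -/
theorem exists_avg_log_eq_zero {u : Ω} (hu : u ∈ M) (hu0 : u ≠ 0) :
    ∃ S₀ : Finset (BasePlace F), ∀ S, S₀ ⊆ S →
      avg S (fun p : GPlace M => Real.logb (Fintype.card F) (p.val u)) = 0 := by
  set y : M := ⟨u, hu⟩ with hy
  have hy0 : y ≠ 0 := fun h => hu0 (congrArg Subtype.val h)
  have hN : Algebra.norm (RatFunc F) y ≠ 0 := Algebra.norm_ne_zero_iff.2 hy0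
  refine ⟨(BasePlace.finite_support_log hN).toFinset, fun S hS => ?_⟩
  have hins : (Field.finInsepDegree (RatFunc F) M : ℝ) ≠ 0 := by
    have h := Field.finSepDegree_mul_finInsepDegree (RatFunc F) M
    have h' := (Module.finrank_pos (R := RatFunc F) (M := M)).ne'
    rw [← h] at h'
    exact_mod_cast right_ne_zero_of_mul h'
  have key : ∀ v : BasePlace F, (Field.finInsepDegree (RatFunc F) M : ℝ) *
      ∑ τ : M →ₐ[RatFunc F] Ω, Real.logb (Fintype.card F) (GPlace.val (v, τ) u) =
      v.log (Algebra.norm (RatFunc F) y) := by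
    intro v
    have h := algebraMap_norm_eq_prod_pow_finInsepDegree (Ω := Ω) (k := RatFunc F) y
    have h2 : v.1 (Algebra.norm (RatFunc F) y) =
        (∏ τ : M →ₐ[RatFunc F] Ω, GPlace.val (v, τ) u) ^ Field.finInsepDegree (RatFunc F) M := by
      rw [← v.ext_algebraMap Ω, h, map_pow, map_prod]
      congr 1
      exact Finset.prod_congr rfl fun τ _ => (GPlace.val_coe (v, τ) y).symm
    unfold BasePlace.log
    rw [h2, NNReal.coe_pow, NNReal.coe_prod, Real.logb_pow, Real.logb_prod]
    intro τ _
    exact_mod_cast (Valuation.ne_zero_iff _).2 hu0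
  have h3 : ∑ v ∈ S, v.log (Algebra.norm (RatFunc F) y) = 0 := by
    rw [← finsum_log_eq_zero hN]
    refine (finsum_eq_sum_of_support_subset _ fun v hv => ?_).symm
    exact hS ((Set.Finite.mem_toFinset _).2 hv)
  simp only [← key, ← Finset.mul_sum] at h3
  unfold avg
  rw [(mul_eq_zero.1 h3).resolve_left hins, mul_zero]

/-- Averages over the embeddings of `M` and of a subfield `K` agree. -/
lemma inv_card_mul_sum_restrict {K : IntermediateField (RatFunc F) Ω} (hKM : K ≤ M)
    [FiniteDimensional (RatFunc F) K] (f : (K →ₐ[RatFunc F] Ω) → ℝ) :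
    (Fintype.card (M →ₐ[RatFunc F] Ω) : ℝ)⁻¹ * ∑ τ : M →ₐ[RatFunc F] Ω,
      f (τ.comp (IntermediateField.inclusion hKM)) =
    (Fintype.card (K →ₐ[RatFunc F] Ω) : ℝ)⁻¹ * ∑ σ, f σ := by
  classical
  let g : (M →ₐ[RatFunc F] Ω) → (K →ₐ[RatFunc F] Ω) :=
    fun τ => τ.comp (IntermediateField.inclusion hKM)
  let n : (K →ₐ[RatFunc F] Ω) → ℕ := fun σ => (Finset.univ.filter fun τ => g τ = σ).card
  -- Automorphisms of `Ω` permute the embeddings of `K` transitively, so every embedding of `K` has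
  -- the same number of extensions to `M`.
  have hle : ∀ σ σ', n σ ≤ n σ' := by
    intro σ σ'
    obtain ⟨γ, hγ⟩ : ∃ γ : Ω →ₐ[RatFunc F] Ω, ∀ y, γ (σ y) = σ' y := by
      have hb := AlgHom.normal_bijective (RatFunc F) Ω Ω (σ.liftNormal Ω)
      let e := AlgEquiv.ofBijective _ hb
      refine ⟨(σ'.liftNormal Ω).comp e.symm.toAlgHom, fun y => ?_⟩
      have h1 : e ((algebraMap K Ω) y) = σ y := σ.liftNormal_commutes Ω y
      have h2 : e.symm (σ y) = (algebraMap K Ω) y := by rw [← h1, e.symm_apply_apply]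
      change σ'.liftNormal Ω (e.symm (σ y)) = _
      rw [h2]
      exact σ'.liftNormal_commutes Ω y
    refine Finset.card_le_card_of_injOn (fun τ => γ.comp τ) ?_ ?_
    · intro τ hτ
      simp only [Finset.coe_filter, Finset.mem_univ, true_and, Set.mem_ofPred_eq] at hτ ⊢
      refine AlgHom.ext fun y => ?_
      rw [← hγ y, ← hτ]
      rfl
    · intro τ _ τ' _ h
      refine AlgHom.ext fun y => γ.toRingHom.injective ?_
      exact DFunLike.congr_fun h y
  have hn : ∀ σ σ', n σ = n σ' := fun σ σ' => le_antisymm (hle _ _) (hle _ _)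
  have hsum : ∀ f : (K →ₐ[RatFunc F] Ω) → ℝ, ∑ τ, f (g τ) = n K.val * ∑ σ, f σ := by
    intro f
    rw [← Finset.sum_fiberwise Finset.univ g, Finset.mul_sum]
    refine Finset.sum_congr rfl fun σ _ => ?_
    rw [Finset.sum_congr rfl (g := fun _ => f σ)
      (fun τ hτ => by rw [(Finset.mem_filter.1 hτ).2]), Finset.sum_const, nsmul_eq_mul]
    rw [show (Finset.univ.filter fun τ => g τ = σ).card = n K.val from hn σ _]
  have hcard := hsum fun _ => 1
  simp only [Finset.sum_const, Finset.card_univ, nsmul_eq_mul, mul_one] at hcard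
  have hM := card_algHom_ne_zero (M := M)
  change _ * ∑ τ, f (g τ) = _
  rw [hsum f, hcard]
  rw [hcard] at hM
  have := left_ne_zero_of_mul hM
  have := right_ne_zero_of_mul hM
  field_simp

variable {K : IntermediateField (RatFunc F) Ω} {ι : Type*} [Finite ι]

lemma iSup_logp_nonneg (p : GPlace M) (y : ι → Ω) :
    0 ≤ ⨆ i, logp (Fintype.card F) (p.val (y i)) :=
  Real.iSup_nonneg fun _ => logp_nonneg _ _

lemma height_eq_finsum (hKM : K ≤ M) [FiniteDimensional (RatFunc F) K] (y : ι → K) :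
    height F y = ∑ᶠ v : BasePlace F, (Fintype.card (M →ₐ[RatFunc F] Ω) : ℝ)⁻¹ *
      ∑ τ : M →ₐ[RatFunc F] Ω, ⨆ i, logp (Fintype.card F) (GPlace.val (v, τ) (y i : Ω)) := by
  rw [height_eq Ω, Field.finSepDegree_eq_of_isAlgClosed (RatFunc F) K Ω, Nat.card_eq_fintype_card,
    mul_finsum]
  refine finsum_congr fun v => ?_
  rw [← inv_card_mul_sum_restrict hKM]
  congr 1
  refine Finset.sum_congr rfl fun τ _ => ?_
  congr 1
  funext i
  rw [show (y i : Ω) = ((IntermediateField.inclusion hKM (y i) : M) : Ω) from rfl,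
    GPlace.val_coe (v, τ)]
  rfl

lemma avg_eq_sum : avg S φ = ∑ v ∈ S, (Fintype.card (M →ₐ[RatFunc F] Ω) : ℝ)⁻¹ *
    ∑ τ, φ (v, τ) := by
  rw [avg, Finset.mul_sum]

lemma finite_support_iSup_logp (y : ι → Ω) : (Function.support fun v : BasePlace F =>
    (Fintype.card (M →ₐ[RatFunc F] Ω) : ℝ)⁻¹ *
      ∑ τ : M →ₐ[RatFunc F] Ω, ⨆ i, logp (Fintype.card F) (GPlace.val (v, τ) (y i))).Finite := by
  have hfin : (⋃ (τ : M →ₐ[RatFunc F] Ω) (i : ι),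
      {v : BasePlace F | 1 < v.ext Ω (τ.liftNormal Ω (y i))}).Finite :=
    Set.finite_iUnion fun σ => Set.finite_iUnion fun i => BasePlace.finite_one_lt_ext F _
  refine hfin.subset fun v hv => ?_
  by_contra h
  simp only [Set.mem_iUnion, not_exists, Set.mem_ofPred_eq, not_lt] at h
  refine hv ?_
  simp only [GPlace.val_apply, logp_of_le_one Fintype.one_lt_card (h _ _)]
  simp

/-- The height is the average over a sufficiently large set of places. -/
theorem exists_height_eq_avg (hKM : K ≤ M) [FiniteDimensional (RatFunc F) K] (y : ι → K) :
    ∃ S₀ : Finset (BasePlace F), ∀ S, S₀ ⊆ S → height F y =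
      avg S fun p : GPlace M => ⨆ i, logp (Fintype.card F) (p.val (y i : Ω)) := by
  refine ⟨(finite_support_iSup_logp (M := M) fun i => (y i : Ω)).toFinset, fun S hS => ?_⟩
  rw [height_eq_finsum hKM, avg_eq_sum]
  exact finsum_eq_sum_of_support_subset _ fun v hv => hS ((Set.Finite.mem_toFinset _).2 hv)

theorem avg_le_height (hKM : K ≤ M) [FiniteDimensional (RatFunc F) K] (y : ι → K)
    (S : Finset (BasePlace F)) :
    avg S (fun p : GPlace M => ⨆ i, logp (Fintype.card F) (p.val (y i : Ω))) ≤ height F y := by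
  classical
  obtain ⟨S₀, h⟩ := exists_height_eq_avg hKM y
  rw [h (S ∪ S₀) Finset.subset_union_right, avg_eq_sum, avg_eq_sum]
  refine Finset.sum_le_sum_of_subset_of_nonneg Finset.subset_union_left fun v _ _ => ?_
  exact mul_nonneg (by positivity) (Finset.sum_nonneg fun τ _ => iSup_logp_nonneg _ _)

open IntermediateField in
theorem exists_weilHeight_eq_avg {y : Ω} (hy : y ∈ M) :
    ∃ S₀ : Finset (BasePlace F), ∀ S, S₀ ⊆ S → weilHeight F y =
      avg S fun p : GPlace M => logp (Fintype.card F) (p.val y) := by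
  have hle : (RatFunc F)⟮y⟯ ≤ M := adjoin_simple_le_iff.2 hy
  have : FiniteDimensional (RatFunc F) (RatFunc F)⟮y⟯ :=
    adjoin.finiteDimensional (Algebra.IsIntegral.isIntegral y)
  obtain ⟨S₀, h⟩ := exists_height_eq_avg hle
    (fun _ : Unit => AdjoinSimple.gen (RatFunc F) y)
  refine ⟨S₀, fun S hS => ?_⟩
  rw [weilHeight, h S hS]
  simp only [AdjoinSimple.coe_gen, ciSup_const]

open IntermediateField in
theorem avg_le_weilHeight {y : Ω} (hy : y ∈ M) (S : Finset (BasePlace F)) :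
    avg S (fun p : GPlace M => logp (Fintype.card F) (p.val y)) ≤ weilHeight F y := by
  have hle : (RatFunc F)⟮y⟯ ≤ M := adjoin_simple_le_iff.2 hy
  have : FiniteDimensional (RatFunc F) (RatFunc F)⟮y⟯ :=
    adjoin.finiteDimensional (Algebra.IsIntegral.isIntegral y)
  have h := avg_le_height hle (fun _ : Unit => AdjoinSimple.gen (RatFunc F) y) S
  simp only [AdjoinSimple.coe_gen, ciSup_const] at h
  exact h

lemma weilHeight_nonneg (y : Ω) : 0 ≤ weilHeight F y := by
  unfold weilHeight height
  refine mul_nonneg (by positivity) (finsum_nonneg fun w => mul_nonneg (by positivity) ?_)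
  exact Real.iSup_nonneg fun _ => le_max_left _ _

/-- Finitely many elements of `Ω` lie in a finite normal extension of `k`. -/
lemma exists_normal_finiteDimensional (s : Set Ω) (hs : s.Finite) :
    ∃ M : IntermediateField (RatFunc F) Ω, s ⊆ M ∧ FiniteDimensional (RatFunc F) M ∧
      Normal (RatFunc F) M := by
  have := hs.to_subtype
  have : FiniteDimensional (RatFunc F) (IntermediateField.adjoin (RatFunc F) s) :=
    IntermediateField.finiteDimensional_adjoin fun y _ => Algebra.IsIntegral.isIntegral y
  refine ⟨IntermediateField.normalClosure (RatFunc F) (IntermediateField.adjoin (RatFunc F) s) Ω,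
    fun y hy => ?_, inferInstance, inferInstance⟩
  exact IntermediateField.le_normalClosure _ (IntermediateField.subset_adjoin _ _ hy)

lemma apply_mem_of_normal [Normal (RatFunc F) M] (γ : Ω ≃ₐ[RatFunc F] Ω) {y : Ω} (hy : y ∈ M) :
    γ y ∈ M := by
  have h := γ.restrictNormal_commutes M ⟨y, hy⟩
  rw [show γ y = _ from h.symm]
  exact SetLike.coe_mem _

/-- Conjugate elements have the same height. -/
theorem weilHeight_conj (γ : Ω ≃ₐ[RatFunc F] Ω) (y : Ω) : weilHeight F (γ y) = weilHeight F y := by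
  classical
  obtain ⟨M, hM, _, _⟩ := exists_normal_finiteDimensional (F := F) {y} (Set.finite_singleton y)
  have hy : y ∈ M := hM rfl
  have hγ := apply_mem_of_normal γ hy
  obtain ⟨S₁, h₁⟩ := exists_weilHeight_eq_avg hy
  obtain ⟨S₂, h₂⟩ := exists_weilHeight_eq_avg hγ
  rw [h₁ (S₁ ∪ S₂) Finset.subset_union_left, h₂ (S₁ ∪ S₂) Finset.subset_union_right]
  unfold avg
  congr 1
  refine Finset.sum_congr rfl fun v _ => ?_
  refine Fintype.sum_equiv
    ⟨fun τ => τ.comp (γ.restrictNormal M).toAlgHom, fun τ => τ.comp (γ.restrictNormal M).symm.toAlgHom,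
      fun τ => ?_, fun τ => ?_⟩ _ _ fun τ => ?_
  · ext z; simp
  · ext z; simp
  · have e1 := GPlace.val_coe (v, τ) ⟨γ y, hγ⟩
    have e2 := GPlace.val_coe (v, τ.comp (γ.restrictNormal M).toAlgHom) ⟨y, hy⟩
    dsimp only at e1 e2 ⊢
    have e3 : γ.restrictNormal M ⟨y, hy⟩ = ⟨γ y, hγ⟩ :=
      Subtype.ext (γ.restrictNormal_commutes M ⟨y, hy⟩)
    change _ = logp _ (GPlace.val (v, τ.comp (γ.restrictNormal M).toAlgHom) y)
    rw [e1, e2, AlgHom.comp_apply]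
    exact congrArg _ (congrArg _ (congrArg τ e3.symm))

end Average

/-! ### The positive part of the logarithm -/

section Logp

variable {q : ℕ}

lemma logp_eq_logb_max (hq : 1 < q) (a : ℝ≥0) : logp q a = Real.logb q (max 1 a : ℝ≥0) := by
  have hq' : (1 : ℝ) < q := by exact_mod_cast hq
  rcases le_total a 1 with h | h
  · rw [logp_of_le_one hq h, max_eq_left h]
    simp
  · rw [max_eq_right h]
    exact max_eq_right (Real.logb_nonneg hq' (by exact_mod_cast h))

lemma logb_le_logb_coe (hq : 1 < q) {a b : ℝ≥0} (ha : a ≠ 0) (h : a ≤ b) :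
    Real.logb q a ≤ Real.logb q b :=
  Real.logb_le_logb_of_le (by exact_mod_cast hq) (by exact_mod_cast pos_iff_ne_zero.2 ha)
    (by exact_mod_cast h)

lemma logb_le_logp (q : ℕ) (a : ℝ≥0) : Real.logb q a ≤ logp q a := le_max_right _ _

lemma logp_mono (hq : 1 < q) {a b : ℝ≥0} (h : a ≤ b) : logp q a ≤ logp q b := by
  rw [logp_eq_logb_max hq, logp_eq_logb_max hq]
  exact logb_le_logb_coe hq (lt_of_lt_of_le one_pos (le_max_left _ _)).ne' (max_le_max_left _ h)

lemma logp_inv (q : ℕ) (a : ℝ≥0) : logp q a⁻¹ = logp q a - Real.logb q a := by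
  unfold logp
  rw [NNReal.coe_inv, Real.logb_inv]
  rcases le_total (Real.logb q a) 0 with h | h
  · rw [max_eq_left h, max_eq_right (by linarith)]
    ring
  · rw [max_eq_right h, max_eq_left (by linarith)]
    ring

end Logp

/-! ### Valuations are trivial on the constants -/

section Constants

variable {F : Type*} [Field F] [Fintype F] {Ω : Type*} [Field Ω] [Algebra F Ω] (w : Valuation Ω ℝ≥0)

lemma val_algebraMap_eq_one {a : F} (ha : a ≠ 0) : w (algebraMap F Ω a) = 1 := by
  have h := congrArg (fun t => w (algebraMap F Ω t)) (FiniteField.pow_card_sub_one_eq_one a ha)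
  simp only [map_pow, map_one] at h
  exact (pow_eq_one_iff.1 h).resolve_right (by have := Fintype.one_lt_card (α := F); omega)

lemma val_smul_le (a : F) (y : Ω) : w (a • y) ≤ w y := by
  rcases eq_or_ne a 0 with rfl | ha
  · simp
  · rw [Algebra.smul_def, map_mul, val_algebraMap_eq_one w ha, one_mul]

end Constants

namespace DrinfeldModule

variable {F : Type*} [Field F] [Fintype F] {Ω : Type*} [Field Ω] [Algebra (RatFunc F) Ω]
  {d : ℕ} (Φ : DrinfeldModule F Ω d)

/-! ### The action -/

section Action

variable [Algebra F Ω]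

lemma action_X_apply (y : Ω) :
    Φ.action Polynomial.X y = ∑ i, Φ.coeff i * y ^ Fintype.card F ^ (i : ℕ) := by
  have hf : ∀ (n : ℕ) (y : Ω), ((FiniteField.frobeniusAlgHom F Ω).toLinearMap ^ n) y =
      y ^ Fintype.card F ^ n := by
    intro n
    induction n with
    | zero => intro y; simp
    | succ n ih =>
      intro y
      rw [pow_succ, Module.End.mul_apply, ih, AlgHom.toLinearMap_apply,
        FiniteField.frobeniusAlgHom_apply, ← pow_mul, pow_succ']
  simp only [action, Polynomial.aeval_X, LinearMap.sum_apply, Module.End.mul_apply, hf,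
    LinearMap.mulLeft_apply]

lemma action_mul_apply (a b : F[X]) (y : Ω) :
    Φ.action (a * b) y = Φ.action a (Φ.action b y) := by
  rw [map_mul, Module.End.mul_apply]

lemma action_X_pow_succ (n : ℕ) (y : Ω) : Φ.action (Polynomial.X ^ (n + 1)) y =
    Φ.action Polynomial.X (Φ.action (Polynomial.X ^ n) y) := by
  rw [pow_succ', action_mul_apply]

lemma action_comm (a b : F[X]) (y : Ω) :
    Φ.action a (Φ.action b y) = Φ.action b (Φ.action a y) := by
  rw [← action_mul_apply, mul_comm, action_mul_apply]

lemma action_eq_sum (a : F[X]) (y : Ω) : Φ.action a y =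
    ∑ i ∈ Finset.range (a.natDegree + 1), a.coeff i • Φ.action (Polynomial.X ^ i) y := by
  conv_lhs => rw [a.as_sum_range_C_mul_X_pow]
  rw [map_sum, LinearMap.sum_apply]
  refine Finset.sum_congr rfl fun i _ => ?_
  rw [← Polynomial.smul_eq_C_mul, map_smul, LinearMap.smul_apply]

lemma algEquiv_smul [IsScalarTower F (RatFunc F) Ω] (γ : Ω ≃ₐ[RatFunc F] Ω) (a : F) (y : Ω) :
    γ (a • y) = a • γ y := by
  rw [← algebraMap_smul (RatFunc F) a y, map_smul, algebraMap_smul]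

/-- Automorphisms fixing the coefficients commute with the action. -/
lemma algEquiv_action [IsScalarTower F (RatFunc F) Ω] {γ : Ω ≃ₐ[RatFunc F] Ω}
    (hγ : ∀ i, γ (Φ.coeff i) = Φ.coeff i) (a : F[X]) (y : Ω) :
    γ (Φ.action a y) = Φ.action a (γ y) := by
  have hX : ∀ (n : ℕ) (y : Ω), γ (Φ.action (Polynomial.X ^ n) y) =
      Φ.action (Polynomial.X ^ n) (γ y) := by
    intro n
    induction n with
    | zero => intro y; simp
    | succ n ih =>
      intro y
      rw [action_X_pow_succ, action_X_pow_succ, ← ih, action_X_apply, action_X_apply, map_sum]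
      simp only [map_mul, map_pow, hγ]
  rw [action_eq_sum, action_eq_sum, map_sum]
  simp only [algEquiv_smul, hX]

lemma action_mem {M : IntermediateField (RatFunc F) Ω} [IsScalarTower F (RatFunc F) Ω]
    (hM : ∀ i, Φ.coeff i ∈ M) (a : F[X]) {y : Ω} (hy : y ∈ M) : Φ.action a y ∈ M := by
  have hX : ∀ n : ℕ, Φ.action (Polynomial.X ^ n) y ∈ M := by
    intro n
    induction n with
    | zero => simpa using hy
    | succ n ih =>
      rw [action_X_pow_succ, action_X_apply]
      exact sum_mem fun i _ => mul_mem (hM i) (pow_mem ih _)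
  rw [action_eq_sum]
  refine sum_mem fun i _ => ?_
  rw [← algebraMap_smul (RatFunc F)]
  exact M.smul_mem (hX i)

end Action

/-! ### Local estimates -/

section Local

variable (w : Valuation Ω ℝ≥0)

/-- The maximum of `1` and the absolute values of the coefficients. -/
def bound : ℝ≥0 := max 1 (Finset.univ.sup fun i => w (Φ.coeff i))

lemma one_le_bound : 1 ≤ Φ.bound w := le_max_left _ _

lemma coeff_le_bound (i : Fin (d + 1)) : w (Φ.coeff i) ≤ Φ.bound w :=
  (Finset.le_sup (f := fun i => w (Φ.coeff i)) (Finset.mem_univ i)).trans (le_max_right _ _)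

lemma bound_eq_one_or : Φ.bound w = 1 ∨ ∃ i, Φ.bound w = w (Φ.coeff i) := by
  rcases le_total (Finset.univ.sup fun i => w (Φ.coeff i)) 1 with h | h
  · exact Or.inl (max_eq_left h)
  · right
    obtain ⟨i, -, hi⟩ := Finset.exists_mem_eq_sup Finset.univ Finset.univ_nonempty
      fun i => w (Φ.coeff i)
    exact ⟨i, by rw [bound, max_eq_right h, hi]⟩

lemma logb_bound : Real.logb (Fintype.card F) (Φ.bound w) =
    ⨆ i, logp (Fintype.card F) (w (Φ.coeff i)) := by
  have hq : 1 < Fintype.card F := Fintype.one_lt_card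
  refine le_antisymm ?_ (ciSup_le fun i => ?_)
  · have hbdd : BddAbove (Set.range fun i => logp (Fintype.card F) (w (Φ.coeff i))) :=
      Set.finite_range _ |>.bddAbove
    rcases Φ.bound_eq_one_or w with h | ⟨i, h⟩
    · rw [h]
      simpa using Real.iSup_nonneg fun i => logp_nonneg (Fintype.card F) (w (Φ.coeff i))
    · rw [h]
      exact (logb_le_logp _ _).trans (le_ciSup hbdd i)
  · rw [logp_eq_logb_max hq]
    exact logb_le_logb_coe hq (lt_of_lt_of_le one_pos (le_max_left _ _)).ne'
      (max_le (Φ.one_le_bound w) (Φ.coeff_le_bound w i))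

variable [Algebra F Ω]

lemma val_action_X_le (y : Ω) :
    w (Φ.action Polynomial.X y) ≤ Φ.bound w * max 1 (w y) ^ Fintype.card F ^ d := by
  rw [action_X_apply]
  refine Valuation.map_sum_le w fun i _ => ?_
  rw [map_mul, map_pow]
  refine mul_le_mul' (Φ.coeff_le_bound w i) ?_
  calc w y ^ Fintype.card F ^ (i : ℕ) ≤ max 1 (w y) ^ Fintype.card F ^ (i : ℕ) := by
        gcongr; exact le_max_right _ _
    _ ≤ _ := pow_le_pow_right₀ (le_max_left _ _)
        (Nat.pow_le_pow_right Fintype.card_pos (by omega))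

lemma max_val_action_X_le (y : Ω) :
    max 1 (w (Φ.action Polynomial.X y)) ≤ Φ.bound w * max 1 (w y) ^ Fintype.card F ^ d :=
  max_le (one_le_mul (Φ.one_le_bound w) (one_le_pow₀ (le_max_left _ _))) (Φ.val_action_X_le w y)

/-- The value of `Φ(T)(y)` is that of its leading term if `y` is large. -/
lemma val_action_X_of_lt {y : Ω} (h1 : 1 < w y)
    (h : ∀ i : Fin d, w (Φ.coeff i.castSucc) * w y ^ Fintype.card F ^ (i : ℕ) <
      w (Φ.coeff (Fin.last d)) * w y ^ Fintype.card F ^ d) :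
    w (Φ.action Polynomial.X y) = w (Φ.coeff (Fin.last d)) * w y ^ Fintype.card F ^ d := by
  rw [action_X_apply, Fin.sum_univ_castSucc]
  have hlast : w (Φ.coeff (Fin.last d) * y ^ Fintype.card F ^ ((Fin.last d : Fin (d + 1)) : ℕ)) =
      w (Φ.coeff (Fin.last d)) * w y ^ Fintype.card F ^ d := by
    rw [map_mul, map_pow, Fin.val_last]
  rw [Valuation.map_add_eq_of_lt_right, hlast]
  rw [hlast]
  refine Valuation.map_sum_lt w ?_ fun i _ => ?_
  · refine mul_ne_zero ((Valuation.ne_zero_iff _).2 Φ.coeff_last) (pow_ne_zero _ ?_)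
    exact (one_pos.trans h1).ne'
  · rw [map_mul, map_pow]
    exact h i

/-- Either `y` lies in the disc of radius `R`, and the bound is trivial, or the leading term of
`Φ(T)(y)` strictly dominates and its value is `|a_d| |y| ^ (q ^ d)`. -/
lemma max_val_pow_le (y : Ω) : max 1 (w y) ^ Fintype.card F ^ d ≤
    max 1 (w (Φ.action Polynomial.X y)) *
      (Φ.bound w * max 1 (w (Φ.coeff (Fin.last d)))⁻¹) ^ Fintype.card F ^ d := by
  set R := Φ.bound w * max 1 (w (Φ.coeff (Fin.last d)))⁻¹ with hR
  set Q := Fintype.card F ^ d with hQ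
  have hQ0 : Q ≠ 0 := pow_ne_zero _ Fintype.card_ne_zero
  have hR1 : 1 ≤ R := one_le_mul (Φ.one_le_bound w) (le_max_left _ _)
  rcases le_or_gt (w y) R with h | h
  · calc max 1 (w y) ^ Q ≤ R ^ Q := by gcongr; exact max_le hR1 h
      _ ≤ _ := le_mul_of_one_le_left zero_le (le_max_left _ _)
  have hy1 : 1 < w y := hR1.trans_lt h
  have ha0 : w (Φ.coeff (Fin.last d)) ≠ 0 := (Valuation.ne_zero_iff _).2 Φ.coeff_last
  have hBa : Φ.bound w < w (Φ.coeff (Fin.last d)) * w y := by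
    calc Φ.bound w = w (Φ.coeff (Fin.last d)) * (Φ.bound w * (w (Φ.coeff (Fin.last d)))⁻¹) := by
          field_simp
      _ ≤ w (Φ.coeff (Fin.last d)) * R := by rw [hR]; gcongr; exact le_max_right _ _
      _ < _ := by gcongr
  have hval := Φ.val_action_X_of_lt w hy1 fun i => by
    have hi : Fintype.card F ^ (i : ℕ) + 1 ≤ Q := by
      rw [hQ]
      exact Nat.pow_lt_pow_right Fintype.one_lt_card i.2
    calc w (Φ.coeff i.castSucc) * w y ^ Fintype.card F ^ (i : ℕ)
        ≤ Φ.bound w * w y ^ Fintype.card F ^ (i : ℕ) := by gcongr; exact Φ.coeff_le_bound w _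
      _ < w (Φ.coeff (Fin.last d)) * w y * w y ^ Fintype.card F ^ (i : ℕ) := by
        gcongr
      _ = w (Φ.coeff (Fin.last d)) * w y ^ (Fintype.card F ^ (i : ℕ) + 1) := by ring
      _ ≤ _ := by
        gcongr
        exact hy1.le
  rw [max_eq_right hy1.le]
  have hRa : 1 ≤ w (Φ.coeff (Fin.last d)) * R ^ Q := by
    calc 1 = w (Φ.coeff (Fin.last d)) * (w (Φ.coeff (Fin.last d)))⁻¹ := (mul_inv_cancel₀ ha0).symm
      _ ≤ w (Φ.coeff (Fin.last d)) * R := by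
        gcongr
        exact (le_max_right _ _).trans (le_mul_of_one_le_left zero_le (Φ.one_le_bound w))
      _ ≤ _ := by gcongr; exact le_self_pow₀ hR1 hQ0
  calc w y ^ Q ≤ w y ^ Q * (w (Φ.coeff (Fin.last d)) * R ^ Q) := le_mul_of_one_le_right zero_le hRa
    _ = w (Φ.action Polynomial.X y) * R ^ Q := by rw [hval]; ring
    _ ≤ _ := by gcongr; exact le_max_right _ _

end Local

end DrinfeldModule

namespace DrinfeldModule

/-! ### The canonical height -/

variable {F : Type*} [Field F] [Fintype F] {Ω : Type*} [Field Ω] [Algebra (RatFunc F) Ω]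
  [Algebra.IsAlgebraic (RatFunc F) Ω] [IsAlgClosed Ω] {d : ℕ} (Φ : DrinfeldModule F Ω d)

instance finiteDimensional_coeffField : FiniteDimensional (RatFunc F) Φ.coeffField := by
  have := (Set.finite_range Φ.coeff).to_subtype
  exact IntermediateField.finiteDimensional_adjoin fun y _ => Algebra.IsIntegral.isIntegral y

section Average

variable {M : IntermediateField (RatFunc F) Ω} [FiniteDimensional (RatFunc F) M]

lemma coeffField_le (hM : ∀ i, Φ.coeff i ∈ M) : Φ.coeffField ≤ M := by
  refine IntermediateField.adjoin_le_iff.2 ?_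
  rintro _ ⟨i, rfl⟩
  exact hM i

lemma avg_logb_bound_le (hM : ∀ i, Φ.coeff i ∈ M) (S : Finset (BasePlace F)) :
    avg S (fun p : GPlace M => Real.logb (Fintype.card F) (Φ.bound p.val)) ≤ Φ.moduleHeight := by
  simp only [logb_bound]
  exact avg_le_height (Φ.coeffField_le hM) Φ.coeff' S

/-- By the product formula, the positive part of the logarithm has the same average for `a_d` and
for its inverse, and the former is part of `h(Φ)`. -/
lemma avg_logp_inv_last_le (hM : ∀ i, Φ.coeff i ∈ M) (S : Finset (BasePlace F)) :
    avg S (fun p : GPlace M => logp (Fintype.card F) (p.val (Φ.coeff (Fin.last d)))⁻¹) ≤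
      Φ.moduleHeight := by
  classical
  obtain ⟨S₀, h⟩ := exists_avg_log_eq_zero (hM (Fin.last d)) Φ.coeff_last
  have hle : avg S (fun p : GPlace M => logp (Fintype.card F) (p.val (Φ.coeff (Fin.last d)))⁻¹) ≤
      avg (S ∪ S₀) (fun p : GPlace M =>
        logp (Fintype.card F) (p.val (Φ.coeff (Fin.last d)))⁻¹) := by
    rw [avg_eq_sum, avg_eq_sum]
    refine Finset.sum_le_sum_of_subset_of_nonneg Finset.subset_union_left fun v _ _ => ?_
    exact mul_nonneg (by positivity) (Finset.sum_nonneg fun τ _ => logp_nonneg _ _)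
  refine hle.trans ?_
  simp only [logp_inv]
  rw [avg_sub, h _ Finset.subset_union_right, sub_zero]
  refine le_trans (avg_mono fun p _ => ?_) (Φ.avg_logb_bound_le hM (S ∪ S₀))
  rw [logb_bound]
  exact le_ciSup (f := fun i => logp (Fintype.card F) (p.val (Φ.coeff i)))
    (Set.finite_range _).bddAbove (Fin.last d)

end Average

/-- The coefficient `a_0 = T` alone contributes `1` at infinity. -/
lemma one_le_moduleHeight : 1 ≤ Φ.moduleHeight := by
  classical
  refine le_trans ?_ (Φ.avg_logb_bound_le (M := Φ.coeffField)
    (fun i => IntermediateField.subset_adjoin _ _ ⟨i, rfl⟩) {BasePlace.infty F})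
  rw [← avg_ite_eq (M := Φ.coeffField) (Finset.mem_singleton_self (BasePlace.infty F)) 1]
  refine avg_mono fun p hp => ?_
  rw [if_pos (Finset.mem_singleton.1 hp), logb_bound]
  have h0 : p.val (Φ.coeff 0) = Fintype.card F := by
    rw [Φ.coeff_zero, p.val_algebraMap, Finset.mem_singleton.1 hp]
    change inftyPlace F RatFunc.X = _
    rw [inftyPlace_of_ne_zero RatFunc.X_ne_zero]
    simp
  refine le_trans ?_ (le_ciSup (f := fun i => logp (Fintype.card F) (p.val (Φ.coeff i)))
    (Set.finite_range _).bddAbove 0)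
  rw [h0]
  refine le_trans ?_ (logb_le_logp _ _)
  rw [NNReal.coe_natCast, Real.logb_self_eq_one]
  exact_mod_cast Fintype.one_lt_card

variable [Algebra F Ω] [IsScalarTower F (RatFunc F) Ω]

local notation "q" => (Fintype.card F)

lemma exists_normal_coeff_mem (s : Set Ω) (hs : s.Finite) :
    ∃ M : IntermediateField (RatFunc F) Ω, (∀ i, Φ.coeff i ∈ M) ∧ s ⊆ M ∧
      FiniteDimensional (RatFunc F) M ∧ Normal (RatFunc F) M := by
  obtain ⟨M, h, h1, h2⟩ := exists_normal_finiteDimensional (F := F) _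
    ((Set.finite_range Φ.coeff).union hs)
  exact ⟨M, fun i => h (Or.inl ⟨i, rfl⟩), fun y hy => h (Or.inr hy), h1, h2⟩

lemma weilHeight_action_X_le (y : Ω) : weilHeight F (Φ.action Polynomial.X y) ≤
    (q : ℝ) ^ d * weilHeight F y + Φ.moduleHeight := by
  classical
  have hq : 1 < q := Fintype.one_lt_card
  obtain ⟨M, hM, hy, _, _⟩ := Φ.exists_normal_coeff_mem {y} (Set.finite_singleton y)
  have hy : y ∈ M := hy rfl
  obtain ⟨S, hS⟩ := exists_weilHeight_eq_avg (Φ.action_mem hM Polynomial.X hy)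
  rw [hS S subset_rfl]
  refine le_trans (avg_mono (ψ := fun p => (q : ℝ) ^ d * logp q (p.val y) +
    Real.logb q (Φ.bound p.val)) fun p _ => ?_) ?_
  · rw [logp_eq_logb_max hq, logp_eq_logb_max hq]
    refine (logb_le_logb_coe hq (lt_of_lt_of_le one_pos (le_max_left _ _)).ne'
      (Φ.max_val_action_X_le p.val y)).trans ?_
    have h1 : (max 1 (p.val y) : ℝ≥0) ≠ 0 := (lt_of_lt_of_le one_pos (le_max_left _ _)).ne'
    have h2 : Φ.bound p.val ≠ 0 := (lt_of_lt_of_le one_pos (Φ.one_le_bound _)).ne'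
    rw [NNReal.coe_mul, NNReal.coe_pow, Real.logb_mul (by exact_mod_cast h2)
      (by exact_mod_cast pow_ne_zero _ h1), Real.logb_pow]
    push_cast
    linarith
  · rw [avg_add, avg_const_mul]
    gcongr
    · exact avg_le_weilHeight hy S
    · exact Φ.avg_logb_bound_le hM S

/-- The local inequality `max_val_pow_le` is averaged. The two copies of `h(Φ)` come from the
coefficients and from the inverse of `a_d`. -/
lemma le_weilHeight_action_X (y : Ω) : (q : ℝ) ^ d * weilHeight F y ≤
    weilHeight F (Φ.action Polynomial.X y) + (q : ℝ) ^ d * (2 * Φ.moduleHeight) := by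
  classical
  have hq : 1 < q := Fintype.one_lt_card
  obtain ⟨M, hM, hy, _, _⟩ := Φ.exists_normal_coeff_mem {y} (Set.finite_singleton y)
  have hy : y ∈ M := hy rfl
  obtain ⟨S, hS⟩ := exists_weilHeight_eq_avg hy
  rw [hS S subset_rfl, ← avg_const_mul]
  refine le_trans (avg_mono (ψ := fun p => logp q (p.val (Φ.action Polynomial.X y)) +
    (q : ℝ) ^ d * (Real.logb q (Φ.bound p.val) +
      logp q (p.val (Φ.coeff (Fin.last d)))⁻¹)) fun p _ => ?_) ?_
  · rw [logp_eq_logb_max hq, logp_eq_logb_max hq, logp_eq_logb_max hq]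
    have h1 : ∀ t : ℝ≥0, ((max 1 t : ℝ≥0) : ℝ) ≠ 0 := fun t => by
      exact_mod_cast (lt_of_lt_of_le one_pos (le_max_left 1 t)).ne'
    have h2 : (Φ.bound p.val : ℝ) ≠ 0 := by
      exact_mod_cast (lt_of_lt_of_le one_pos (Φ.one_le_bound _)).ne'
    have h := logb_le_logb_coe hq (pow_ne_zero _ (by exact_mod_cast h1 (p.val y)))
      (Φ.max_val_pow_le p.val y)
    rw [NNReal.coe_mul, NNReal.coe_pow, NNReal.coe_pow, NNReal.coe_mul,
      Real.logb_mul (h1 _) (pow_ne_zero _ (mul_ne_zero h2 (h1 _))), Real.logb_pow, Real.logb_pow,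
      Real.logb_mul h2 (h1 _)] at h
    push_cast at h ⊢
    exact h
  · rw [avg_add, avg_const_mul, avg_add]
    gcongr
    · exact avg_le_weilHeight (Φ.action_mem hM _ hy) S
    · linarith [Φ.avg_logb_bound_le hM S, Φ.avg_logp_inv_last_le hM S]

/-- The two comparisons give `|q ^ d h(y) - h(Φ(T)(y))| ≤ 2 q ^ d h(Φ)`, so consecutive terms of the
defining sequence differ by a geometric amount and the sequence converges. -/
lemma dist_le (y : Ω) (n : ℕ) :
    dist (weilHeight F (Φ.action (Polynomial.X ^ n) y) / (q : ℝ) ^ (d * n))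
      (weilHeight F (Φ.action (Polynomial.X ^ (n + 1)) y) / (q : ℝ) ^ (d * (n + 1))) ≤
      2 * Φ.moduleHeight * (((q : ℝ) ^ d)⁻¹) ^ n := by
  have hq0 : (0 : ℝ) < q := by exact_mod_cast Fintype.card_pos
  have hq1 : (1 : ℝ) ≤ (q : ℝ) ^ d :=
    one_le_pow₀ (by exact_mod_cast Fintype.one_lt_card (α := F).le)
  have hh := Φ.one_le_moduleHeight
  have h1 := Φ.weilHeight_action_X_le (Φ.action (Polynomial.X ^ n) y)
  have h2 := Φ.le_weilHeight_action_X (Φ.action (Polynomial.X ^ n) y)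
  rw [← action_X_pow_succ] at h1 h2
  set a := weilHeight F (Φ.action (Polynomial.X ^ n) y)
  set b := weilHeight F (Φ.action (Polynomial.X ^ (n + 1)) y)
  set Q := (q : ℝ) ^ d with hQ
  have hQ0 : 0 < Q := by positivity
  rw [pow_mul, pow_mul, ← hQ, Real.dist_eq]
  have e : a / Q ^ n - b / Q ^ (n + 1) = (Q * a - b) / Q * (Q⁻¹) ^ n := by
    rw [inv_pow, pow_succ]
    field_simp
  rw [e, abs_mul, abs_of_pos (show 0 < (Q⁻¹) ^ n by positivity)]
  gcongr
  rw [abs_div, abs_of_pos hQ0, div_le_iff₀ hQ0, abs_le]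
  constructor <;> nlinarith

lemma inv_card_pow_lt_one (hd : 0 < d) : ((q : ℝ) ^ d)⁻¹ < 1 :=
  inv_lt_one_of_one_lt₀ (one_lt_pow₀ (by exact_mod_cast Fintype.one_lt_card) hd.ne')

theorem tendsto_canonicalHeight (y : Ω) : Filter.Tendsto
    (fun n : ℕ => weilHeight F (Φ.action (Polynomial.X ^ n) y) / (q : ℝ) ^ (d * n))
    Filter.atTop (nhds (Φ.canonicalHeight y)) :=
  (cauchySeq_of_le_geometric _ _ (inv_card_pow_lt_one (F := F) Φ.rank_pos) (Φ.dist_le y)).tendsto_limUnder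

lemma canonicalHeight_nonneg (y : Ω) : 0 ≤ Φ.canonicalHeight y :=
  ge_of_tendsto' (Φ.tendsto_canonicalHeight y) fun n =>
    div_nonneg (weilHeight_nonneg _) (by positivity)

/-- This is the tail of the geometric series: its ratio is at most `1 / 2`, so the error `2 h(Φ)` is
at most doubled. -/
theorem weilHeight_action_X_pow_le (y : Ω) (n : ℕ) :
    weilHeight F (Φ.action (Polynomial.X ^ n) y) ≤
      (q : ℝ) ^ (d * n) * Φ.canonicalHeight y + 4 * Φ.moduleHeight := by
  have h := dist_le_of_le_geometric_of_tendsto _ _ (inv_card_pow_lt_one (F := F) Φ.rank_pos) (Φ.dist_le y)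
    (Φ.tendsto_canonicalHeight y) n
  have hh := Φ.one_le_moduleHeight
  have hq2 : (2 : ℝ) ≤ (q : ℝ) ^ d := by
    have h2 : (2 : ℝ) ≤ q := by exact_mod_cast Fintype.one_lt_card (α := F)
    exact h2.trans (le_self_pow₀ (by linarith) Φ.rank_pos.ne')
  rw [Real.dist_eq] at h
  have h := (le_abs_self _).trans h
  set a := weilHeight F (Φ.action (Polynomial.X ^ n) y)
  rw [pow_mul] at h ⊢
  set Q := (q : ℝ) ^ d with hQ
  have hQ0 : 0 < Q := by positivity
  have hQn : 0 < Q ^ n := by positivity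
  have h3 : (1 - Q⁻¹)⁻¹ ≤ 2 := by
    rw [inv_le_comm₀ (by linarith [(inv_card_pow_lt_one (F := F) Φ.rank_pos)]) two_pos]
    have : Q⁻¹ ≤ 2⁻¹ := inv_anti₀ two_pos hq2
    linarith
  have h4 : a / Q ^ n - Φ.canonicalHeight y ≤ 4 * Φ.moduleHeight / Q ^ n := by
    refine h.trans ?_
    rw [inv_pow, div_eq_mul_inv, div_eq_mul_inv]
    calc 2 * Φ.moduleHeight * (Q ^ n)⁻¹ * (1 - Q⁻¹)⁻¹ ≤ 2 * Φ.moduleHeight * (Q ^ n)⁻¹ * 2 := by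
          gcongr
      _ = _ := by ring
  have h5 : a / Q ^ n ≤ (Q ^ n * Φ.canonicalHeight y + 4 * Φ.moduleHeight) / Q ^ n := by
    rw [add_div, mul_div_cancel_left₀ _ hQn.ne']
    linarith
  exact (div_le_div_iff_of_pos_right hQn).1 h5

theorem canonicalHeight_conj {γ : Ω ≃ₐ[RatFunc F] Ω} (hγ : ∀ i, γ (Φ.coeff i) = Φ.coeff i)
    (y : Ω) : Φ.canonicalHeight (γ y) = Φ.canonicalHeight y := by
  unfold canonicalHeight
  simp only [← Φ.algEquiv_action hγ, weilHeight_conj]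

/-- Places are ultrametric and trivial on constants, so a combination with coefficients in `F` is
locally no larger than its largest term. -/
lemma weilHeight_sum_smul_le {ι : Type*} (s : Finset ι) (a : ι → F) (y : ι → Ω) :
    weilHeight F (∑ i ∈ s, a i • y i) ≤ ∑ i ∈ s, weilHeight F (y i) := by
  have hq : 1 < q := Fintype.one_lt_card
  obtain ⟨M, hy, _, _⟩ := exists_normal_finiteDimensional (F := F) _
    ((Finset.finite_toSet s).image y)
  have hy : ∀ i ∈ s, y i ∈ M := fun i hi => hy ⟨i, hi, rfl⟩
  have hsum : ∑ i ∈ s, a i • y i ∈ M := sum_mem fun i hi => by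
    rw [← algebraMap_smul (RatFunc F)]
    exact M.smul_mem (hy i hi)
  obtain ⟨S, hS⟩ := exists_weilHeight_eq_avg hsum
  rw [hS S subset_rfl]
  refine le_trans (avg_mono (ψ := fun p => ∑ i ∈ s, logp q (p.val (y i))) fun p _ => ?_) ?_
  · have h0 : 0 ≤ ∑ i ∈ s, logp q (p.val (y i)) := Finset.sum_nonneg fun i _ => logp_nonneg _ _
    rcases s.eq_empty_or_nonempty with rfl | hs
    · simp [logp]
    obtain ⟨i, hi, hle⟩ := Finset.exists_max_image s (fun i => p.val (y i)) hs
    refine (logp_mono hq (Valuation.map_sum_le p.val (g := p.val (y i)) fun j hj =>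
      (val_smul_le _ _ _).trans (hle j hj))).trans ?_
    exact Finset.single_le_sum (f := fun i => logp q (p.val (y i)))
      (fun j _ => logp_nonneg _ _) hi
  · rw [avg_sum]
    exact Finset.sum_le_sum fun i hi => avg_le_weilHeight (hy i hi) S

/-- Expand `Φ(a)` in the `Φ(T ^ i)`. Each `Φ(T ^ i)` multiplies `ĥ` by `q ^ (d i)`, and the
geometric sum is at most twice its last term. -/
theorem canonicalHeight_action_le (a : F[X]) (y : Ω) : Φ.canonicalHeight (Φ.action a y) ≤
    2 * (q : ℝ) ^ (d * a.natDegree) * Φ.canonicalHeight y := by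
  have hq2 : (2 : ℝ) ≤ (q : ℝ) ^ d := by
    have h2 : (2 : ℝ) ≤ q := by exact_mod_cast Fintype.one_lt_card (α := F)
    exact h2.trans (le_self_pow₀ (by linarith) Φ.rank_pos.ne')
  have hlim : Filter.Tendsto (fun n : ℕ => ∑ i ∈ Finset.range (a.natDegree + 1),
      (q : ℝ) ^ (d * i) * (weilHeight F (Φ.action (Polynomial.X ^ (n + i)) y) /
        (q : ℝ) ^ (d * (n + i)))) Filter.atTop
      (nhds (∑ i ∈ Finset.range (a.natDegree + 1), (q : ℝ) ^ (d * i) * Φ.canonicalHeight y)) :=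
    tendsto_finsetSum _ fun i _ => ((Filter.tendsto_add_atTop_iff_nat i).2
      (Φ.tendsto_canonicalHeight y)).const_mul _
  have h1 := le_of_tendsto_of_tendsto' (Φ.tendsto_canonicalHeight (Φ.action a y)) hlim fun n => by
    rw [action_comm, action_eq_sum]
    refine (div_le_div_of_nonneg_right (weilHeight_sum_smul_le _ _ _) (by positivity)).trans ?_
    rw [Finset.sum_div]
    refine Finset.sum_le_sum fun i _ => le_of_eq ?_
    rw [← action_mul_apply, ← pow_add, add_comm i n, mul_add, pow_add (q : ℝ)]
    have : (0 : ℝ) < q := by exact_mod_cast Fintype.card_pos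
    field_simp
  refine h1.trans ?_
  rw [← Finset.sum_mul]
  refine mul_le_mul_of_nonneg_right ?_ (Φ.canonicalHeight_nonneg y)
  have : ∀ m : ℕ, ∑ i ∈ Finset.range (m + 1), (q : ℝ) ^ (d * i) ≤ 2 * (q : ℝ) ^ (d * m) := by
    intro m
    induction m with
    | zero => simp
    | succ m ih =>
      rw [Finset.sum_range_succ]
      have : (q : ℝ) ^ (d * (m + 1)) = (q : ℝ) ^ (d * m) * (q : ℝ) ^ d := by ring
      have h0 : (0 : ℝ) ≤ (q : ℝ) ^ (d * m) := by positivity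
      nlinarith
  exact this _

end DrinfeldModule

/-! ### Separating points by a small perturbation -/

section Perturbation

variable {F : Type*} [Field F] [Fintype F] {Ω : Type*} [Field Ω] [Algebra F Ω]
  (w : Valuation Ω ℝ≥0)

lemma val_le_one_of_isIntegral {u : Ω} (hu : IsIntegral F u) : w u ≤ 1 := by
  refine val_le_one_of_root w ((minpoly.monic hu).map (algebraMap F Ω)) (fun i => ?_)
    (by rw [Polynomial.eval_map_algebraMap, minpoly.aeval])
  rw [Polynomial.coeff_map, ← mul_one (algebraMap F Ω _), ← Algebra.smul_def]
  exact (val_smul_le w _ 1).trans w.map_one.le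

lemma val_eq_one_of_isIntegral {u : Ω} (hu : IsIntegral F u) (hu0 : u ≠ 0) : w u = 1 := by
  refine le_antisymm (val_le_one_of_isIntegral w hu) ?_
  have h := val_le_one_of_isIntegral w hu.inv
  rw [map_inv₀] at h
  exact (inv_le_one₀ (pos_iff_ne_zero.2 ((Valuation.ne_zero_iff _).2 hu0))).1 h

/-- The candidates for `u` are the elements algebraic over `F`: there are infinitely many, and
distinct ones differ by units. If each candidate failed at some `b ∈ s`, two would fail at the same
`b`, and subtracting would make `ϖ` times a unit smaller than `ϖ`. -/
lemma exists_val_ge (F : Type*) [Field F] [Fintype F] [Algebra F Ω] [IsAlgClosed Ω] (ϖ a : Ω) (s : Finset Ω) :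
    ∃ u : Ω, w u ≤ 1 ∧ ∀ b ∈ s, w ϖ ≤ w (a + ϖ * u - b) := by
  classical
  by_contra! hcon
  have : IsAlgClosed (algebraicClosure F Ω) := (algebraicClosure.isAlgClosure F Ω).isAlgClosed
  have hinf : Infinite (algebraicClosure F Ω) := inferInstance
  have hInt : ∀ u : algebraicClosure F Ω, IsIntegral F (u : Ω) := fun u =>
    (mem_algebraicClosure_iff.1 u.2).isIntegral
  choose f hfs hf using fun u : algebraicClosure F Ω =>
    hcon u (val_le_one_of_isIntegral w (hInt u))
  obtain ⟨u, u', hne, huu⟩ := Finite.exists_ne_map_eq_of_infinite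
    (fun u => (⟨f u, hfs u⟩ : s))
  have huu : f u = f u' := congrArg Subtype.val huu
  have h1 : w (ϖ * ((u - u' : algebraicClosure F Ω) : Ω)) < w ϖ := by
    have e : ϖ * ((u - u' : algebraicClosure F Ω) : Ω) =
        (a + ϖ * (u : Ω) - f u) - (a + ϖ * (u' : Ω) - f u') := by
      rw [huu]
      push_cast
      ring
    rw [e]
    exact Valuation.map_sub_lt w (hf u) (hf u')
  rw [map_mul, val_eq_one_of_isIntegral w (hInt _) (fun h => hne (sub_eq_zero.1
    (Subtype.ext h))), mul_one] at h1
  exact lt_irrefl _ h1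

/-- Points can be moved by at most `|ϖ|` so that no distance decreases and all of them become at
least `|ϖ|`. -/
lemma exists_perturbation (F : Type*) [Field F] [Fintype F] [Algebra F Ω] [IsAlgClosed Ω] {ι : Type*} [Finite ι] (ϖ : Ω)
    (a : ι → Ω) : ∃ b : ι → Ω, (∀ i, w (b i - a i) ≤ w ϖ) ∧
      ∀ i j, i ≠ j → max (w ϖ) (w (a i - a j)) ≤ w (b i - b j) := by
  classical
  have := Fintype.ofFinite ι
  suffices h : ∀ s : Finset ι, ∃ b : ι → Ω, (∀ i, w (b i - a i) ≤ w ϖ) ∧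
      ∀ i ∈ s, ∀ j ∈ s, i ≠ j → max (w ϖ) (w (a i - a j)) ≤ w (b i - b j) by
    obtain ⟨b, h1, h2⟩ := h Finset.univ
    exact ⟨b, h1, fun i j => h2 i (Finset.mem_univ _) j (Finset.mem_univ _)⟩
  intro s
  induction s using Finset.induction_on with
  | empty => exact ⟨a, by simp, by simp⟩
  | insert i s hi ih =>
    obtain ⟨b, h1, h2⟩ := ih
    obtain ⟨u, hu, hu2⟩ := exists_val_ge w F ϖ (a i) (s.image b)
    set z := a i + ϖ * u with hz
    have hzi : w (z - a i) ≤ w ϖ := by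
      rw [hz, add_sub_cancel_left, map_mul]
      exact mul_le_of_le_one_right' hu
    have key : ∀ j ∈ s, max (w ϖ) (w (a i - a j)) ≤ w (z - b j) := by
      intro j hj
      have h3 := hu2 _ (Finset.mem_image_of_mem b hj)
      refine max_le h3 ?_
      by_contra! hlt
      have e : a i - a j = -(z - a i) + (z - b j) + (b j - a j) := by ring
      have hle : w (a i - a j) ≤ max (max (w ϖ) (w (z - b j))) (w ϖ) := by
        rw [e]
        refine (Valuation.map_add _ _ _).trans (max_le_max ?_ (h1 j))
        refine (Valuation.map_add _ _ _).trans (max_le_max ?_ le_rfl)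
        rwa [Valuation.map_neg]
      rw [max_eq_right h3, max_eq_left h3] at hle
      exact absurd hlt (not_lt.2 hle)
    refine ⟨Function.update b i z, fun j => ?_, fun j hj j' hj' hne => ?_⟩
    · rcases eq_or_ne j i with rfl | hji
      · simpa using hzi
      · simpa [hji] using h1 j
    · rcases Finset.mem_insert.1 hj with rfl | hjs
      · have hj'j : j' ≠ j := hne.symm
        simpa [hj'j] using key j' ((Finset.mem_insert.1 hj').resolve_left hj'j)
      · have hji : j ≠ i := fun h => hi (h ▸ hjs)
        rcases Finset.mem_insert.1 hj' with rfl | hj's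
        · have := key j hjs
          rw [Valuation.map_sub_swap] at this
          rw [Function.update_self, Function.update_of_ne hji, Valuation.map_sub_swap w (b j)]
          exact this
        · have hj'i : j' ≠ i := fun h => hi (h ▸ hj's)
          simpa [hji, hj'i] using h2 j hjs j' hj's hne

end Perturbation

/-! ### The determinant estimate -/

section Determinant

variable {Ω : Type*} [Field Ω] (w : Valuation Ω ℝ≥0)

lemma val_det_le {n : Type*} [Fintype n] [DecidableEq n] (A : Matrix n n Ω) (B c : n → ℝ≥0)
    (h : ∀ i j, w (A i j) ≤ B i * c j) : w A.det ≤ (∏ i, B i) * ∏ j, c j := by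
  rw [Matrix.det_apply]
  refine Valuation.map_sum_le w fun σ _ => ?_
  have hs : w (Equiv.Perm.sign σ • ∏ i, A (σ i) i) = w (∏ i, A (σ i) i) := by
    rcases Int.units_eq_one_or (Equiv.Perm.sign σ) with h | h <;> simp [h]
  rw [hs, map_prod]
  calc ∏ i, w (A (σ i) i) ≤ ∏ i, (B (σ i) * c i) := Finset.prod_le_prod' fun i _ => h _ _
    _ = _ := by rw [Finset.prod_mul_distrib, Equiv.prod_comp σ B]

/-- After division by their leading coefficients the `P n` are monic of degree `n`, so their matrix
of values has the Vandermonde determinant of the points. It is bounded row by row, and squared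
because every unordered pair of points occurs twice on the left. -/
lemma prod_val_sub_le {L : ℕ} (b : Fin L → Ω) (P : ℕ → Polynomial Ω)
    (hdeg : ∀ n < L, (P n).natDegree = n) (h0 : ∀ n < L, P n ≠ 0) (B : Fin L → ℝ≥0)
    (hB : ∀ i, ∀ n < L, w ((P n).eval (b i)) ≤ B i) :
    (∏ i, ∏ j ∈ {i}ᶜ, w (b i - b j)) * (∏ n ∈ Finset.range L, w (P n).leadingCoeff) ^ 2 ≤
      (∏ i, B i) ^ 2 := by
  have hlc : ∀ n < L, (P n).leadingCoeff ≠ 0 := fun n hn => Polynomial.leadingCoeff_ne_zero.2 (h0 n hn)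
  let p : Fin L → Polynomial Ω := fun n => Polynomial.C (P n).leadingCoeff⁻¹ * P n
  have hp := Matrix.det_eval_matrixOfPolynomials_eq_det_vandermonde b p
    (fun n => by
      rw [Polynomial.natDegree_C_mul (inv_ne_zero (hlc n n.2)), hdeg n n.2])
    (fun n => by
      rw [Polynomial.Monic, Polynomial.leadingCoeff_mul, Polynomial.leadingCoeff_C,
        inv_mul_cancel₀ (hlc n n.2)])
  have hle := val_det_le w (Matrix.of fun i j => (p j).eval (b i)) B
    (fun n => (w (P n).leadingCoeff)⁻¹) (fun i j => by
      simp only [Matrix.of_apply, p, Polynomial.eval_mul, Polynomial.eval_C, map_mul, map_inv₀]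
      rw [mul_comm]
      gcongr
      exact hB i j j.2)
  rw [← hp, Matrix.det_vandermonde, map_prod] at hle
  simp only [map_prod] at hle
  have hsq : ∏ i, ∏ j ∈ {i}ᶜ, w (b i - b j) = (∏ i, ∏ j ∈ Finset.Ioi i, w (b j - b i)) ^ 2 := by
    rw [← Finset.prod_pow]
    simp only [← Finset.prod_pow]
    rw [← Finset.prod_congr rfl fun i _ => Finset.prod_congr rfl fun j _ =>
      Valuation.map_sub_swap w (b j) (b i),
      ← Finset.prod_prod_Ioi_mul_eq_prod_prod_off_diag (fun i j => w (b i - b j))]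
    refine Finset.prod_congr rfl fun i _ => Finset.prod_congr rfl fun j _ => ?_
    rw [Valuation.map_sub_swap w (b i), sq]
  rw [hsq, ← mul_pow]
  gcongr
  rw [Finset.prod_range fun n => w (P n).leadingCoeff]
  refine (mul_le_mul_left hle _).trans ?_
  rw [Finset.prod_inv_distrib, mul_assoc, inv_mul_cancel₀, mul_one]
  exact Finset.prod_ne_zero_iff.2 fun n _ => (Valuation.ne_zero_iff _).2 (hlc n n.2)

end Determinant

namespace DrinfeldModule

variable {F : Type*} [Field F] [Fintype F] {Ω : Type*} [Field Ω] [Algebra (RatFunc F) Ω]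
  {d : ℕ} (Φ : DrinfeldModule F Ω d)

/-! ### The polynomials `Φ(T ^ n)(X)` and their products -/

/-- The polynomial `Φ(T)(X)`. -/
def polyT : Polynomial Ω := ∑ i, Polynomial.C (Φ.coeff i) * Polynomial.X ^ Fintype.card F ^ (i : ℕ)

lemma degree_polyT_aux : (∑ i : Fin d, Polynomial.C (Φ.coeff i.castSucc) *
    Polynomial.X ^ Fintype.card F ^ (i : ℕ)).degree <
    (Polynomial.C (Φ.coeff (Fin.last d)) * Polynomial.X ^ Fintype.card F ^ d).degree := by
  rw [Polynomial.degree_C_mul_X_pow _ Φ.coeff_last]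
  refine (Polynomial.degree_sum_le _ _).trans_lt ?_
  rw [Finset.sup_lt_iff (WithBot.bot_lt_coe _)]
  intro i _
  refine (Polynomial.degree_C_mul_X_pow_le _ _).trans_lt ?_
  exact_mod_cast Nat.pow_lt_pow_right Fintype.one_lt_card i.2

lemma polyT_eq : Φ.polyT = (∑ i : Fin d, Polynomial.C (Φ.coeff i.castSucc) *
    Polynomial.X ^ Fintype.card F ^ (i : ℕ)) +
    Polynomial.C (Φ.coeff (Fin.last d)) * Polynomial.X ^ Fintype.card F ^ d := by
  rw [polyT, Fin.sum_univ_castSucc]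
  rfl

lemma natDegree_polyT : Φ.polyT.natDegree = Fintype.card F ^ d := by
  rw [polyT_eq, Polynomial.natDegree_add_eq_right_of_degree_lt Φ.degree_polyT_aux,
    Polynomial.natDegree_C_mul_X_pow _ _ Φ.coeff_last]

lemma leadingCoeff_polyT : Φ.polyT.leadingCoeff = Φ.coeff (Fin.last d) := by
  rw [polyT_eq, Polynomial.leadingCoeff_add_of_degree_lt Φ.degree_polyT_aux,
    Polynomial.leadingCoeff_C_mul_X_pow]

/-- The polynomial `Φ(T ^ n)(X)`. -/
def polyTPow (n : ℕ) : Polynomial Ω := (fun P => Φ.polyT.comp P)^[n] Polynomial.X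

lemma polyTPow_succ (n : ℕ) : Φ.polyTPow (n + 1) = Φ.polyT.comp (Φ.polyTPow n) := by
  rw [polyTPow, Function.iterate_succ_apply']
  rfl

lemma natDegree_polyTPow (n : ℕ) : (Φ.polyTPow n).natDegree = (Fintype.card F ^ d) ^ n := by
  induction n with
  | zero => simp [polyTPow]
  | succ n ih => rw [polyTPow_succ, Polynomial.natDegree_comp, ih, natDegree_polyT, pow_succ']

lemma leadingCoeff_polyTPow_succ (n : ℕ) : (Φ.polyTPow (n + 1)).leadingCoeff =
    Φ.coeff (Fin.last d) * (Φ.polyTPow n).leadingCoeff ^ Fintype.card F ^ d := by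
  rw [polyTPow_succ, Polynomial.leadingCoeff_comp, leadingCoeff_polyT, natDegree_polyT]
  rw [natDegree_polyTPow]
  exact pow_ne_zero _ (pow_ne_zero _ Fintype.card_ne_zero)

lemma polyTPow_ne_zero (n : ℕ) : Φ.polyTPow n ≠ 0 := by
  intro h
  have := Φ.natDegree_polyTPow n
  rw [h, Polynomial.natDegree_zero] at this
  exact pow_ne_zero n (pow_ne_zero d (Fintype.card_ne_zero (α := F))) this.symm

lemma leadingCoeff_polyTPow_mem {M : IntermediateField (RatFunc F) Ω} (hM : ∀ i, Φ.coeff i ∈ M)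
    (n : ℕ) : (Φ.polyTPow n).leadingCoeff ∈ M := by
  induction n with
  | zero => simp [polyTPow]
  | succ n ih =>
    rw [leadingCoeff_polyTPow_succ]
    exact mul_mem (hM _) (pow_mem ih _)

lemma val_leadingCoeff_polyTPow {w : Valuation Ω ℝ≥0} (hw : w (Φ.coeff (Fin.last d)) = 1)
    (n : ℕ) : w (Φ.polyTPow n).leadingCoeff = 1 := by
  induction n with
  | zero => simp [polyTPow]
  | succ n ih => rw [leadingCoeff_polyTPow_succ, map_mul, map_pow, hw, ih, one_pow, one_mul]

/-- The product of the `Φ(T ^ k)(X)`, for `k ≤ J`, to the digits of `n` in base `q ^ d`. -/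
def polyDigits (J n : ℕ) : Polynomial Ω := ∏ k ∈ Finset.range (J + 1),
  Φ.polyTPow k ^ (n / (Fintype.card F ^ d) ^ k % Fintype.card F ^ d)

lemma sum_digits_mul_pow (Q J n : ℕ) :
    ∑ k ∈ Finset.range J, n / Q ^ k % Q * Q ^ k = n % Q ^ J := by
  induction J with
  | zero => simp [Nat.mod_one]
  | succ J ih => rw [Finset.sum_range_succ, ih, Nat.mod_pow_succ, mul_comm (n / Q ^ J % Q)]

lemma natDegree_polyDigits {J n : ℕ} (hn : n < (Fintype.card F ^ d) ^ (J + 1)) :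
    (Φ.polyDigits J n).natDegree = n := by
  rw [polyDigits, Polynomial.natDegree_prod _ _ fun k _ => pow_ne_zero _ (Φ.polyTPow_ne_zero k)]
  simp only [Polynomial.natDegree_pow, natDegree_polyTPow]
  rw [sum_digits_mul_pow, Nat.mod_eq_of_lt hn]

lemma polyDigits_ne_zero (J n : ℕ) : Φ.polyDigits J n ≠ 0 :=
  Finset.prod_ne_zero_iff.2 fun k _ => pow_ne_zero _ (Φ.polyTPow_ne_zero k)

lemma leadingCoeff_polyDigits_mem {M : IntermediateField (RatFunc F) Ω}
    (hM : ∀ i, Φ.coeff i ∈ M) (J n : ℕ) : (Φ.polyDigits J n).leadingCoeff ∈ M := by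
  rw [polyDigits, Polynomial.leadingCoeff_prod]
  refine prod_mem fun k _ => ?_
  rw [Polynomial.leadingCoeff_pow]
  exact pow_mem (Φ.leadingCoeff_polyTPow_mem hM k) _

lemma val_leadingCoeff_polyDigits {w : Valuation Ω ℝ≥0} (hw : w (Φ.coeff (Fin.last d)) = 1)
    (J n : ℕ) : w (Φ.polyDigits J n).leadingCoeff = 1 := by
  rw [polyDigits, Polynomial.leadingCoeff_prod, map_prod]
  refine Finset.prod_eq_one fun k _ => ?_
  rw [Polynomial.leadingCoeff_pow, map_pow, Φ.val_leadingCoeff_polyTPow hw, one_pow]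

variable [Algebra F Ω]

lemma eval_polyT (y : Ω) : Φ.polyT.eval y = Φ.action Polynomial.X y := by
  simp [polyT, action_X_apply, Polynomial.eval_finsetSum]

lemma eval_polyTPow (n : ℕ) (y : Ω) :
    (Φ.polyTPow n).eval y = Φ.action (Polynomial.X ^ n) y := by
  induction n with
  | zero => simp [polyTPow]
  | succ n ih => rw [polyTPow_succ, Polynomial.eval_comp, ih, eval_polyT, action_X_pow_succ]

/-! ### The local inequality -/

variable (w : Valuation Ω ℝ≥0)

/-- A radius of a disc on which all `Φ(T ^ k)`, for `k ≤ J`, are bounded by `1`. -/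
def radius (J : ℕ) : ℝ≥0 := (max 1 (w (Φ.coeff 0)))⁻¹ ^ J * (Φ.bound w)⁻¹

/-- The bound for the values of the polynomials `polyDigits J n` at `y`. -/
def sizeBound (J : ℕ) (y : Ω) : ℝ≥0 := ∏ k ∈ Finset.range (J + 1),
  max 1 (w (Φ.action (Polynomial.X ^ k) y)) ^ (Fintype.card F ^ d - 1)

lemma exists_val_eq_radius (J : ℕ) : ∃ ϖ : Ω, w ϖ = Φ.radius w J := by
  obtain ⟨a, ha⟩ : ∃ a : Ω, w a = max 1 (w (Φ.coeff 0)) := by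
    rcases max_choice 1 (w (Φ.coeff 0)) with h | h <;> rw [h]
    · exact ⟨1, w.map_one⟩
    · exact ⟨_, rfl⟩
  obtain ⟨b, hb⟩ : ∃ b : Ω, w b = Φ.bound w := by
    rcases Φ.bound_eq_one_or w with h | ⟨i, h⟩
    · exact ⟨1, by rw [h, w.map_one]⟩
    · exact ⟨_, h.symm⟩
  exact ⟨a⁻¹ ^ J * b⁻¹, by rw [map_mul, map_pow, map_inv₀, map_inv₀, ha, hb, radius]⟩

lemma radius_ne_zero (J : ℕ) : Φ.radius w J ≠ 0 :=
  mul_ne_zero (pow_ne_zero _ (inv_ne_zero (lt_of_lt_of_le one_pos (le_max_left _ _)).ne'))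
    (inv_ne_zero (lt_of_lt_of_le one_pos (Φ.one_le_bound w)).ne')

/-- On a disc of radius at most the inverse of `bound`, the terms of degree at least two do not
exceed `|y|`, so `Φ(T)` enlarges `y` by at most `max(1, |T|)`. This is why `-log radius` is only
linear in `J`, with `J` multiplying a contribution of `T` that lives at infinity. -/
lemma val_action_X_pow_le_of_le_radius {J k : ℕ} (hk : k ≤ J) {y : Ω}
    (hy : w y ≤ Φ.radius w J) :
    w (Φ.action (Polynomial.X ^ k) y) ≤ Φ.radius w (J - k) := by
  set θ : ℝ≥0 := max 1 (w (Φ.coeff 0)) with hθ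
  have hθ1 : 1 ≤ θ := le_max_left _ _
  have hθ0 : θ ≠ 0 := (lt_of_lt_of_le one_pos hθ1).ne'
  have hB := Φ.one_le_bound w
  have hB0 : Φ.bound w ≠ 0 := (lt_of_lt_of_le one_pos hB).ne'
  induction k with
  | zero => simpa using hy
  | succ k ih =>
    have ih := ih (by omega)
    have hstep : Φ.radius w (J - (k + 1)) = θ * Φ.radius w (J - k) := by
      rw [radius, radius, ← hθ, show J - k = J - (k + 1) + 1 by omega, pow_succ]
      field_simp
    rw [hstep, action_X_pow_succ, action_X_apply]
    set z := Φ.action (Polynomial.X ^ k) y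
    set ρ := Φ.radius w (J - k) with hρ
    have hρB : Φ.bound w * ρ ≤ 1 := by
      rw [hρ, radius, mul_left_comm, mul_inv_cancel₀ hB0, mul_one]
      exact pow_le_one₀ zero_le (inv_le_one_of_one_le₀ hθ1)
    have hρ1 : ρ ≤ 1 := (le_mul_of_one_le_left zero_le hB).trans hρB
    refine Valuation.map_sum_le w fun i _ => ?_
    rw [map_mul, map_pow]
    rcases Fin.eq_zero_or_eq_succ i with rfl | ⟨j, rfl⟩
    · simp only [Fin.val_zero, pow_zero, pow_one]
      gcongr
      exact le_max_right _ _
    · have h2 : 2 ≤ Fintype.card F ^ ((Fin.succ j : Fin (d + 1)) : ℕ) := by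
        rw [Fin.val_succ]
        exact (Fintype.one_lt_card (α := F)).trans_le (Nat.le_self_pow (by omega) _)
      calc w (Φ.coeff j.succ) * w z ^ Fintype.card F ^ ((Fin.succ j : Fin (d + 1)) : ℕ)
          ≤ Φ.bound w * ρ ^ Fintype.card F ^ ((Fin.succ j : Fin (d + 1)) : ℕ) := by
            gcongr
            exact Φ.coeff_le_bound w _
        _ ≤ Φ.bound w * ρ ^ 2 := by
            refine mul_le_mul' le_rfl ?_
            exact pow_le_pow_of_le_one zero_le hρ1 h2
        _ = Φ.bound w * ρ * ρ := by ring
        _ ≤ θ * ρ := by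
            gcongr
            exact hρB.trans hθ1

lemma radius_le_one (J : ℕ) : Φ.radius w J ≤ 1 :=
  mul_le_one₀ (pow_le_one₀ zero_le (inv_le_one_of_one_le₀ (le_max_left _ _))) zero_le
    (inv_le_one_of_one_le₀ (Φ.one_le_bound w))

/-- By additivity `Φ(T ^ k)(z) = Φ(T ^ k)(z - y) + Φ(T ^ k)(y)`, and the first term is at most one;
the digits are at most `q ^ d - 1`. -/
lemma val_eval_polyDigits_le {J : ℕ} {y z : Ω} (hz : w (z - y) ≤ Φ.radius w J) (n : ℕ) :
    w ((Φ.polyDigits J n).eval z) ≤ Φ.sizeBound w J y := by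
  rw [polyDigits, Polynomial.eval_prod, map_prod, sizeBound]
  refine Finset.prod_le_prod' fun k hk => ?_
  rw [Polynomial.eval_pow, map_pow, eval_polyTPow]
  have hk : k ≤ J := by
    rw [Finset.mem_range] at hk
    omega
  have h1 : w (Φ.action (Polynomial.X ^ k) z) ≤ max 1 (w (Φ.action (Polynomial.X ^ k) y)) := by
    have e : Φ.action (Polynomial.X ^ k) z = Φ.action (Polynomial.X ^ k) (z - y) +
        Φ.action (Polynomial.X ^ k) y := by rw [map_sub, sub_add_cancel]
    rw [e]
    refine (Valuation.map_add _ _ _).trans (max_le_max ?_ le_rfl)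
    exact (Φ.val_action_X_pow_le_of_le_radius w hk hz).trans (Φ.radius_le_one w _)
  have hQ : 0 < Fintype.card F ^ d := pow_pos Fintype.card_pos _
  refine (pow_le_pow_left₀ zero_le h1 _).trans (pow_le_pow_right₀ (le_max_left _ _) ?_)
  have := Nat.mod_lt (n / (Fintype.card F ^ d) ^ k) hQ
  omega

/-- The main local inequality. -/
theorem prod_max_radius_le [IsAlgClosed Ω] {ι : Type*} [Fintype ι] [DecidableEq ι] (a : ι → Ω)
    (J : ℕ) (hJ : Fintype.card ι ≤ (Fintype.card F ^ d) ^ (J + 1)) :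
    (∏ i, ∏ j ∈ {i}ᶜ, max (Φ.radius w J) (w (a i - a j))) *
      (∏ n ∈ Finset.range (Fintype.card ι), w (Φ.polyDigits J n).leadingCoeff) ^ 2 ≤
      (∏ i, Φ.sizeBound w J (a i)) ^ 2 := by
  obtain ⟨ϖ, hϖ⟩ := Φ.exists_val_eq_radius w J
  -- The points `a i` may coincide, which would make the determinant vanish. The perturbed points
  -- are at least the radius apart and satisfy the same size bounds.
  obtain ⟨b, hb, hbb⟩ := exists_perturbation w F ϖ a
  rw [hϖ] at hbb hb
  let e := (Fintype.equivFin ι).symm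
  have h := prod_val_sub_le w (fun i => b (e i)) (Φ.polyDigits J)
    (fun n hn => Φ.natDegree_polyDigits (hn.trans_le hJ)) (fun n _ => Φ.polyDigits_ne_zero J n)
    (fun i => Φ.sizeBound w J (a (e i))) (fun i n _ => Φ.val_eval_polyDigits_le w (hb (e i)) n)
  rw [e.prod_comp fun i => Φ.sizeBound w J (a i)] at h
  refine le_trans (mul_le_mul_left ?_ _) h
  have e1 : ∏ i, ∏ j ∈ {i}ᶜ, w (b (e i) - b (e j)) = ∏ i, ∏ j ∈ {i}ᶜ, w (b i - b j) := by
    rw [← e.prod_comp fun i => ∏ j ∈ {i}ᶜ, w (b i - b j)]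
    refine Finset.prod_congr rfl fun i _ => ?_
    refine Finset.prod_equiv e (fun j => by simp) fun j _ => rfl
  rw [e1]
  refine Finset.prod_le_prod' fun i _ => Finset.prod_le_prod' fun j hj => hbb i j ?_
  simpa [eq_comm] using hj

end DrinfeldModule

/-! ### Places above an irreducible polynomial, of inertia degree one -/

section Inertia

variable {F : Type*} [Field F] [Fintype F] {l : F[X]} (hl : Irreducible l)

lemma isUnif_finitePlace : IsUnif (finitePlace l hl) (algebraMap F[X] (RatFunc F) l) := by
  refine exists_uniformizer_of_map _ (one_lt_card_pow hl) ?_ _ fun x => rfl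
  rw [IsDedekindDomain.HeightOneSpectrum.valuation_of_algebraMap,
    IsDedekindDomain.HeightOneSpectrum.intValuation_singleton (primeOf l hl) hl.ne_zero rfl]

lemma dvd_pow_card_sub (hl : Irreducible l) (a : F[X]) : l ∣ a ^ Fintype.card F ^ l.natDegree - a := by
  have : Fact (Irreducible l) := ⟨hl⟩
  have hfin : Module.Finite F (AdjoinRoot l) := (AdjoinRoot.powerBasis hl.ne_zero).finite
  have := Module.finite_of_finite F (M := AdjoinRoot l)
  have := Fintype.ofFinite (AdjoinRoot l)
  have hcard : Fintype.card (AdjoinRoot l) = Fintype.card F ^ l.natDegree := by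
    rw [Module.card_eq_pow_finrank (K := F), (AdjoinRoot.powerBasis hl.ne_zero).finrank,
      AdjoinRoot.powerBasis_dim]
  rw [← AdjoinRoot.mk_eq_zero, map_sub, map_pow, ← hcard, FiniteField.pow_card, sub_self]

lemma finitePlace_lt_one_of_dvd {a : F[X]} (h : l ∣ a) :
    finitePlace l hl (algebraMap F[X] (RatFunc F) a) < 1 := by
  obtain ⟨b, rfl⟩ := h
  rw [map_mul, map_mul, mul_comm]
  exact mul_lt_one_of_nonneg_of_lt_one_right (finitePlace_polynomial_le_one l hl b) zero_le
    (isUnif_finitePlace hl).2.1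

/-- Fermat's congruence modulo `l`, extended from polynomials to `l`-integral fractions by clearing
a denominator prime to `l`. -/
lemma finitePlace_pow_card_sub_lt_one {a : RatFunc F} (ha : finitePlace l hl a ≤ 1) :
    finitePlace l hl (a ^ Fintype.card F ^ l.natDegree - a) < 1 := by
  set Q := Fintype.card F ^ l.natDegree
  rw [finitePlace_apply, WithZeroMulInt.toNNReal_le_one_iff (one_lt_card_pow hl)] at ha
  obtain ⟨n, s, hns⟩ := (primeOf l hl).exists_primeCompl_mul_eq_of_integer a ha
  have hs : ¬ l ∣ s := fun h => s.2 (Ideal.mem_span_singleton.2 h)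
  have hs0 : (s : F[X]) ≠ 0 := fun h => hs (h ▸ dvd_zero l)
  have hsv := finitePlace_polynomial_eq_one hl hs
  have hs0' : algebraMap F[X] (RatFunc F) s ≠ 0 := by simpa using hs0
  have e : (a ^ Q - a) * (algebraMap F[X] (RatFunc F) s) ^ (Q + 1) =
      algebraMap F[X] (RatFunc F) (n ^ Q * s - n * (s : F[X]) ^ Q) := by
    simp only [map_sub, map_mul, map_pow]
    rw [← hns]
    ring
  have h2 : finitePlace l hl ((a ^ Q - a) * (algebraMap F[X] (RatFunc F) s) ^ (Q + 1)) < 1 := by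
    rw [e]
    refine finitePlace_lt_one_of_dvd hl ?_
    have : n ^ Q * (s : F[X]) - n * (s : F[X]) ^ Q =
        (n ^ Q - n) * s - n * ((s : F[X]) ^ Q - s) := by ring
    rw [this]
    exact dvd_sub ((dvd_pow_card_sub hl n).mul_right _) ((dvd_pow_card_sub hl _).mul_left _)
  rwa [map_mul, map_pow, hsv, one_pow, mul_one] at h2

variable {K : Type*} [Field K] [Algebra (RatFunc F) K] [FiniteDimensional (RatFunc F) K]

/-- With inertia degree one, `a` is congruent to an element `b'` of `k`, for which the congruence is
known, and Frobenius is additive. -/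
lemma pow_card_sub_lt_one_of_inertiaDeg (hl : Irreducible l) (w : Place F K)
    (hw : w.base = finitePlace l hl) (hf : w.inertiaDeg = 1) {a : K} (ha : w.1 a ≤ 1) :
    w.1 (a ^ Fintype.card F ^ l.natDegree - a) < 1 := by
  set Q := Fintype.card F ^ l.natDegree with hQ
  have hsurj := (Algebra.finrank_eq_one_iff_bijective_algebraMap.1 hf).2
  obtain ⟨b, hb⟩ := hsurj (IsLocalRing.residue _ (⟨a, ha⟩ : w.1.valuationSubring))
  obtain ⟨b, rfl⟩ := IsLocalRing.residue_surjective b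
  have hb' : IsLocalRing.residue w.1.valuationSubring
      (algebraMap w.base.valuationSubring w.1.valuationSubring b - ⟨a, ha⟩) = 0 := by
    rw [map_sub, ← hb]
    exact sub_self _
  rw [IsLocalRing.residue_eq_zero_iff, IsLocalRing.mem_maximalIdeal, mem_nonunits_iff,
    isUnit_valuationSubring_iff] at hb'
  set b' : K := algebraMap (RatFunc F) K (b : RatFunc F) with hb'def
  have h1 : w.1 (b' - a) < 1 := lt_of_le_of_ne
    (Valuation.map_sub_le _ (show w.1 b' ≤ 1 from b.2) ha) hb'
  have h2 : w.1 (b' ^ Q - b') < 1 := by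
    have h3 : finitePlace l hl (b : RatFunc F) ≤ 1 := by
      rw [← hw]
      exact b.2
    have h4 := finitePlace_pow_card_sub_lt_one hl h3
    rw [← hw] at h4
    rw [hb'def, ← map_pow, ← map_sub]
    exact h4
  obtain ⟨p, hp⟩ := CharP.exists F
  have hpp : Fact p.Prime := ⟨CharP.char_is_prime F p⟩
  obtain ⟨m, -, hm⟩ := FiniteField.card F p
  have : CharP (RatFunc F) p := charP_of_injective_algebraMap (algebraMap F (RatFunc F)).injective p
  have : CharP K p := charP_of_injective_algebraMap (algebraMap (RatFunc F) K).injective p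
  have hfrob : a ^ Q = b' ^ Q - (b' - a) ^ Q := by
    rw [hQ, hm, ← pow_mul, sub_pow_char_pow]
    ring
  have e : a ^ Q - a = (b' ^ Q - b') + (b' - a) - (b' - a) ^ Q := by
    rw [hfrob]
    ring
  rw [e]
  refine Valuation.map_sub_lt _ (Valuation.map_add_lt _ h2 h1) ?_
  rw [map_pow]
  exact pow_lt_one₀ zero_le h1 (pow_ne_zero _ Fintype.card_ne_zero)

/-- Values less than one are bounded away from one. -/
lemma exists_gap (hl : Irreducible l) (w : Place F K) (hw : w.base = finitePlace l hl)
    (Ω : Type*) [Field Ω] [Algebra (RatFunc F) Ω] [Algebra.IsAlgebraic (RatFunc F) Ω]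
    [IsAlgClosed Ω] (hf : w.inertiaDeg = 1) : ∃ g : ℝ≥0, g ≠ 0 ∧ g < 1 ∧
      Real.logb (Fintype.card F) g ≤ -(l.natDegree / Module.finrank (RatFunc F) K : ℝ) ∧
      ∀ a : K, w.1 a < 1 → w.1 a ≤ g := by
  classical
  have hv : w.base = (BasePlace.finite l hl).1 := hw
  have hπ := isUnif_finitePlace hl
  rw [← hw] at hπ
  have hfin := (BasePlace.finite l hl).2.integralClosure_finite K
  rw [← hv] at hfin
  obtain ⟨u, hu0, hu1, hval, -, he, -, -⟩ :=
    exists_local_parameter (v := w.base) (w := w.1) hπ (fun x => rfl)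
  change w.1 u ^ w.ramificationIdx = _ at he
  have hdeg := w.localDegree_eq (Ω := Ω) _ hv
  -- As `f = 1`, the ramification index is the local degree, hence at most `[K : k]`. Since `l` is
  -- the `e`-th power of the gap up to units, this bounds the gap `w u`.
  have hle : w.ramificationIdx ≤ Module.finrank (RatFunc F) K := by
    have h1 : w.localDegree = w.ramificationIdx := by rw [Place.localDegree, hf, mul_one]
    rw [← h1, hdeg.1, ← Field.finSepDegree_mul_finInsepDegree (RatFunc F) K, mul_comm]
    gcongr
    rw [Field.finSepDegree_eq_of_isAlgClosed (RatFunc F) K Ω, Nat.card_eq_fintype_card]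
    exact Finset.card_le_univ _
  have hq : (1 : ℝ) < Fintype.card F := by exact_mod_cast Fintype.one_lt_card
  refine ⟨w.1 u, hu0, hu1, ?_, fun a ha => ?_⟩
  · rw [hw, finitePlace_self] at he
    have h2 := congrArg (fun t : ℝ≥0 => Real.logb (Fintype.card F) t) he
    simp only [NNReal.coe_pow, NNReal.coe_inv, NNReal.coe_natCast] at h2
    rw [Real.logb_pow, Real.logb_inv, Real.logb_pow, Real.logb_self_eq_one hq, mul_one] at h2
    have h3 : Real.logb (Fintype.card F) (w.1 u) ≤ 0 :=
      Real.logb_nonpos hq (w.1 u).2 (by exact_mod_cast hu1.le)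
    have hc : (0 : ℝ) < Module.finrank (RatFunc F) K := by
      exact_mod_cast Module.finrank_pos (R := RatFunc F) (M := K)
    rw [← neg_div, le_div_iff₀ hc]
    have hle' : (w.ramificationIdx : ℝ) ≤ Module.finrank (RatFunc F) K := by exact_mod_cast hle
    nlinarith
  · rcases eq_or_ne a 0 with rfl | ha0
    · simp
    obtain ⟨n, hn⟩ := hval a ha0
    rw [hn] at ha ⊢
    have hn0 : 0 < n := by
      by_contra! h
      exact absurd ha (not_lt.2 (one_le_zpow_of_nonpos₀ (pos_iff_ne_zero.2 hu0) hu1.le h))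
    calc w.1 u ^ n ≤ w.1 u ^ (1 : ℤ) :=
          zpow_le_zpow_right_of_le_one₀ (pos_iff_ne_zero.2 hu0) hu1.le (by omega)
      _ = _ := zpow_one _

end Inertia

/-! ### Congruences -/

section Congruence

variable {Ω : Type*} [Field Ω] {w : Valuation Ω ℝ≥0} {g : ℝ≥0}

lemma val_mul_sub_mul_le {a b a' b' : Ω} (hb : w b ≤ 1) (ha' : w a' ≤ 1)
    (h : w (a - a') ≤ g) (h' : w (b - b') ≤ g) : w (a * b - a' * b') ≤ g := by
  have e : a * b - a' * b' = (a - a') * b + a' * (b - b') := by ring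
  rw [e]
  refine Valuation.map_add_le w ?_ ?_
  · rw [map_mul]
    exact (mul_le_of_le_one_right' hb).trans h
  · rw [map_mul]
    exact (mul_le_of_le_one_left' ha').trans h'

lemma val_pow_sub_pow_le {a a' : Ω} (ha : w a ≤ 1) (ha' : w a' ≤ 1) (h : w (a - a') ≤ g) (n : ℕ) :
    w (a ^ n - a' ^ n) ≤ g := by
  induction n with
  | zero => simp
  | succ n ih =>
    rw [pow_succ, pow_succ]
    exact val_mul_sub_mul_le ha (by rw [map_pow]; exact pow_le_one₀ zero_le ha') ih h

/-- If a binary form vanishes at `(y, z)` and `Q` is a power of the characteristic, it is small at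
points close to `(y ^ Q, z ^ Q)`. -/
lemma val_form_le {p m : ℕ} [ExpChar Ω p] {n : ℕ} {c : ℕ → Ω} {y z y' z' : Ω}
    (hc : ∀ i, w (c i) ≤ 1) (hcQ : ∀ i, w (c i - c i ^ p ^ m) ≤ g)
    (hy : w y ≤ 1) (hz : w z ≤ 1) (hy' : w y' ≤ 1) (hz' : w z' ≤ 1)
    (hyy : w (y' - y ^ p ^ m) ≤ g) (hzz : w (z' - z ^ p ^ m) ≤ g)
    (h0 : ∑ i ∈ Finset.range (n + 1), c i * (y ^ i * z ^ (n - i)) = 0) :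
    w (∑ i ∈ Finset.range (n + 1), c i * (y' ^ i * z' ^ (n - i))) ≤ g := by
  have h1 := congrArg (fun t => t ^ p ^ m) h0
  simp only [sum_pow_char_pow, zero_pow (pow_ne_zero m (expChar_pos Ω p).ne')] at h1
  rw [← sub_zero (∑ i ∈ Finset.range (n + 1), c i * (y' ^ i * z' ^ (n - i))), ← h1,
    ← Finset.sum_sub_distrib]
  refine Valuation.map_sum_le w fun i _ => ?_
  have hpow : ∀ {a : Ω}, w a ≤ 1 → ∀ k : ℕ, w (a ^ k) ≤ 1 := fun ha k => by
    rw [map_pow]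
    exact pow_le_one₀ zero_le ha
  rw [mul_pow, mul_pow, pow_right_comm y, pow_right_comm z]
  refine val_mul_sub_mul_le ?_ (hpow (hc i) _) (hcQ i) ?_
  · rw [map_mul]
    exact mul_le_one' (hpow hy' _) (hpow hz' _)
  · exact val_mul_sub_mul_le (hpow hz' _) (hpow (hpow hy _) _)
      (val_pow_sub_pow_le hy' (hpow hy _) hyy i) (val_pow_sub_pow_le hz' (hpow hz _) hzz _)

end Congruence

namespace DrinfeldModule

/-! ### Estimates at the primes with property RV -/

variable {F : Type*} [Field F] [Fintype F] {Ω : Type*} [Field Ω] [Algebra (RatFunc F) Ω]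
  {d : ℕ} (Φ : DrinfeldModule F Ω d)

/-- The place of `k(Φ)` induced by a valuation of `Ω`. -/
def placeOfVal (w : Valuation Ω ℝ≥0) {v : Valuation (RatFunc F) ℝ≥0} (hv : IsBasePlace F v)
    (hw : ∀ x, w (algebraMap (RatFunc F) Ω x) = v x) : Place F Φ.coeffField :=
  ⟨w.comap (algebraMap Φ.coeffField Ω), by
    convert hv
    ext x
    exact congrArg _ (hw x)⟩

lemma placeOfVal_base (w : Valuation Ω ℝ≥0) {v : Valuation (RatFunc F) ℝ≥0} (hv : IsBasePlace F v)
    (hw : ∀ x, w (algebraMap (RatFunc F) Ω x) = v x) : (Φ.placeOfVal w hv hw).base = v := by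
  ext x
  exact congrArg _ (hw x)

variable [Algebra F Ω]

/-- The polynomial `Φ(a)(X)`. -/
def polyOf (a : F[X]) : Polynomial Ω := ∑ i ∈ Finset.range (a.natDegree + 1),
  Polynomial.C (algebraMap F Ω (a.coeff i)) * Φ.polyTPow i

lemma eval_polyOf (a : F[X]) (y : Ω) : (Φ.polyOf a).eval y = Φ.action a y := by
  rw [action_eq_sum, polyOf, Polynomial.eval_finsetSum]
  refine Finset.sum_congr rfl fun i _ => ?_
  rw [Polynomial.eval_mul, Polynomial.eval_C, eval_polyTPow, Algebra.smul_def]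

lemma natDegree_polyOf_le (a : F[X]) :
    (Φ.polyOf a).natDegree ≤ Fintype.card F ^ (d * a.natDegree) := by
  refine Polynomial.natDegree_sum_le_of_forall_le _ _ fun i hi => ?_
  refine (Polynomial.natDegree_C_mul_le _ _).trans ?_
  rw [natDegree_polyTPow, ← pow_mul]
  refine Nat.pow_le_pow_right Fintype.card_pos ?_
  have := Finset.mem_range.1 hi
  gcongr
  omega

/-- At a valuation with `|Φ(l)(z) - z ^ Q| < max(1, |z|) ^ Q` the module has good reduction. -/
lemma val_coeff_last_eq_one {w : Valuation Ω ℝ≥0} (hc : ∀ i, w (Φ.coeff i) ≤ 1) {l : F[X]}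
    (hl : 0 < l.natDegree) {z : Ω} (hz : 1 < w z)
    (hlz : w (Φ.action l z) = w z ^ Fintype.card F ^ (d * l.natDegree)) :
    w (Φ.coeff (Fin.last d)) = 1 := by
  refine le_antisymm (hc _) (not_lt.1 fun hlt => ?_)
  have hq1 : 1 < Fintype.card F ^ d := Nat.one_lt_pow Φ.rank_pos.ne' Fintype.one_lt_card
  have hb : Φ.bound w = 1 := max_eq_left (Finset.sup_le fun i _ => hc i)
  -- If `|a_d| < 1`, then `Φ(T)` raises `|z|` to strictly less than the power `q ^ d`. Iterating,
  -- `|Φ(l)(z)|` would fall strictly below `|z| ^ (q ^ (d deg l))`.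
  have hone : max 1 (w (Φ.action Polynomial.X z)) < w z ^ Fintype.card F ^ d := by
    refine max_lt (one_lt_pow₀ hz (by omega)) ?_
    rw [action_X_apply]
    refine Valuation.map_sum_lt w (pow_ne_zero _ (one_pos.trans hz).ne') fun i _ => ?_
    rw [map_mul, map_pow]
    rcases Fin.eq_castSucc_or_eq_last i with ⟨j, rfl⟩ | rfl
    · calc w (Φ.coeff j.castSucc) * w z ^ Fintype.card F ^ (j.castSucc : ℕ)
          ≤ w z ^ Fintype.card F ^ (j.castSucc : ℕ) := mul_le_of_le_one_left' (hc _)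
        _ < _ := pow_lt_pow_right₀ hz (Nat.pow_lt_pow_right Fintype.one_lt_card j.2)
    · exact mul_lt_of_lt_one_left (pow_pos (one_pos.trans hz) _) hlt
  have hall : ∀ i : ℕ, max 1 (w (Φ.action (Polynomial.X ^ (i + 1)) z)) <
      w z ^ Fintype.card F ^ (d * (i + 1)) := by
    intro i
    induction i with
    | zero => simpa using hone
    | succ i ih =>
      rw [action_X_pow_succ]
      refine (Φ.max_val_action_X_le w _).trans_lt ?_
      rw [hb, one_mul]
      calc _ < (w z ^ Fintype.card F ^ (d * (i + 1))) ^ Fintype.card F ^ d :=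
            pow_lt_pow_left₀ ih zero_le (by omega)
        _ = _ := by rw [← pow_mul, ← pow_add, mul_add d (i + 1) 1, mul_one]
  refine absurd hlz (ne_of_lt ?_)
  rw [action_eq_sum]
  refine Valuation.map_sum_lt w (pow_ne_zero _ (one_pos.trans hz).ne') fun i hi => ?_
  refine (val_smul_le w _ _).trans_lt ?_
  have hi' : i ≤ l.natDegree := by
    have := Finset.mem_range.1 hi
    omega
  rcases i with _ | i
  · rw [pow_zero, map_one, Module.End.one_apply]
    conv_lhs => rw [← pow_one (w z)]
    exact pow_lt_pow_right₀ hz (Nat.one_lt_pow (mul_ne_zero Φ.rank_pos.ne' hl.ne')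
      Fintype.one_lt_card)
  · refine ((le_max_right _ _).trans_lt (hall i)).trans_le (pow_le_pow_right₀ hz.le ?_)
    refine Nat.pow_le_pow_right Fintype.card_pos ?_
    gcongr

/-- Good reduction: the size bound dominates powers of the absolute value. -/
lemma max_val_pow_le_sizeBound {w : Valuation Ω ℝ≥0} (hc : ∀ i, w (Φ.coeff i) ≤ 1)
    (hlast : w (Φ.coeff (Fin.last d)) = 1) (J : ℕ) (z : Ω) :
    max 1 (w z) ^ ((Fintype.card F ^ d) ^ (J + 1) - 1) ≤ Φ.sizeBound w J z := by
  have hq1 : 1 < Fintype.card F ^ d := Nat.one_lt_pow Φ.rank_pos.ne' Fintype.one_lt_card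
  rcases le_or_gt (w z) 1 with hz | hz
  · rw [max_eq_left hz, one_pow]
    exact Finset.one_le_prod' fun k _ => one_le_pow₀ (le_max_left _ _)
  have hstep : ∀ y, 1 < w y → w (Φ.action Polynomial.X y) = w y ^ Fintype.card F ^ d := by
    intro y hy
    rw [Φ.val_action_X_of_lt w hy fun i => ?_, hlast, one_mul]
    rw [hlast, one_mul]
    exact (mul_le_of_le_one_left' (hc _)).trans_lt
      (pow_lt_pow_right₀ hy (Nat.pow_lt_pow_right Fintype.one_lt_card i.2))
  have hall : ∀ k : ℕ, w (Φ.action (Polynomial.X ^ k) z) = w z ^ (Fintype.card F ^ d) ^ k := by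
    intro k
    induction k with
    | zero => simp
    | succ k ih =>
      rw [action_X_pow_succ, hstep, ih, ← pow_mul, pow_succ]
      rw [ih]
      exact one_lt_pow₀ hz (pow_ne_zero _ (by omega))
  rw [sizeBound, max_eq_right hz.le]
  calc w z ^ ((Fintype.card F ^ d) ^ (J + 1) - 1)
      = w z ^ ∑ k ∈ Finset.range (J + 1), (Fintype.card F ^ d) ^ k * (Fintype.card F ^ d - 1) := by
        rw [← Finset.sum_mul, Nat.geomSum_eq hq1, Nat.div_mul_cancel (Nat.sub_one_dvd_pow_sub_one _ _)]
    _ = ∏ k ∈ Finset.range (J + 1),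
        w z ^ ((Fintype.card F ^ d) ^ k * (Fintype.card F ^ d - 1)) :=
        (Finset.prod_pow_eq_pow_sum _ _ _).symm
    _ ≤ _ := Finset.prod_le_prod' fun k _ => by
        rw [hall k, pow_mul]
        gcongr
        exact le_max_right _ _

variable [Algebra.IsAlgebraic (RatFunc F) Ω] [IsAlgClosed Ω]

/-- A valuation of `Ω` lying over `l`, with the consequences of property RV. -/
theorem IsRVPrime.exists_gap {l : F[X]} (h : Φ.IsRVPrime l) {hl : Irreducible l}
    {w : Valuation Ω ℝ≥0} (hw : ∀ x, w (algebraMap (RatFunc F) Ω x) = finitePlace l hl x) :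
    (∀ i, w (Φ.coeff i) ≤ 1) ∧ ∃ g : ℝ≥0, g ≠ 0 ∧ g < 1 ∧
      Real.logb (Fintype.card F) g ≤ -(l.natDegree / Φ.coeffDegree : ℝ) ∧
      (∀ z, w (Φ.action l z - z ^ Fintype.card F ^ (d * l.natDegree)) ≤
        g * max 1 (w z) ^ Fintype.card F ^ (d * l.natDegree)) ∧
      ∀ a : Φ.coeffField, w a ≤ 1 →
        w ((a : Ω) - (a : Ω) ^ Fintype.card F ^ (d * l.natDegree)) ≤ g := by
  obtain ⟨-, hl', hRV⟩ := h
  set u := Φ.placeOfVal w (Or.inr ⟨l, hl, rfl⟩) hw with hu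
  have hub : u.base = finitePlace l hl := Φ.placeOfVal_base w _ hw
  obtain ⟨hInt, ⟨P, hP, hPres⟩, hf⟩ := hRV u hub
  obtain ⟨g, hg0, hg1, hglog, hg⟩ := DrinfeldLehmer.exists_gap hl u hub Ω hf
  refine ⟨hInt, g, hg0, hg1, hglog, fun z => ?_, fun a ha => ?_⟩
  · set Q := Fintype.card F ^ (d * l.natDegree) with hQ
    set ι := (algebraMap Φ.coeffField Ω).comp u.1.valuationSubring.subtype with hι
    have hmap : P.map ι = Φ.polyOf l := Polynomial.funext fun z => by
      rw [Polynomial.eval_map, hP, eval_polyOf]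
    have hcoeff : ∀ i, w ((Φ.polyOf l - Polynomial.X ^ Q).coeff i) ≤ g := by
      intro i
      have h1 : (Φ.polyOf l - Polynomial.X ^ Q).coeff i =
          ι ((P - Polynomial.X ^ Q).coeff i) := by
        rw [← hmap, ← Polynomial.coeff_map, Polynomial.map_sub, Polynomial.map_pow,
          Polynomial.map_X]
      have h2 : IsLocalRing.residue u.1.valuationSubring ((P - Polynomial.X ^ Q).coeff i) = 0 := by
        rw [← Polynomial.coeff_map, Polynomial.map_sub, hPres, Polynomial.map_pow,
          Polynomial.map_X, sub_self, Polynomial.coeff_zero]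
      rw [IsLocalRing.residue_eq_zero_iff, IsLocalRing.mem_maximalIdeal, mem_nonunits_iff,
        isUnit_valuationSubring_iff] at h2
      rw [h1]
      exact hg _ (lt_of_le_of_ne ((P - Polynomial.X ^ Q).coeff i).2 h2)
    have hdeg : (Φ.polyOf l - Polynomial.X ^ Q).natDegree ≤ Q :=
      (Polynomial.natDegree_sub_le _ _).trans
        (max_le (Φ.natDegree_polyOf_le l) (Polynomial.natDegree_X_pow_le _))
    have := val_eval_le w hcoeff hdeg z
    rwa [Polynomial.eval_sub, eval_polyOf, Polynomial.eval_pow, Polynomial.eval_X] at this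
  -- RV gives `Q = (q ^ deg l) ^ d`, so the congruence for `q ^ deg l` is iterated `d` times.
  · have key : ∀ m : ℕ, u.1 (a ^ (Fintype.card F ^ l.natDegree) ^ m - a) < 1 := by
      intro m
      induction m with
      | zero => simp
      | succ m ih =>
        have h1 := pow_card_sub_lt_one_of_inertiaDeg hl u hub hf
          (a := a ^ (Fintype.card F ^ l.natDegree) ^ m) (by
            rw [map_pow]
            exact pow_le_one₀ zero_le ha)
        rw [← pow_mul, ← pow_succ] at h1
        have := Valuation.map_add_lt _ h1 ih
        rwa [sub_add_sub_cancel] at this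
    have h2 := hg _ (key d)
    rw [Valuation.map_sub_swap, ← pow_mul, mul_comm l.natDegree] at h2
    exact h2

variable {Φ} in
/-- The `l`-adic gain: if `f` vanishes at `z` then `f(Φ(l)(z))` is small. -/
theorem IsRVPrime.exists_gain {l : F[X]} (h : Φ.IsRVPrime l) {hl : Irreducible l}
    {w : Valuation Ω ℝ≥0} (hw : ∀ x, w (algebraMap (RatFunc F) Ω x) = finitePlace l hl x) :
    (∀ i, w (Φ.coeff i) ≤ 1) ∧ w (Φ.coeff (Fin.last d)) = 1 ∧
    ∃ g : ℝ≥0, g ≠ 0 ∧ Real.logb (Fintype.card F) g ≤ -(l.natDegree / Φ.coeffDegree : ℝ) ∧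
      ∀ (f : Polynomial Φ.coeffField) (n : ℕ) (B : ℝ≥0) (z : Ω), f.natDegree ≤ n →
        (∀ i, w (f.coeff i : Ω) ≤ B) → Polynomial.aeval z f = 0 →
        w (Polynomial.aeval (Φ.action l z) f) ≤ g * B * max 1 (w (Φ.action l z)) ^ n := by
  obtain ⟨hInt, g, hg0, hg1, hglog, hact, hpow⟩ := IsRVPrime.exists_gap Φ h hw
  set Q := Fintype.card F ^ (d * l.natDegree) with hQ
  have hQ0 : Q ≠ 0 := pow_ne_zero _ Fintype.card_ne_zero
  have hval : ∀ z, 1 < w z → w (Φ.action l z) = w z ^ Q := by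
    intro z hz
    have h1 := hact z
    rw [max_eq_right hz.le] at h1
    have h2 : w (Φ.action l z - z ^ Q) < w (z ^ Q) := by
      rw [map_pow]
      exact h1.trans_lt (mul_lt_of_lt_one_left (pow_pos (one_pos.trans hz) _) hg1)
    have h3 := Valuation.map_add_eq_of_lt_left w h2
    rwa [add_sub_cancel, map_pow] at h3
  -- The test point `1 / l` has absolute value greater than one, and there `|Φ(l)(z)| = |z| ^ Q`,
  -- which forces good reduction.
  have hlast : w (Φ.coeff (Fin.last d)) = 1 := by
    refine Φ.val_coeff_last_eq_one hInt hl.natDegree_pos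
      (z := algebraMap (RatFunc F) Ω (algebraMap F[X] (RatFunc F) l)⁻¹) ?_ (hval _ ?_) <;>
    · rw [hw, map_inv₀]
      exact (one_lt_inv₀ (pos_iff_ne_zero.2 (isUnif_finitePlace hl).1)).2
        (isUnif_finitePlace hl).2.1
  refine ⟨hInt, hlast, g, hg0, hglog, fun f n B z hn hB hz => ?_⟩
  set y := Φ.action l z with hy
  rcases eq_or_ne f 0 with rfl | hf0
  · simp
  -- Dividing by the largest coefficient makes all coefficients integral, so that they are congruent
  -- to their `Q`-th powers.
  obtain ⟨j, -, hj⟩ := Finset.exists_max_image f.support (fun i => w (f.coeff i : Ω))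
    (Polynomial.support_nonempty.2 hf0)
  have hfj : f.coeff j ≠ 0 := by
    intro h0
    have hall : ∀ i, f.coeff i = 0 := fun i => by
      by_contra hi
      have := hj i (Polynomial.mem_support_iff.2 hi)
      rw [h0, ZeroMemClass.coe_zero, map_zero, le_zero_iff, map_eq_zero] at this
      exact hi (Subtype.ext this)
    exact hf0 (Polynomial.ext fun i => by rw [hall i, Polynomial.coeff_zero])
  have hwj : w (f.coeff j : Ω) ≠ 0 := (Valuation.ne_zero_iff _).2 (by simpa using hfj)
  have hmax : ∀ i, w (f.coeff i : Ω) ≤ w (f.coeff j : Ω) := fun i => by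
    by_cases hi : i ∈ f.support
    · exact hj i hi
    · rw [Polynomial.notMem_support_iff.1 hi]
      simp
  let c : ℕ → Φ.coeffField := fun i => f.coeff i / f.coeff j
  have hc : ∀ i, w (c i : Ω) ≤ 1 := fun i => by
    simp only [c]
    push_cast
    rw [map_div₀]
    exact div_le_one_of_le₀ (hmax i) zero_le
  have hsum : ∀ t : Ω, Polynomial.aeval t f =
      (f.coeff j : Ω) * ∑ i ∈ Finset.range (n + 1), (c i : Ω) * t ^ i := by
    intro t
    rw [Polynomial.aeval_eq_sum_range' (Nat.lt_succ_of_le hn), Finset.mul_sum]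
    refine Finset.sum_congr rfl fun i _ => ?_
    have : (f.coeff j : Ω) ≠ 0 := by simpa using hfj
    simp only [c]
    push_cast
    rw [Algebra.smul_def, ← mul_assoc, mul_div_cancel₀ _ this]
    rfl
  obtain ⟨p, hp⟩ := CharP.exists F
  have hpp : Fact p.Prime := ⟨CharP.char_is_prime F p⟩
  have : CharP Ω p := charP_of_injective_algebraMap (algebraMap F Ω).injective p
  obtain ⟨m, -, hm⟩ := FiniteField.card F p
  have hQp : Q = p ^ (m * (d * l.natDegree)) := by rw [hQ, hm, ← pow_mul]
  rw [hsum] at hz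
  have hz := (mul_eq_zero.1 hz).resolve_left (by simpa using hfj)
  have hgoal : w (∑ i ∈ Finset.range (n + 1), (c i : Ω) * y ^ i) ≤ g * max 1 (w y) ^ n →
      w (Polynomial.aeval y f) ≤ g * B * max 1 (w y) ^ n := by
    intro h1
    rw [hsum, map_mul]
    calc _ ≤ B * (g * max 1 (w y) ^ n) := mul_le_mul' (hB j) h1
      _ = _ := by ring
  apply hgoal
  rcases le_or_gt (w z) 1 with hz1 | hz1
  · have h1 := hact z
    rw [max_eq_left hz1, one_pow, mul_one] at h1
    have hy1 : w y ≤ 1 := by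
      have := Valuation.map_add_le w (h1.trans hg1.le) (show w (z ^ Q) ≤ 1 by
        rw [map_pow]
        exact pow_le_one₀ zero_le hz1)
      rwa [sub_add_cancel] at this
    have h2 := val_form_le (w := w) (g := g) (p := p) (m := m * (d * l.natDegree)) (n := n)
      (c := fun i => (c i : Ω)) (y := z) (z := 1) (y' := y) (z' := 1) hc
      (fun i => by rw [← hQp]; exact hpow (c i) (hc i)) hz1 w.map_one.le hy1 w.map_one.le
      (by rw [← hQp]; exact h1) (by simp) (by simpa using hz)
    rw [max_eq_left hy1, one_pow, mul_one]
    simpa using h2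
  · have hwy := hval z hz1
    have hz0 : z ≠ 0 := fun h => by simp [h] at hz1
    have hzpos : 0 < w z := one_pos.trans hz1
    have hy1 : 1 < w y := by
      rw [hwy]
      exact one_lt_pow₀ hz1 hQ0
    have hy0 : y ≠ 0 := fun h => by simp [h] at hy1
    have hypos : 0 < w y := one_pos.trans hy1
    have hinv : ∀ {t : Ω}, 1 < w t → w t⁻¹ ≤ 1 := fun ht => by
      rw [map_inv₀]
      exact inv_le_one_of_one_le₀ ht.le
    -- When `|z| > 1`, pass to the reversed polynomial at `z⁻¹`; `f` is in effect treated as a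
    -- binary form on the projective line.
    have hrev : ∀ t : Ω, t ≠ 0 → ∑ i ∈ Finset.range (n + 1), (c i : Ω) * ((1 : Ω) ^ i * t⁻¹ ^ (n - i)) =
        t⁻¹ ^ n * ∑ i ∈ Finset.range (n + 1), (c i : Ω) * t ^ i := by
      intro t ht
      rw [Finset.mul_sum]
      refine Finset.sum_congr rfl fun i hi => ?_
      have hi : i ≤ n := by
        have := Finset.mem_range.1 hi
        omega
      rw [one_pow, one_mul]
      have : t⁻¹ ^ n = t⁻¹ ^ (n - i) * t⁻¹ ^ i := by rw [← pow_add, Nat.sub_add_cancel hi]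
      rw [this, inv_pow t i]
      field_simp
    have h2 := val_form_le (w := w) (g := g) (p := p) (m := m * (d * l.natDegree)) (n := n)
      (c := fun i => (c i : Ω)) (y := 1) (z := z⁻¹) (y' := 1) (z' := y⁻¹) hc
      (fun i => by rw [← hQp]; exact hpow (c i) (hc i)) w.map_one.le (hinv hz1) w.map_one.le
      (hinv hy1) (by simp) (by
        rw [← hQp]
        have e : y⁻¹ - z⁻¹ ^ Q = -((y - z ^ Q) * (y * z ^ Q)⁻¹) := by
          rw [inv_pow]
          field_simp
          ring
        rw [e, Valuation.map_neg, map_mul, map_inv₀, map_mul, map_pow, hwy]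
        have h1 := hact z
        rw [max_eq_right hz1.le] at h1
        have hzQ : 0 < w z ^ Q := pow_pos hzpos _
        calc w (y - z ^ Q) * (w z ^ Q * w z ^ Q)⁻¹ ≤ g * w z ^ Q * (w z ^ Q * w z ^ Q)⁻¹ := by
              gcongr
          _ = g * (w z ^ Q)⁻¹ := by
              have := hzQ.ne'
              field_simp
          _ ≤ g := mul_le_of_le_one_right' (inv_le_one_of_one_le₀ (one_le_pow₀ hz1.le)))
      (by rw [hrev z hz0, hz, mul_zero])
    rw [hrev y hy0, map_mul, map_pow, map_inv₀] at h2
    rw [max_eq_right hy1.le]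
    have hyn : 0 < w y ^ n := pow_pos hypos _
    rw [inv_pow, inv_mul_le_iff₀ hyn] at h2
    rwa [mul_comm]

end DrinfeldModule

namespace DrinfeldModule

/-! ### Conjugates over the field of coefficients -/

variable {F : Type*} [Field F] [Fintype F] {Ω : Type*} [Field Ω] [Algebra (RatFunc F) Ω]
  {d : ℕ} (Φ : DrinfeldModule F Ω d)

lemma algEquiv_coeff (γ : Ω ≃ₐ[Φ.coeffField] Ω) (i : Fin (d + 1)) :
    γ.restrictScalars (RatFunc F) (Φ.coeff i) = Φ.coeff i :=
  γ.commutes (Φ.coeff' i)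

variable [Algebra.IsAlgebraic (RatFunc F) Ω]

lemma finite_orbit (x : Ω) : (MulAction.orbit (Ω ≃ₐ[Φ.coeffField] Ω) x).Finite := by
  classical
  have hInt : IsIntegral Φ.coeffField x :=
    (Algebra.IsIntegral.isIntegral (R := RatFunc F) x).tower_top
  refine (Polynomial.rootSet_finite (minpoly Φ.coeffField x) Ω).subset ?_
  rintro _ ⟨γ, rfl⟩
  rw [Polynomial.mem_rootSet]
  refine ⟨minpoly.ne_zero hInt, ?_⟩
  change Polynomial.aeval (γ x) _ = 0
  rw [Polynomial.aeval_algHom_apply, minpoly.aeval, map_zero]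

/-- The conjugates of `x` over `k(Φ)`. -/
def conj (x : Ω) : Finset Ω := (Φ.finite_orbit x).toFinset

lemma mem_conj {x z : Ω} : z ∈ Φ.conj x ↔ ∃ γ : Ω ≃ₐ[Φ.coeffField] Ω, γ x = z := by
  rw [conj, Set.Finite.mem_toFinset]
  exact Iff.rfl

lemma self_mem_conj (x : Ω) : x ∈ Φ.conj x := Φ.mem_conj.2 ⟨1, rfl⟩

section Torsion

variable [Algebra F Ω] [IsScalarTower F (RatFunc F) Ω]

lemma apply_action (γ : Ω ≃ₐ[Φ.coeffField] Ω) (a : F[X]) (y : Ω) :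
    γ (Φ.action a y) = Φ.action a (γ y) :=
  Φ.algEquiv_action (Φ.algEquiv_coeff γ) a y

lemma exists_pow_apply_eq (γ : Ω ≃ₐ[Φ.coeffField] Ω) (x : Ω) : ∃ n > 0, (γ ^ n) x = x := by
  obtain ⟨i, -, j, -, hij, h⟩ := Set.infinite_univ.exists_lt_map_eq_of_mapsTo
    (f := fun n : ℕ => (γ ^ n) x) (t := MulAction.orbit (Ω ≃ₐ[Φ.coeffField] Ω) x) (fun n _ => ⟨γ ^ n, rfl⟩) (Φ.finite_orbit x)
  refine ⟨j - i, by omega, (γ ^ i).injective ?_⟩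
  have : (γ ^ i) ((γ ^ (j - i)) x) = (γ ^ (i + (j - i))) x := by
    rw [pow_add]
    rfl
  rw [this, Nat.add_sub_cancel' hij.le]
  exact h.symm

/-- If `Φ(a)(x)` and `Φ(b)(x)` are conjugate, with `x` not torsion, then `a ^ n = b ^ n`. -/
lemma exists_pow_eq_pow {x : Ω} (hx : ¬ Φ.IsTorsion x) {a b : F[X]}
    {γ : Ω ≃ₐ[Φ.coeffField] Ω} (h : Φ.action a (γ x) = Φ.action b x) :
    ∃ n > 0, a ^ n = b ^ n := by
  obtain ⟨n, hn, hγ⟩ := Φ.exists_pow_apply_eq γ x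
  -- Iterate the relation `Φ(a)(γ x) = Φ(b)(x)` along the powers of `γ`, one of which fixes `x`.
  have key : ∀ m : ℕ, Φ.action (a ^ m) ((γ ^ m) x) = Φ.action (b ^ m) x := by
    intro m
    induction m with
    | zero => simp
    | succ m ih =>
      have h1 : (γ ^ (m + 1)) x = γ ((γ ^ m) x) := by
        rw [pow_succ']
        rfl
      rw [h1, pow_succ', action_mul_apply, ← Φ.apply_action γ (a ^ m), ih, Φ.apply_action,
        action_comm, h, ← action_mul_apply, ← pow_succ]
  refine ⟨n, hn, ?_⟩
  by_contra hne
  refine hx ⟨a ^ n - b ^ n, sub_ne_zero.2 hne, ?_⟩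
  have := key n
  rw [hγ] at this
  rw [map_sub, LinearMap.sub_apply, this, sub_self]

lemma action_ne_of_irreducible {x : Ω} (hx : ¬ Φ.IsTorsion x) {l : F[X]} (hl : Irreducible l)
    {z z' : Ω} (hz : z ∈ Φ.conj x) (hz' : z' ∈ Φ.conj x) : Φ.action l z ≠ z' := by
  obtain ⟨γ, rfl⟩ := Φ.mem_conj.1 hz
  obtain ⟨γ', rfl⟩ := Φ.mem_conj.1 hz'
  intro h
  have h1 : Φ.action l ((γ'⁻¹ * γ) x) = Φ.action 1 x := by
    have := congrArg γ'.symm h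
    rw [Φ.apply_action, AlgEquiv.symm_apply_apply] at this
    rw [map_one, Module.End.one_apply]
    exact this
  obtain ⟨n, hn, h2⟩ := Φ.exists_pow_eq_pow hx h1
  rw [one_pow] at h2
  exact hl.not_isUnit ((isUnit_pow_iff hn.ne').1 (h2 ▸ isUnit_one))

lemma eq_of_action_eq {x : Ω} (hx : ¬ Φ.IsTorsion x) {l l' : F[X]} (hl : Irreducible l)
    (hl' : Irreducible l') (hm : l.Monic) (hm' : l'.Monic)
    {z z' : Ω} (hz : z ∈ Φ.conj x) (hz' : z' ∈ Φ.conj x) (h : Φ.action l z = Φ.action l' z') :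
    l = l' := by
  obtain ⟨γ, rfl⟩ := Φ.mem_conj.1 hz
  obtain ⟨γ', rfl⟩ := Φ.mem_conj.1 hz'
  have h1 : Φ.action l ((γ'⁻¹ * γ) x) = Φ.action l' x := by
    have := congrArg γ'.symm h
    rw [Φ.apply_action, Φ.apply_action, AlgEquiv.symm_apply_apply] at this
    exact this
  obtain ⟨n, hn, h2⟩ := Φ.exists_pow_eq_pow hx h1
  have h3 : l ∣ l' := hl.prime.dvd_of_dvd_pow (h2 ▸ dvd_pow_self l hn.ne')
  exact Polynomial.eq_of_monic_of_associated hm hm' (hl.associated_of_dvd hl' h3)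

/-- The number of irreducible polynomials which are not injective on the conjugates of `x`. -/
lemma two_pow_card_le {x : Ω} (Λ : Finset F[X]) (hirr : ∀ l ∈ Λ, Irreducible l)
    (hmonic : ∀ l ∈ Λ, l.Monic)
    (hdrop : ∀ l ∈ Λ, ¬ Set.InjOn (Φ.action l) (Φ.conj x)) : 2 ^ Λ.card ≤ (Φ.conj x).card := by
  classical
  have hcop : ∀ l ∈ Λ, IsCoprime l (∏ j ∈ Λ.erase l, j) := fun l hl =>
    IsCoprime.prod_right fun j hj => by
      have hj' := Finset.mem_of_mem_erase hj
      refine ((hirr l hl).coprime_iff_not_dvd).2 fun h => Finset.ne_of_mem_erase hj ?_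
      exact (Polynomial.eq_of_monic_of_associated (hmonic l hl) (hmonic j hj')
        ((hirr l hl).associated_of_dvd (hirr j hj') h)).symm
  -- Failure of injectivity yields an automorphism moving `x` by a nonzero `l`-torsion point.
  have hγ : ∀ l ∈ Λ, ∃ γ : Ω ≃ₐ[Φ.coeffField] Ω, γ x - x ≠ 0 ∧ Φ.action l (γ x - x) = 0 := by
    intro l hl
    have h := hdrop l hl
    simp only [Set.InjOn] at h
    push Not at h
    obtain ⟨z, hz, z', hz', h1, h2⟩ := h
    obtain ⟨γ, rfl⟩ := Φ.mem_conj.1 hz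
    obtain ⟨γ', rfl⟩ := Φ.mem_conj.1 hz'
    refine ⟨γ⁻¹ * γ', fun h => h2 ?_, ?_⟩
    · have h3 : γ.symm (γ' x) = x := sub_eq_zero.1 h
      rw [← h3, AlgEquiv.apply_symm_apply, h3]
    · have := congrArg γ.symm h1
      rw [Φ.apply_action, Φ.apply_action, AlgEquiv.symm_apply_apply] at this
      rw [map_sub, this]
      exact sub_self _
  -- Composing the automorphisms for `l ∈ I` gives a conjugate whose displacement from `x` has a
  -- nonzero `j`-component exactly for `j ∈ I`. Multiplication by the other primes isolates that
  -- component, so different `I` give different conjugates.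
  have key : ∀ I ⊆ Λ, ∃ z ∈ Φ.conj x, ∀ j ∈ Λ,
      (Φ.action (∏ i ∈ Λ.erase j, i) (z - x) ≠ 0 ↔ j ∈ I) := by
    intro I
    induction I using Finset.induction_on with
    | empty => exact fun _ => ⟨x, Φ.self_mem_conj x, fun j _ => by simp⟩
    | insert l I hlI ih =>
      intro hI
      obtain ⟨z, hz, hzI⟩ := ih ((Finset.subset_insert _ _).trans hI)
      have hl : l ∈ Λ := hI (Finset.mem_insert_self _ _)
      obtain ⟨γ, hγ0, hγl⟩ := hγ l hl
      obtain ⟨γ', rfl⟩ := Φ.mem_conj.1 hz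
      refine ⟨γ (γ' x), Φ.mem_conj.2 ⟨γ * γ', rfl⟩, fun j hj => ?_⟩
      have e : γ (γ' x) - x = γ (γ' x - x) + (γ x - x) := by
        rw [map_sub]
        ring
      rw [e, map_add, ← Φ.apply_action]
      rcases eq_or_ne j l with rfl | hjl
      · have h1 : Φ.action (∏ i ∈ Λ.erase j, i) (γ' x - x) = 0 := by
          by_contra h
          exact hlI ((hzI j hj).1 h)
        rw [h1, map_zero, zero_add]
        refine iff_of_true (fun h => hγ0 ?_) (Finset.mem_insert_self _ _)
        obtain ⟨u, v, huv⟩ := hcop j hj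
        have := congrArg (fun a => Φ.action a (γ x - x)) huv
        simp only [map_add, LinearMap.add_apply, action_mul_apply, hγl, h, map_zero, map_one,
          Module.End.one_apply, add_zero] at this
        exact this.symm
      · have h1 : Φ.action (∏ i ∈ Λ.erase j, i) (γ x - x) = 0 := by
          obtain ⟨b, hb⟩ := Finset.dvd_prod_of_mem (fun i : F[X] => i)
            (Finset.mem_erase.2 ⟨hjl.symm, hl⟩)
          rw [hb, mul_comm, action_mul_apply, hγl, map_zero]
        rw [h1, add_zero, Finset.mem_insert, or_iff_right hjl, ← hzI j hj, ne_eq, ne_eq,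
          EmbeddingLike.map_eq_zero_iff]
  rw [← Finset.card_powerset]
  choose! f hf hfI using key
  refine Finset.card_le_card_of_injOn f (fun I hI => hf I (Finset.mem_powerset.1 hI)) ?_
  intro I hI I' hI' h
  have hI := Finset.mem_powerset.1 hI
  have hI' := Finset.mem_powerset.1 hI'
  ext j
  by_cases hj : j ∈ Λ
  · rw [← hfI I hI j hj, ← hfI I' hI' j hj, h]
  · exact iff_of_false (fun h => hj (hI h)) (fun h => hj (hI' h))

end Torsion

open IntermediateField in
-- Distinct conjugates over `k(Φ)` give distinct embeddings of `k(x)` over `k`, so `δ` is at most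
-- the separable degree.
lemma card_conj_mul_insepDegree_le [IsAlgClosed Ω] (x : Ω) :
    (Φ.conj x).card * insepDegree F x ≤ degree F x := by
  classical
  have : FiniteDimensional (RatFunc F) (RatFunc F)⟮x⟯ :=
    adjoin.finiteDimensional (Algebra.IsIntegral.isIntegral x)
  unfold insepDegree degree
  rw [← Field.finSepDegree_mul_finInsepDegree (RatFunc F) (RatFunc F)⟮x⟯]
  refine Nat.mul_le_mul_right _ ?_
  rw [Field.finSepDegree_eq_of_isAlgClosed (RatFunc F) _ Ω, Nat.card_eq_fintype_card]
  choose! γ hγ using fun z (hz : z ∈ Φ.conj x) => Φ.mem_conj.1 hz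
  refine Finset.card_le_card_of_injOn
    (fun z => ((γ z).restrictScalars (RatFunc F)).toAlgHom.comp (RatFunc F)⟮x⟯.val)
    (fun _ _ => Finset.mem_coe.2 (Finset.mem_univ _)) ?_
  intro z hz z' hz' h
  have h1 := DFunLike.congr_fun h (AdjoinSimple.gen (RatFunc F) x)
  change γ z x = γ z' x at h1
  rwa [hγ z hz, hγ z' hz'] at h1

open IntermediateField in
-- This power is the norm of `x` to the separable closure of `k` in `k(x)`.
lemma isSeparable_pow_insepDegree (x : Ω) : IsSeparable (RatFunc F) (x ^ insepDegree F x) := by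
  have : FiniteDimensional (RatFunc F) (RatFunc F)⟮x⟯ :=
    adjoin.finiteDimensional (Algebra.IsIntegral.isIntegral x)
  set S := separableClosure (RatFunc F) (RatFunc F)⟮x⟯ with hS
  have h := algebraMap_norm_of_isPurelyInseparable (k := S) (AdjoinSimple.gen (RatFunc F) x)
  have h1 : IsSeparable (RatFunc F) ((Algebra.norm S (AdjoinSimple.gen (RatFunc F) x) : S) :
      (RatFunc F)⟮x⟯) := mem_separableClosure_iff.1 (SetLike.coe_mem _)
  have h2 : ((Algebra.norm S (AdjoinSimple.gen (RatFunc F) x) : S) : (RatFunc F)⟮x⟯) =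
      AdjoinSimple.gen (RatFunc F) x ^ insepDegree F x := h
  rw [h2] at h1
  have h3 := h1.map (f := (RatFunc F)⟮x⟯.val)
  rw [map_pow] at h3
  exact h3 (RatFunc F)⟮x⟯.val.injective

lemma exists_insepDegree_eq_pow (p : ℕ) [ExpChar (RatFunc F) p] (x : Ω) :
    ∃ n, insepDegree F x = p ^ n := by
  have : FiniteDimensional (RatFunc F) (IntermediateField.adjoin (RatFunc F) {x}) :=
    IntermediateField.adjoin.finiteDimensional (Algebra.IsIntegral.isIntegral x)
  exact finInsepDegree_eq_pow _ _ p

lemma insepDegree_pos (x : Ω) : 0 < insepDegree F x := by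
  obtain ⟨n, hn⟩ := exists_insepDegree_eq_pow (F := F) (ringExpChar (RatFunc F)) x
  rw [hn]
  exact pow_pos (expChar_pos (RatFunc F) _) n

/-- The product of the `(X - z) ^ P` over the conjugates `z` of `x` has coefficients in `k(Φ)`,
with `P` the inseparable degree of `x`. -/
theorem exists_map_eq_prod [IsAlgClosed Ω] (x : Ω) : ∃ f : Polynomial Φ.coeffField,
    f.map (algebraMap Φ.coeffField Ω) =
      ∏ z ∈ Φ.conj x, (Polynomial.X - Polynomial.C z) ^ insepDegree F x := by
  classical
  set P := insepDegree F x with hP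
  obtain ⟨p, hp⟩ := CharP.exists F
  have hpp : Fact p.Prime := ⟨CharP.char_is_prime F p⟩
  have : CharP (RatFunc F) p := charP_of_injective_algebraMap (algebraMap F (RatFunc F)).injective p
  have : CharP Ω p := charP_of_injective_algebraMap (algebraMap (RatFunc F) Ω).injective p
  obtain ⟨n, hn⟩ : ∃ n, P = p ^ n := exists_insepDegree_eq_pow p x
  have hInt : IsIntegral Φ.coeffField (x ^ P) :=
    (Algebra.IsIntegral.isIntegral (R := RatFunc F) (x ^ P)).tower_top
  have hsep : (minpoly Φ.coeffField (x ^ P)).Separable :=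
    (isSeparable_pow_insepDegree (F := F) x).tower_top Φ.coeffField
  have hnorm : Normal Φ.coeffField Ω := Normal.tower_top_of_normal (RatFunc F) Φ.coeffField Ω
  set g := minpoly Φ.coeffField (x ^ P) with hg
  -- The roots are the `z ^ P`, pairwise distinct because `x ^ P` is separable. Substituting `X ^ P`
  -- for `X` turns `X - z ^ P` into `(X - z) ^ P`.
  have hroots : (g.map (algebraMap Φ.coeffField Ω)).roots =
      ((Φ.conj x).image fun z => z ^ P).val := by
    refine Multiset.Nodup.ext (Polynomial.nodup_roots (hsep.map)) (Finset.nodup _) |>.2 fun y => ?_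
    rw [Polynomial.mem_roots (Polynomial.map_ne_zero (minpoly.ne_zero hInt)), Polynomial.IsRoot,
      Polynomial.eval_map_algebraMap, Finset.mem_val, Finset.mem_image]
    constructor
    · intro hy
      obtain ⟨γ, hγ⟩ := minpoly.exists_algEquiv_of_root'
        (Algebra.IsAlgebraic.isAlgebraic (R := Φ.coeffField) (x ^ P)) hy
      exact ⟨γ x, Φ.mem_conj.2 ⟨γ, rfl⟩, by rw [← map_pow, hγ]⟩
    · rintro ⟨z, hz, rfl⟩
      obtain ⟨γ, rfl⟩ := Φ.mem_conj.1 hz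
      rw [← map_pow, Polynomial.aeval_algHom_apply, minpoly.aeval, map_zero]
  have hprod : g.map (algebraMap Φ.coeffField Ω) =
      ∏ z ∈ Φ.conj x, (Polynomial.X - Polynomial.C (z ^ P)) := by
    rw [(IsAlgClosed.splits (g.map (algebraMap Φ.coeffField Ω))).eq_prod_roots_of_monic
      ((minpoly.monic hInt).map _), hroots]
    change ∏ y ∈ (Φ.conj x).image fun z => z ^ P, (Polynomial.X - Polynomial.C y) = _
    rw [Finset.prod_image]
    intro z _ z' _ h
    rw [hn] at h
    exact iterateFrobenius_inj Ω p n h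
  refine ⟨Polynomial.expand Φ.coeffField P g, ?_⟩
  rw [Polynomial.map_expand, hprod, map_prod]
  refine Finset.prod_congr rfl fun z _ => ?_
  rw [map_sub, Polynomial.expand_X, Polynomial.expand_C, hn, map_pow, sub_pow_char_pow]

end DrinfeldModule

/-! ### Coefficients of products -/

section Coefficients

variable {Ω : Type*} [Field Ω] (w : Valuation Ω ℝ≥0)

lemma val_coeff_mul_le {f g : Polynomial Ω} {A B : ℝ≥0} (hf : ∀ i, w (f.coeff i) ≤ A)
    (hg : ∀ i, w (g.coeff i) ≤ B) (n : ℕ) : w ((f * g).coeff n) ≤ A * B := by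
  rw [Polynomial.coeff_mul]
  refine Valuation.map_sum_le w fun i _ => ?_
  rw [map_mul]
  exact mul_le_mul' (hf _) (hg _)

lemma val_coeff_prod_le {ι : Type*} (s : Finset ι) (f : ι → Polynomial Ω) (A : ι → ℝ≥0)
    (hf : ∀ i ∈ s, ∀ n, w ((f i).coeff n) ≤ A i) (n : ℕ) :
    w ((∏ i ∈ s, f i).coeff n) ≤ ∏ i ∈ s, A i := by
  classical
  induction s using Finset.induction_on generalizing n with
  | empty =>
    rw [Finset.prod_empty, Finset.prod_empty, Polynomial.coeff_one]
    split_ifs <;> simp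
  | insert a s ha ih =>
    rw [Finset.prod_insert ha, Finset.prod_insert ha]
    exact val_coeff_mul_le w (hf a (Finset.mem_insert_self _ _))
      (ih fun i hi => hf i (Finset.mem_insert_of_mem hi)) n

lemma val_coeff_X_sub_C_le (z : Ω) (n : ℕ) :
    w ((Polynomial.X - Polynomial.C z).coeff n) ≤ max 1 (w z) := by
  rw [Polynomial.coeff_sub, Polynomial.coeff_X, Polynomial.coeff_C]
  refine (Valuation.map_sub _ _ _).trans (max_le_max ?_ ?_) <;> split_ifs <;> simp

lemma val_coeff_X_sub_C_pow_le (z : Ω) (P n : ℕ) :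
    w (((Polynomial.X - Polynomial.C z) ^ P).coeff n) ≤ max 1 (w z) ^ P := by
  have := val_coeff_prod_le w (Finset.range P) (fun _ => Polynomial.X - Polynomial.C z)
    (fun _ => max 1 (w z)) (fun _ _ => val_coeff_X_sub_C_le w z) n
  simpa using this

end Coefficients

lemma logb_val_sub_le {Ω : Type*} [Field Ω] (w : Valuation Ω ℝ≥0) {q : ℕ} (hq : 1 < q) {y z : Ω}
    (h : y ≠ z) : Real.logb q (w (y - z)) ≤ logp q (w y) + logp q (w z) := by
  have h0 : w (y - z) ≠ 0 := (Valuation.ne_zero_iff _).2 (sub_ne_zero.2 h)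
  have h1 : ∀ t : ℝ≥0, ((max 1 t : ℝ≥0) : ℝ) ≠ 0 := fun t => by
    exact_mod_cast (lt_of_lt_of_le one_pos (le_max_left 1 t)).ne'
  rw [logp_eq_logb_max hq, logp_eq_logb_max hq, ← Real.logb_mul (h1 _) (h1 _), ← NNReal.coe_mul]
  refine logb_le_logb_coe hq h0 ((Valuation.map_sub _ _ _).trans (max_le ?_ ?_))
  · exact (le_max_right 1 _).trans (le_mul_of_one_le_right zero_le (le_max_left _ _))
  · exact (le_max_right 1 _).trans (le_mul_of_one_le_left zero_le (le_max_left _ _))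

/-! ### The configuration of points and its local inequalities -/

namespace DrinfeldModule

variable {F : Type*} [Field F] [Fintype F] {Ω : Type*} [Field Ω] [Algebra (RatFunc F) Ω]
  [Algebra.IsAlgebraic (RatFunc F) Ω] [IsAlgClosed Ω] [Algebra F Ω] [IsScalarTower F (RatFunc F) Ω]
  {d : ℕ} {Φ : DrinfeldModule F Ω d}

lemma IsRVPrime.irreducible {l : F[X]} (h : Φ.IsRVPrime l) : Irreducible l := h.2.1

/-- The `l`-adic gain for the differences `Φ(l)(z) - z'`, with `z, z'` conjugates of `x`. -/
lemma IsRVPrime.le_sum {l : F[X]} (h : Φ.IsRVPrime l) {hl : Irreducible l}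
    {w : Valuation Ω ℝ≥0} (hw : ∀ x, w (algebraMap (RatFunc F) Ω x) = finitePlace l hl x)
    {x z : Ω} (hx : ¬ Φ.IsTorsion x) (hz : z ∈ Φ.conj x) :
    (l.natDegree / Φ.coeffDegree : ℝ) ≤ ∑ z' ∈ Φ.conj x, (insepDegree F x : ℝ) *
      (logp (Fintype.card F) (w (Φ.action l z)) + logp (Fintype.card F) (w z') -
        Real.logb (Fintype.card F) (w (Φ.action l z - z'))) := by
  have hq : 1 < Fintype.card F := Fintype.one_lt_card
  obtain ⟨-, -, g, hg0, hglog, hg⟩ := h.exists_gain hw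
  obtain ⟨f, hf⟩ := Φ.exists_map_eq_prod x
  set P := insepDegree F x with hP
  have hP0 : P ≠ 0 := (insepDegree_pos x).ne'
  set y := Φ.action l z with hy
  have haeval : ∀ t : Ω, Polynomial.aeval t f = ∏ z' ∈ Φ.conj x, (t - z') ^ P := by
    intro t
    rw [← Polynomial.eval_map_algebraMap, hf, Polynomial.eval_prod]
    simp
  have hdeg : f.natDegree ≤ (Φ.conj x).card * P := by
    rw [← Polynomial.natDegree_map (algebraMap Φ.coeffField Ω), hf]
    refine (Polynomial.natDegree_prod_le _ _).trans ?_
    rw [← smul_eq_mul]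
    refine Finset.sum_le_card_nsmul _ _ _ fun z' _ => ?_
    rw [Polynomial.natDegree_pow, Polynomial.natDegree_X_sub_C, mul_one]
  have h1 := hg f _ (∏ z' ∈ Φ.conj x, max 1 (w z') ^ P) z hdeg (fun i => by
    have := val_coeff_prod_le w (Φ.conj x) (fun z' => (Polynomial.X - Polynomial.C z') ^ P)
      (fun z' => max 1 (w z') ^ P) (fun z' _ n => val_coeff_X_sub_C_pow_le w z' P n) i
    rw [← hf, Polynomial.coeff_map] at this
    exact this) (by rw [haeval]; exact Finset.prod_eq_zero hz (by rw [sub_self, zero_pow hP0]))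
  rw [haeval] at h1
  have hne : ∀ z' ∈ Φ.conj x, y - z' ≠ 0 := fun z' hz' =>
    sub_ne_zero.2 (Φ.action_ne_of_irreducible hx hl hz hz')
  have hm : ∀ t : ℝ≥0, (max 1 t : ℝ≥0) ≠ 0 := fun t => (lt_of_lt_of_le one_pos (le_max_left 1 t)).ne'
  have h2 := logb_le_logb_coe hq ((Valuation.ne_zero_iff _).2
    (Finset.prod_ne_zero_iff.2 fun z' hz' => pow_ne_zero _ (hne z' hz'))) h1
  have hprod : ∏ z' ∈ Φ.conj x, max 1 (w z') ^ P ≠ 0 :=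
    Finset.prod_ne_zero_iff.2 fun z' _ => pow_ne_zero _ (hm _)
  rw [NNReal.coe_mul, Real.logb_mul (by exact_mod_cast mul_ne_zero hg0 hprod)
    (by exact_mod_cast pow_ne_zero _ (hm _)), NNReal.coe_mul,
    Real.logb_mul (by exact_mod_cast hg0) (by exact_mod_cast hprod), map_prod, NNReal.coe_prod,
    NNReal.coe_prod, Real.logb_prod, Real.logb_prod, NNReal.coe_pow, Real.logb_pow] at h2
  · simp only [map_pow, NNReal.coe_pow, Real.logb_pow] at h2
    simp only [← logp_eq_logb_max hq] at h2
    rw [← Finset.mul_sum, ← Finset.mul_sum] at h2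
    rw [← Finset.mul_sum, Finset.sum_sub_distrib, Finset.sum_add_distrib, Finset.sum_const,
      nsmul_eq_mul]
    push_cast at h2
    nlinarith
  · intro z' hz'
    exact_mod_cast pow_ne_zero _ (hm _)
  · intro z' hz'
    exact_mod_cast (Valuation.ne_zero_iff _).2 (pow_ne_zero _ (hne z' hz'))

variable (Φ) in
/-- The points of the configuration: the conjugates of `x`, repeated `m` times, and their images
under `Φ(l)` for `l ∈ Λ`. -/
def point (x : Ω) (Λ : Finset F[X]) (m : ℕ) : (Fin m ⊕ Λ) × Φ.conj x → Ω
  | (Sum.inl _, z) => z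
  | (Sum.inr l, z) => Φ.action l.1 z

variable (Φ) in
/-- The difference of two points, or `1` if it vanishes. -/
def diff (x : Ω) (Λ : Finset F[X]) (m : ℕ) (i j : (Fin m ⊕ Λ) × Φ.conj x) : Ω :=
  open scoped Classical in
  if Φ.point x Λ m i = Φ.point x Λ m j then 1 else Φ.point x Λ m i - Φ.point x Λ m j

section Configuration

variable {x : Ω} {Λ : Finset F[X]} {m : ℕ}

lemma diff_ne_zero (i j : (Fin m ⊕ Λ) × Φ.conj x) : Φ.diff x Λ m i j ≠ 0 := by
  unfold diff
  split_ifs with h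
  · exact one_ne_zero
  · exact sub_ne_zero.2 h

lemma diff_of_ne {i j : (Fin m ⊕ Λ) × Φ.conj x} (h : Φ.point x Λ m i ≠ Φ.point x Λ m j) :
    Φ.diff x Λ m i j = Φ.point x Λ m i - Φ.point x Λ m j := if_neg h

lemma logb_val_diff_le (w : Valuation Ω ℝ≥0) (i j : (Fin m ⊕ Λ) × Φ.conj x) :
    Real.logb (Fintype.card F) (w (Φ.diff x Λ m i j)) ≤
      logp (Fintype.card F) (w (Φ.point x Λ m i)) +
        logp (Fintype.card F) (w (Φ.point x Λ m j)) := by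
  unfold diff
  split_ifs with h
  · rw [map_one, NNReal.coe_one, Real.logb_one]
    exact add_nonneg (logp_nonneg _ _) (logp_nonneg _ _)
  · exact logb_val_sub_le w Fintype.one_lt_card h

lemma logb_val_diff_swap (w : Valuation Ω ℝ≥0) (i j : (Fin m ⊕ Λ) × Φ.conj x) :
    Real.logb (Fintype.card F) (w (Φ.diff x Λ m i j)) =
      Real.logb (Fintype.card F) (w (Φ.diff x Λ m j i)) := by
  unfold diff
  by_cases h : Φ.point x Λ m i = Φ.point x Λ m j
  · rw [if_pos h, if_pos h.symm]
  · rw [if_neg h, if_neg (Ne.symm h), Valuation.map_sub_swap]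

open scoped Classical in
/-- The number of coincidences between the points. -/
lemma sum_card_point_eq_le (hx : ¬ Φ.IsTorsion x) (hirr : ∀ l ∈ Λ, Irreducible l)
    (hmonic : ∀ l ∈ Λ, l.Monic) (hinj : ∀ l ∈ Λ, Set.InjOn (Φ.action l) (Φ.conj x)) :
    ∑ i, (({i}ᶜ : Finset ((Fin m ⊕ Λ) × Φ.conj x)).filter
      fun j => Φ.point x Λ m i = Φ.point x Λ m j).card ≤ (Φ.conj x).card * m ^ 2 := by
  rw [Fintype.sum_prod_type, Fintype.sum_sum_type]
  have h2 : ∀ l : Λ, ∀ z : Φ.conj x, (({(Sum.inr l, z)}ᶜ : Finset ((Fin m ⊕ Λ) × Φ.conj x)).filter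
      fun j => Φ.point x Λ m (Sum.inr l, z) = Φ.point x Λ m j).card = 0 := by
    intro l z
    rw [Finset.card_eq_zero, Finset.filter_eq_empty_iff]
    rintro ⟨a | l', z'⟩ hj h
    · exact Φ.action_ne_of_irreducible hx (hirr l l.2) z.2 z'.2 h
    · have hll : l = l' := Subtype.ext (Φ.eq_of_action_eq hx (hirr l l.2) (hirr l' l'.2)
        (hmonic l l.2) (hmonic l' l'.2) z.2 z'.2 h)
      subst hll
      have hzz : z = z' := Subtype.ext (hinj l l.2 z.2 z'.2 h)
      subst hzz
      simp at hj
  have h1 : ∀ a : Fin m, ∀ z : Φ.conj x, (({(Sum.inl a, z)}ᶜ : Finset ((Fin m ⊕ Λ) × Φ.conj x)).filter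
      fun j => Φ.point x Λ m (Sum.inl a, z) = Φ.point x Λ m j).card ≤ m := by
    intro a z
    have hsub : (({(Sum.inl a, z)}ᶜ : Finset ((Fin m ⊕ Λ) × Φ.conj x)).filter
        fun j => Φ.point x Λ m (Sum.inl a, z) = Φ.point x Λ m j) ⊆
        (Finset.univ : Finset (Fin m)).image fun b => (Sum.inl b, z) := by
      rintro ⟨b | l', z'⟩ hj
      · have hzz : z = z' := Subtype.ext (Finset.mem_filter.1 hj).2
        subst hzz
        exact Finset.mem_image_of_mem _ (Finset.mem_univ b)
      · exact absurd (Finset.mem_filter.1 hj).2.symm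
          (Φ.action_ne_of_irreducible hx (hirr l' l'.2) z'.2 z.2)
    refine (Finset.card_le_card hsub).trans (Finset.card_image_le.trans ?_)
    simp
  simp only [h2, Finset.sum_const_zero, add_zero]
  refine (Finset.sum_le_sum fun a _ => Finset.sum_le_sum fun z _ => h1 a z).trans ?_
  simp only [Finset.sum_const, Finset.card_univ, Fintype.card_fin, smul_eq_mul, Fintype.card_coe]
  exact le_of_eq (by ring)

lemma sizeBound_ne_zero (w : Valuation Ω ℝ≥0) (J : ℕ) (y : Ω) : Φ.sizeBound w J y ≠ 0 :=
  Finset.prod_ne_zero_iff.2 fun _ _ => pow_ne_zero _ (lt_of_lt_of_le one_pos (le_max_left _ _)).ne'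

lemma logb_sizeBound (w : Valuation Ω ℝ≥0) (J : ℕ) (y : Ω) :
    Real.logb (Fintype.card F) (Φ.sizeBound w J y) = ∑ k ∈ Finset.range (J + 1),
      ((Fintype.card F ^ d - 1 : ℕ) : ℝ) *
        logp (Fintype.card F) (w (Φ.action (Polynomial.X ^ k) y)) := by
  have hq : 1 < Fintype.card F := Fintype.one_lt_card
  rw [sizeBound, NNReal.coe_prod, Real.logb_prod]
  · simp only [NNReal.coe_pow, Real.logb_pow, logp_eq_logb_max hq]
  · intro k _
    have h : (max 1 (w (Φ.action (Polynomial.X ^ k) y)) : ℝ≥0) ≠ 0 :=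
      (lt_of_lt_of_le one_pos (le_max_left _ _)).ne'
    exact_mod_cast pow_ne_zero _ h

lemma neg_logb_radius (w : Valuation Ω ℝ≥0) (J : ℕ) :
    -Real.logb (Fintype.card F) (Φ.radius w J) =
      J * logp (Fintype.card F) (w (Φ.coeff 0)) + Real.logb (Fintype.card F) (Φ.bound w) := by
  have hq : 1 < Fintype.card F := Fintype.one_lt_card
  have h1 : ((max 1 (w (Φ.coeff 0)) : ℝ≥0) : ℝ) ≠ 0 := by
    exact_mod_cast (lt_of_lt_of_le one_pos (le_max_left 1 _)).ne'
  have h2 : (Φ.bound w : ℝ) ≠ 0 := by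
    exact_mod_cast (lt_of_lt_of_le one_pos (Φ.one_le_bound w)).ne'
  rw [radius, NNReal.coe_mul, NNReal.coe_pow, NNReal.coe_inv, NNReal.coe_inv,
    Real.logb_mul (pow_ne_zero _ (inv_ne_zero h1)) (inv_ne_zero h2), Real.logb_pow, Real.logb_inv,
    Real.logb_inv, logp_eq_logb_max hq]
  ring

/-- The local inequality for the configuration, at an arbitrary valuation. -/
lemma sum_logb_diff_le (hx : ¬ Φ.IsTorsion x) (hirr : ∀ l ∈ Λ, Irreducible l)
    (hmonic : ∀ l ∈ Λ, l.Monic) (hinj : ∀ l ∈ Λ, Set.InjOn (Φ.action l) (Φ.conj x))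
    (w : Valuation Ω ℝ≥0) (J : ℕ)
    (hJ : Fintype.card ((Fin m ⊕ Λ) × Φ.conj x) ≤ (Fintype.card F ^ d) ^ (J + 1)) :
    ∑ i, ∑ j, Real.logb (Fintype.card F) (w (Φ.diff x Λ m i j)) +
      2 * ∑ n ∈ Finset.range (Fintype.card ((Fin m ⊕ Λ) × Φ.conj x)),
        Real.logb (Fintype.card F) (w (Φ.polyDigits J n).leadingCoeff) ≤
    2 * ∑ i, Real.logb (Fintype.card F) (Φ.sizeBound w J (Φ.point x Λ m i)) +
      (Φ.conj x).card * m ^ 2 * (J * logp (Fintype.card F) (w (Φ.coeff 0)) +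
        Real.logb (Fintype.card F) (Φ.bound w)) := by
  classical
  have hq : 1 < Fintype.card F := Fintype.one_lt_card
  have h := Φ.prod_max_radius_le w (Φ.point x Λ m) J hJ
  set ρ := Φ.radius w J with hρ
  have hρ0 : ρ ≠ 0 := Φ.radius_ne_zero w J
  have hmax0 : ∀ t : ℝ≥0, ((max ρ t : ℝ≥0) : ℝ) ≠ 0 := fun t => by
    exact_mod_cast (lt_of_lt_of_le (pos_iff_ne_zero.2 hρ0) (le_max_left ρ t)).ne'
  have hlc : ∀ n, w (Φ.polyDigits J n).leadingCoeff ≠ 0 := fun n =>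
    (Valuation.ne_zero_iff _).2 (Polynomial.leadingCoeff_ne_zero.2 (Φ.polyDigits_ne_zero J n))
  have hA : ∏ i, ∏ j ∈ {i}ᶜ, max ρ (w (Φ.point x Λ m i - Φ.point x Λ m j)) ≠ 0 :=
    Finset.prod_ne_zero_iff.2 fun i _ => Finset.prod_ne_zero_iff.2 fun j _ => by
      exact_mod_cast hmax0 _
  have hB : ∏ n ∈ Finset.range (Fintype.card ((Fin m ⊕ Λ) × Φ.conj x)),
      w (Φ.polyDigits J n).leadingCoeff ≠ 0 := Finset.prod_ne_zero_iff.2 fun n _ => hlc n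
  have h1 := logb_le_logb_coe hq (mul_ne_zero hA (pow_ne_zero 2 hB)) h
  rw [NNReal.coe_mul, Real.logb_mul (by exact_mod_cast hA) (by exact_mod_cast pow_ne_zero 2 hB),
    NNReal.coe_pow, NNReal.coe_pow, Real.logb_pow, Real.logb_pow, NNReal.coe_prod, NNReal.coe_prod,
    NNReal.coe_prod, Real.logb_prod _ _ (fun i _ => by
      rw [NNReal.coe_prod]
      exact Finset.prod_ne_zero_iff.2 fun j _ => hmax0 _),
    Real.logb_prod _ _ (fun n _ => by exact_mod_cast hlc n),
    Real.logb_prod _ _ (fun i _ => by exact_mod_cast sizeBound_ne_zero w J _)] at h1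
  simp only [NNReal.coe_prod] at h1
  rw [Finset.sum_congr rfl fun i _ => Real.logb_prod _ _ fun j _ => hmax0 _] at h1
  -- Where two points with different indices coincide, `max(ρ, 0) = ρ` appears in the local
  -- inequality while `diff` contributes `log 1 = 0`; the discrepancy is `-log ρ` per coincidence.
  have hpair : ∀ i, ∑ j, Real.logb (Fintype.card F) (w (Φ.diff x Λ m i j)) ≤
      ∑ j ∈ {i}ᶜ, Real.logb (Fintype.card F)
        (max ρ (w (Φ.point x Λ m i - Φ.point x Λ m j)) : ℝ≥0) +
      (({i}ᶜ : Finset ((Fin m ⊕ Λ) × Φ.conj x)).filter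
        fun j => Φ.point x Λ m i = Φ.point x Λ m j).card * (-Real.logb (Fintype.card F) ρ) := by
    intro i
    have hii : Real.logb (Fintype.card F) (w (Φ.diff x Λ m i i)) = 0 := by
      simp [diff]
    rw [← Finset.sum_compl_add_sum {i}, Finset.sum_singleton, hii, add_zero, Finset.card_filter]
    rw [Nat.cast_sum]
    simp only [Nat.cast_ite, Nat.cast_one, Nat.cast_zero]
    rw [Finset.sum_mul, ← Finset.sum_add_distrib]
    refine Finset.sum_le_sum fun j _ => ?_
    unfold diff
    split_ifs with hij
    · rw [hij, sub_self, map_zero, max_eq_left zero_le, map_one]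
      simp
    · rw [zero_mul, add_zero]
      exact logb_le_logb_coe hq ((Valuation.ne_zero_iff _).2 (sub_ne_zero.2 hij)) (le_max_right _ _)
  have hcount := sum_card_point_eq_le (m := m) hx hirr hmonic hinj
  have hρ1 : 0 ≤ -Real.logb (Fintype.card F) ρ := by
    have := Real.logb_nonpos (b := Fintype.card F) (by exact_mod_cast hq) ρ.2
      (by exact_mod_cast Φ.radius_le_one w J)
    exact neg_nonneg.2 this
  have h2 := Finset.sum_le_sum fun i (_ : i ∈ Finset.univ) => hpair i
  rw [Finset.sum_add_distrib, ← Finset.sum_mul] at h2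
  have hcount' : (∑ i, ((({i}ᶜ : Finset ((Fin m ⊕ Λ) × Φ.conj x)).filter
      fun j => Φ.point x Λ m i = Φ.point x Λ m j).card : ℝ)) ≤ (Φ.conj x).card * m ^ 2 := by
    exact_mod_cast hcount
  have h3 := mul_le_mul_of_nonneg_right hcount' hρ1
  rw [← neg_logb_radius, ← hρ]
  rw [Nat.cast_ofNat] at h1
  linarith

/-- The local inequality for the configuration, with the gain at the places above `l ∈ Λ`. -/
lemma sum_logb_diff_le_of_mem (hx : ¬ Φ.IsTorsion x) (hRV : ∀ l ∈ Λ, Φ.IsRVPrime l) {t : ℕ}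
    (hm : m = insepDegree F x * t) {l : F[X]} (hlΛ : l ∈ Λ) {hl : Irreducible l}
    {w : Valuation Ω ℝ≥0} (hw : ∀ x, w (algebraMap (RatFunc F) Ω x) = finitePlace l hl x) (J : ℕ)
    (hJ : Fintype.card ((Fin m ⊕ Λ) × Φ.conj x) < (Fintype.card F ^ d) ^ (J + 1)) :
    ∑ i, ∑ j, Real.logb (Fintype.card F) (w (Φ.diff x Λ m i j)) +
      2 * ∑ n ∈ Finset.range (Fintype.card ((Fin m ⊕ Λ) × Φ.conj x)),
        Real.logb (Fintype.card F) (w (Φ.polyDigits J n).leadingCoeff) ≤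
    2 * ∑ i, Real.logb (Fintype.card F) (Φ.sizeBound w J (Φ.point x Λ m i)) -
      2 * (t * (Φ.conj x).card * (l.natDegree / Φ.coeffDegree)) := by
  classical
  have hq : 1 < Fintype.card F := Fintype.one_lt_card
  obtain ⟨hInt, hlast, -⟩ := (hRV l hlΛ).exists_gain hw
  have hlc : ∑ n ∈ Finset.range (Fintype.card ((Fin m ⊕ Λ) × Φ.conj x)),
      Real.logb (Fintype.card F) (w (Φ.polyDigits J n).leadingCoeff) = 0 :=
    Finset.sum_eq_zero fun n _ => by rw [Φ.val_leadingCoeff_polyDigits hlast]; simp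
  rw [hlc, mul_zero, add_zero]
  set a : (Fin m ⊕ Λ) × Φ.conj x → ℝ := fun i => logp (Fintype.card F) (w (Φ.point x Λ m i)) with ha
  -- `D i j ≥ 0` is the defect of the ultrametric bound `|y - y'| ≤ max(1, |y|) max(1, |y'|)`. Good
  -- reduction makes the trivial bound affordable, so all defects are gains and coincidences cost
  -- nothing here.
  set D : (Fin m ⊕ Λ) × Φ.conj x → (Fin m ⊕ Λ) × Φ.conj x → ℝ := fun i j =>
    a i + a j - Real.logb (Fintype.card F) (w (Φ.diff x Λ m i j)) with hD
  have hD0 : ∀ i j, 0 ≤ D i j := fun i j => sub_nonneg.2 (logb_val_diff_le w i j)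
  have hDs : ∀ i j, D i j = D j i := fun i j => by
    simp only [hD]
    rw [logb_val_diff_swap, add_comm (a i)]
  -- The diagonal pairs are counted too, so each point enters `2 L` times. The exponent `q ^ (d (J +
  -- 1)) - 1` must be at least `L`, whence the strict inequality in `hJ`.
  have hsize : ∀ i, (Fintype.card ((Fin m ⊕ Λ) × Φ.conj x) : ℝ) * a i ≤
      Real.logb (Fintype.card F) (Φ.sizeBound w J (Φ.point x Λ m i)) := by
    intro i
    have h1 := logb_le_logb_coe hq (pow_ne_zero _ (lt_of_lt_of_le one_pos (le_max_left _ _)).ne')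
      (Φ.max_val_pow_le_sizeBound hInt hlast J (Φ.point x Λ m i))
    rw [NNReal.coe_pow, Real.logb_pow, ← logp_eq_logb_max hq] at h1
    refine le_trans (mul_le_mul_of_nonneg_right ?_ (logp_nonneg _ _)) h1
    exact_mod_cast Nat.le_sub_one_of_lt hJ
  -- The `m = P t` copies of each conjugate supply the multiplicity `P` needed for `f`, `t` times
  -- over.
  have hgain : ∀ z : Φ.conj x, (t : ℝ) * (l.natDegree / Φ.coeffDegree) ≤
      ∑ b : Fin m, ∑ z' : Φ.conj x, D (Sum.inr ⟨l, hlΛ⟩, z) (Sum.inl b, z') := by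
    intro z
    have h1 := (hRV l hlΛ).le_sum hw hx z.2
    rw [← Finset.sum_coe_sort] at h1
    have e : ∀ b : Fin m, ∑ z' : Φ.conj x, D (Sum.inr ⟨l, hlΛ⟩, z) (Sum.inl b, z') =
        ∑ z' : Φ.conj x, (logp (Fintype.card F) (w (Φ.action l z)) + logp (Fintype.card F) (w z') -
          Real.logb (Fintype.card F) (w (Φ.action l z - z'))) := by
      intro b
      refine Finset.sum_congr rfl fun z' _ => ?_
      simp only [hD]
      rw [diff_of_ne (i := (Sum.inr ⟨l, hlΛ⟩, z)) (j := (Sum.inl b, z'))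
        (Φ.action_ne_of_irreducible hx hl z.2 z'.2)]
      rfl
    simp only [e, Finset.sum_const, Finset.card_univ, Fintype.card_fin, nsmul_eq_mul]
    rw [← Finset.mul_sum] at h1
    have h2 := mul_le_mul_of_nonneg_left h1 (Nat.cast_nonneg (α := ℝ) t)
    rw [hm]
    push_cast
    nlinarith
  have hfirst : (t : ℝ) * (Φ.conj x).card * (l.natDegree / Φ.coeffDegree) ≤
      ∑ l' : Λ, ∑ z : Φ.conj x, ∑ b : Fin m, ∑ z' : Φ.conj x, D (Sum.inr l', z) (Sum.inl b, z') := by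
    refine le_trans ?_ (Finset.single_le_sum
      (f := fun l' : Λ => ∑ z : Φ.conj x, ∑ b : Fin m, ∑ z' : Φ.conj x,
        D (Sum.inr l', z) (Sum.inl b, z'))
      (fun l' _ => Finset.sum_nonneg fun z _ => Finset.sum_nonneg fun b _ =>
        Finset.sum_nonneg fun z' _ => hD0 _ _) (Finset.mem_univ (⟨l, hlΛ⟩ : Λ)))
    refine le_trans (le_of_eq ?_) (Finset.sum_le_sum fun z _ => hgain z)
    rw [Finset.sum_const, Finset.card_univ, Fintype.card_coe, nsmul_eq_mul]
    ring
  have hinr : ∑ l' : Λ, ∑ z : Φ.conj x, ∑ b : Fin m, ∑ z' : Φ.conj x,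
      D (Sum.inr l', z) (Sum.inl b, z') ≤ ∑ l' : Λ, ∑ z : Φ.conj x, ∑ j, D (Sum.inr l', z) j := by
    refine Finset.sum_le_sum fun l' _ => Finset.sum_le_sum fun z _ => ?_
    rw [Fintype.sum_prod_type, Fintype.sum_sum_type]
    exact le_add_of_nonneg_right (Finset.sum_nonneg fun _ _ => Finset.sum_nonneg fun _ _ => hD0 _ _)
  have hinl : ∑ l' : Λ, ∑ z : Φ.conj x, ∑ b : Fin m, ∑ z' : Φ.conj x,
      D (Sum.inr l', z) (Sum.inl b, z') ≤ ∑ b : Fin m, ∑ z' : Φ.conj x, ∑ j, D (Sum.inl b, z') j := by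
    have e : ∑ l' : Λ, ∑ z : Φ.conj x, ∑ b : Fin m, ∑ z' : Φ.conj x,
        D (Sum.inr l', z) (Sum.inl b, z') = ∑ b : Fin m, ∑ z' : Φ.conj x, ∑ l' : Λ,
          ∑ z : Φ.conj x, D (Sum.inl b, z') (Sum.inr l', z) := by
      calc _ = ∑ u : Λ × Φ.conj x, ∑ v : Fin m × Φ.conj x,
            D (Sum.inr u.1, u.2) (Sum.inl v.1, v.2) := by simp only [Fintype.sum_prod_type]
        _ = ∑ v : Fin m × Φ.conj x, ∑ u : Λ × Φ.conj x,
            D (Sum.inl v.1, v.2) (Sum.inr u.1, u.2) := by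
          rw [Finset.sum_comm]
          exact Finset.sum_congr rfl fun _ _ => Finset.sum_congr rfl fun _ _ => hDs _ _
        _ = _ := by simp only [Fintype.sum_prod_type]
    rw [e]
    refine Finset.sum_le_sum fun b _ => Finset.sum_le_sum fun z' _ => ?_
    rw [Fintype.sum_prod_type, Fintype.sum_sum_type]
    exact le_add_of_nonneg_left (Finset.sum_nonneg fun _ _ => Finset.sum_nonneg fun _ _ => hD0 _ _)
  -- The gain is counted for the pairs (image, conjugate) and again for the pairs (conjugate,
  -- image).
  have htotal : 2 * ((t : ℝ) * (Φ.conj x).card * (l.natDegree / Φ.coeffDegree)) ≤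
      ∑ i, ∑ j, D i j := by
    rw [Fintype.sum_prod_type, Fintype.sum_sum_type]
    linarith
  have hexp : ∑ i, ∑ j, D i j = 2 * ∑ i, (Fintype.card ((Fin m ⊕ Λ) × Φ.conj x) : ℝ) * a i -
      ∑ i, ∑ j, Real.logb (Fintype.card F) (w (Φ.diff x Λ m i j)) := by
    simp only [hD, Finset.sum_sub_distrib, Finset.sum_add_distrib, Finset.sum_const,
      Finset.card_univ, nsmul_eq_mul, ← Finset.mul_sum]
    ring
  have := Finset.sum_le_sum fun i (_ : i ∈ Finset.univ) => hsize i
  linarith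

end Configuration

end DrinfeldModule

namespace DrinfeldModule

/-! ### The global inequality -/

variable {F : Type*} [Field F] [Fintype F] {Ω : Type*} [Field Ω] [Algebra (RatFunc F) Ω]
  [Algebra.IsAlgebraic (RatFunc F) Ω] [IsAlgClosed Ω] [Algebra F Ω] [IsScalarTower F (RatFunc F) Ω]
  {d : ℕ} {Φ : DrinfeldModule F Ω d}

lemma logp_coeff_zero_le [DecidableEq (BasePlace F)] {M : IntermediateField (RatFunc F) Ω}
    (p : GPlace M) : logp (Fintype.card F) (p.val (Φ.coeff 0)) ≤
      if p.1 = BasePlace.infty F then 1 else 0 := by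
  have hq : 1 < Fintype.card F := Fintype.one_lt_card
  rw [Φ.coeff_zero, p.val_algebraMap]
  split_ifs with h
  · rw [h]
    change logp _ (inftyPlace F RatFunc.X) ≤ 1
    rw [inftyPlace_of_ne_zero RatFunc.X_ne_zero]
    refine max_le zero_le_one ?_
    have : (Fintype.card F : ℝ) ≠ 0 := by exact_mod_cast Fintype.card_ne_zero
    simp [Real.logb_self_eq_one (b := (Fintype.card F : ℝ)) (by exact_mod_cast hq)]
  · rcases p.1.2 with h' | ⟨l, hl, h'⟩
    · exact absurd (Subtype.ext h') h
    · rw [h', ← RatFunc.algebraMap_X]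
      exact (logp_of_le_one hq (finitePlace_polynomial_le_one l hl _)).le

/-- The height of `Φ(T ^ k)(y)` is at most `q ^ (d k) ĥ(y) + 4 h(Φ)`. With weights `q ^ d - 1` the
main terms telescope to less than `q ^ (d (J + 1)) ĥ(y)`, and each of the `J + 1` errors counts
fully. -/
lemma sum_avg_sizeBound_le {M : IntermediateField (RatFunc F) Ω} [FiniteDimensional (RatFunc F) M]
    (hM : ∀ i, Φ.coeff i ∈ M) {y : Ω} (hy : y ∈ M) (S : Finset (BasePlace F)) (J : ℕ) :
    avg S (fun p : GPlace M => Real.logb (Fintype.card F) (Φ.sizeBound p.val J y)) ≤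
      ((Fintype.card F : ℝ) ^ d) ^ (J + 1) * Φ.canonicalHeight y +
        4 * Φ.moduleHeight * (Fintype.card F : ℝ) ^ d * (J + 1) := by
  have hh := Φ.one_le_moduleHeight
  have hc := Φ.canonicalHeight_nonneg y
  simp only [logb_sizeBound]
  rw [avg_sum]
  simp only [avg_const_mul]
  set Q := (Fintype.card F : ℝ) ^ d with hQ
  have hQ1 : 1 ≤ Q := one_le_pow₀ (by exact_mod_cast Fintype.one_lt_card (α := F).le)
  have hcast : ((Fintype.card F ^ d - 1 : ℕ) : ℝ) = Q - 1 := by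
    rw [Nat.cast_sub (Nat.one_le_pow _ _ Fintype.card_pos)]
    push_cast
    rfl
  rw [hcast]
  have hgeom : (∑ k ∈ Finset.range (J + 1), Q ^ k) * (Q - 1) = Q ^ (J + 1) - 1 := geom_sum_mul Q _
  calc ∑ k ∈ Finset.range (J + 1), (Q - 1) *
        avg S (fun p : GPlace M => logp (Fintype.card F) (p.val (Φ.action (Polynomial.X ^ k) y)))
      ≤ ∑ k ∈ Finset.range (J + 1), (Q - 1) * (Q ^ k * Φ.canonicalHeight y + 4 * Φ.moduleHeight) := by
        refine Finset.sum_le_sum fun k _ => mul_le_mul_of_nonneg_left ?_ (by linarith)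
        refine (avg_le_weilHeight (Φ.action_mem hM _ hy) S).trans ?_
        have := Φ.weilHeight_action_X_pow_le y k
        rwa [pow_mul] at this
    _ = (∑ k ∈ Finset.range (J + 1), Q ^ k) * (Q - 1) * Φ.canonicalHeight y +
        4 * Φ.moduleHeight * (Q - 1) * (J + 1) := by
        rw [Finset.sum_mul, Finset.sum_mul, ← Finset.mul_sum, Finset.sum_add_distrib,
          Finset.sum_const, Finset.card_range, nsmul_eq_mul, mul_add, Finset.mul_sum]
        push_cast
        congr 1
        · exact Finset.sum_congr rfl fun k _ => by ring
        · ring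
    _ ≤ _ := by
        rw [hgeom]
        gcongr <;> linarith

/-- The global inequality obtained from the product formula. -/
theorem main_inequality {x : Ω} (hx : ¬ Φ.IsTorsion x) {Λ : Finset F[X]}
    (hRV : ∀ l ∈ Λ, Φ.IsRVPrime l) {N : ℕ} (hN : ∀ l ∈ Λ, l.natDegree = N)
    (hinj : ∀ l ∈ Λ, Set.InjOn (Φ.action l) (Φ.conj x)) {t m δ L J : ℕ}
    (hm : m = insepDegree F x * t) (hδ : δ = (Φ.conj x).card) (hL : L = (m + Λ.card) * δ)
    (hJL : (Fintype.card F ^ d) ^ J ≤ L) (hLJ : L < (Fintype.card F ^ d) ^ (J + 1)) :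
    2 * (t * N * Λ.card / Φ.coeffDegree : ℝ) ≤
      2 * (Fintype.card F : ℝ) ^ d * L * (m + 2 * Λ.card * (Fintype.card F : ℝ) ^ (d * N)) *
        Φ.canonicalHeight x +
      8 * Φ.moduleHeight * (Fintype.card F : ℝ) ^ d * (J + 1) * (m + Λ.card) +
      m ^ 2 * (Φ.moduleHeight + J) := by
  classical
  have hq : 1 < Fintype.card F := Fintype.one_lt_card
  have hh := Φ.one_le_moduleHeight
  have hch := Φ.canonicalHeight_nonneg x
  have hirr : ∀ l ∈ Λ, Irreducible l := fun l hl => (hRV l hl).irreducible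
  have hmonic : ∀ l ∈ Λ, l.Monic := fun l hl => (hRV l hl).1
  have hδ0 : 0 < δ := hδ ▸ Finset.card_pos.2 ⟨x, Φ.self_mem_conj x⟩
  obtain ⟨M, hM, hxM, _, _⟩ := Φ.exists_normal_coeff_mem {x} (Set.finite_singleton x)
  have hxM : x ∈ M := hxM rfl
  have hconjM : ∀ z ∈ Φ.conj x, z ∈ M := fun z hz => by
    obtain ⟨γ, rfl⟩ := Φ.mem_conj.1 hz
    exact apply_mem_of_normal (γ.restrictScalars (RatFunc F)) hxM
  have hcard : Fintype.card ((Fin m ⊕ Λ) × Φ.conj x) = L := by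
    rw [Fintype.card_prod, Fintype.card_sum, Fintype.card_fin, Fintype.card_coe, Fintype.card_coe,
      hL, hδ]
  have hptM : ∀ i, Φ.point x Λ m i ∈ M := by
    rintro ⟨b | l, z⟩
    · exact hconjM _ z.2
    · exact Φ.action_mem hM _ (hconjM _ z.2)
  have hconjh : ∀ z ∈ Φ.conj x, Φ.canonicalHeight z = Φ.canonicalHeight x := fun z hz => by
    obtain ⟨γ, rfl⟩ := Φ.mem_conj.1 hz
    exact Φ.canonicalHeight_conj (Φ.algEquiv_coeff γ) x
  have hsumh : ∑ i, Φ.canonicalHeight (Φ.point x Λ m i) ≤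
      δ * (m + 2 * Λ.card * (Fintype.card F : ℝ) ^ (d * N)) * Φ.canonicalHeight x := by
    rw [Fintype.sum_prod_type, Fintype.sum_sum_type]
    have h1 : ∀ b : Fin m, ∑ z : Φ.conj x, Φ.canonicalHeight (Φ.point x Λ m (Sum.inl b, z)) =
        δ * Φ.canonicalHeight x := fun b => by
      rw [Finset.sum_congr rfl fun z _ => hconjh _ z.2, Finset.sum_const, Finset.card_univ,
        Fintype.card_coe, nsmul_eq_mul, hδ]
    have h2 : ∀ l : Λ, ∑ z : Φ.conj x, Φ.canonicalHeight (Φ.point x Λ m (Sum.inr l, z)) ≤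
        δ * (2 * (Fintype.card F : ℝ) ^ (d * N) * Φ.canonicalHeight x) := fun l => by
      refine (Finset.sum_le_card_nsmul _ _ (2 * (Fintype.card F : ℝ) ^ (d * N) *
        Φ.canonicalHeight x) fun z _ => ?_).trans (le_of_eq ?_)
      · have := Φ.canonicalHeight_action_le l.1 z
        rwa [hN l l.2, hconjh _ z.2] at this
      · rw [Finset.card_univ, Fintype.card_coe, nsmul_eq_mul, hδ]
    refine (add_le_add (Finset.sum_le_sum fun b _ => (h1 b).le)
      (Finset.sum_le_sum fun l _ => h2 l)).trans (le_of_eq ?_)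
    simp only [Finset.sum_const, Finset.card_univ, Fintype.card_fin, Fintype.card_coe, nsmul_eq_mul]
    ring
  -- The global element to which the product formula is applied. The leading coefficients are
  -- included so that their local contributions cancel on average.
  set u : Ω := (∏ i, ∏ j, Φ.diff x Λ m i j) *
    (∏ n ∈ Finset.range L, (Φ.polyDigits J n).leadingCoeff) ^ 2 with hu
  have hdM : ∀ i j, Φ.diff x Λ m i j ∈ M := fun i j => by
    unfold diff
    split_ifs
    · exact M.one_mem
    · exact M.sub_mem (hptM i) (hptM j)
  have huM : u ∈ M := mul_mem (prod_mem fun i _ => prod_mem fun j _ => hdM i j)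
    (pow_mem (prod_mem fun n _ => Φ.leadingCoeff_polyDigits_mem hM J n) 2)
  have hlc0 : ∀ n, (Φ.polyDigits J n).leadingCoeff ≠ 0 := fun n =>
    Polynomial.leadingCoeff_ne_zero.2 (Φ.polyDigits_ne_zero J n)
  have hprod1 : ∏ i, ∏ j, Φ.diff x Λ m i j ≠ 0 :=
    Finset.prod_ne_zero_iff.2 fun i _ => Finset.prod_ne_zero_iff.2 fun j _ => diff_ne_zero i j
  have hprod2 : ∏ n ∈ Finset.range L, (Φ.polyDigits J n).leadingCoeff ≠ 0 :=
    Finset.prod_ne_zero_iff.2 fun n _ => hlc0 n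
  have hlogu : ∀ w : Valuation Ω ℝ≥0, Real.logb (Fintype.card F) (w u) =
      ∑ i, ∑ j, Real.logb (Fintype.card F) (w (Φ.diff x Λ m i j)) +
      2 * ∑ n ∈ Finset.range L,
        Real.logb (Fintype.card F) (w (Φ.polyDigits J n).leadingCoeff) := by
    intro w
    have hne : ∀ {a : Ω}, a ≠ 0 → ((w a : ℝ≥0) : ℝ) ≠ 0 := fun ha => by
      exact_mod_cast (Valuation.ne_zero_iff w).2 ha
    rw [hu, map_mul, NNReal.coe_mul, Real.logb_mul (hne hprod1) (hne (pow_ne_zero 2 hprod2)),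
      map_pow, NNReal.coe_pow, Real.logb_pow, map_prod, map_prod, NNReal.coe_prod, NNReal.coe_prod,
      Real.logb_prod _ _ (fun i _ => hne (Finset.prod_ne_zero_iff.2 fun j _ => diff_ne_zero i j)),
      Real.logb_prod _ _ (fun n _ => hne (hlc0 n))]
    simp only [map_prod, NNReal.coe_prod]
    rw [Finset.sum_congr rfl fun i _ => Real.logb_prod _ _ fun j _ => hne (diff_ne_zero i j),
      Nat.cast_ofNat]
  obtain ⟨S₀, hS₀⟩ := exists_avg_log_eq_zero huM (mul_ne_zero hprod1 (pow_ne_zero 2 hprod2))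
  let v : Λ → BasePlace F := fun l => BasePlace.finite l.1 (hirr l l.2)
  have hvinj : Function.Injective v := by
    intro l l' h
    by_contra hne
    have h1 := finitePlace_self l.1 (hirr l l.2)
    have h2 : finitePlace l.1 (hirr l l.2) = finitePlace l'.1 (hirr l' l'.2) :=
      congrArg Subtype.val h
    rw [h2, finitePlace_polynomial_eq_one (hirr l' l'.2) fun hdvd => hne (Subtype.ext
      (Polynomial.eq_of_monic_of_associated (hmonic l l.2) (hmonic l' l'.2)
        ((hirr l' l'.2).associated_of_dvd (hirr l l.2) hdvd).symm))] at h1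
    exact (one_lt_card_pow (hirr l l.2)).ne' (inv_eq_one.1 h1.symm)
  -- `S` must contain infinity and all `l ∈ Λ`, so that the corresponding indicator functions
  -- average to exactly one.
  set S : Finset (BasePlace F) := S₀ ∪ insert (BasePlace.infty F) (Finset.univ.image v) with hS
  have hSinf : BasePlace.infty F ∈ S := Finset.mem_union_right _ (Finset.mem_insert_self _ _)
  have hSv : ∀ l, v l ∈ S := fun l => Finset.mem_union_right _ (Finset.mem_insert_of_mem
    (Finset.mem_image_of_mem _ (Finset.mem_univ l)))
  have h0 := hS₀ S Finset.subset_union_left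
  set c := Φ.coeffDegree with hc
  have hlocal : ∀ p : GPlace M, Real.logb (Fintype.card F) (p.val u) ≤
      2 * ∑ i, Real.logb (Fintype.card F) (Φ.sizeBound p.val J (Φ.point x Λ m i)) +
      (δ * m ^ 2 : ℝ) * (J * (if p.1 = BasePlace.infty F then 1 else 0) +
        Real.logb (Fintype.card F) (Φ.bound p.val)) -
      (2 * (t * δ * (N / c)) : ℝ) * ∑ l : Λ, (if p.1 = v l then (1 : ℝ) else 0) := by
    intro p
    have hb0 : 0 ≤ Real.logb (Fintype.card F) (Φ.bound p.val) :=
      Real.logb_nonneg (by exact_mod_cast hq) (by exact_mod_cast Φ.one_le_bound _)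
    rw [hlogu, ← hcard]
    by_cases hp : ∃ l, p.1 = v l
    · obtain ⟨l, hl⟩ := hp
      have h1 := sum_logb_diff_le_of_mem hx hRV hm l.2 (w := p.val) (hl := hirr l l.2)
        (fun y => by rw [p.val_algebraMap, hl]; rfl) J (hcard ▸ hLJ)
      have h2 : ∑ l' : Λ, (if p.1 = v l' then (1 : ℝ) else 0) = 1 := by
        rw [Finset.sum_eq_single l, if_pos hl]
        · intro l' _ hne
          rw [if_neg fun h => hne (hvinj (h.symm.trans hl))]
        · exact fun h => absurd (Finset.mem_univ l) h
      rw [h2, mul_one]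
      rw [hN l l.2, ← hδ] at h1
      have h3 : 0 ≤ (δ * m ^ 2 : ℝ) * (J * (if p.1 = BasePlace.infty F then 1 else 0) +
          Real.logb (Fintype.card F) (Φ.bound p.val)) := by
        have : (0 : ℝ) ≤ if p.1 = BasePlace.infty F then 1 else 0 := by split_ifs <;> simp
        positivity
      linarith
    · have h1 := sum_logb_diff_le (m := m) hx hirr hmonic hinj p.val J (hcard ▸ hLJ.le)
      have h2 : ∑ l' : Λ, (if p.1 = v l' then (1 : ℝ) else 0) = 0 :=
        Finset.sum_eq_zero fun l' _ => if_neg fun h => hp ⟨l', h⟩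
      rw [h2, mul_zero, sub_zero]
      refine h1.trans ?_
      rw [← hδ]
      gcongr
      exact logp_coeff_zero_le p
  have h1 := avg_mono (S := S) fun p (_ : p.1 ∈ S) => hlocal p
  rw [h0, avg_sub, avg_add, avg_const_mul, avg_sum, avg_const_mul, avg_add, avg_const_mul,
    avg_const_mul, avg_sum, avg_ite_eq hSinf,
    Finset.sum_congr rfl fun l _ => avg_ite_eq (hSv l) 1, Finset.sum_const, Finset.card_univ,
    Fintype.card_coe, nsmul_eq_mul, mul_one, mul_one] at h1
  have h2 := Φ.avg_logb_bound_le hM S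
  have h3 : ∑ i, avg S (fun p : GPlace M =>
      Real.logb (Fintype.card F) (Φ.sizeBound p.val J (Φ.point x Λ m i))) ≤
      (Fintype.card F : ℝ) ^ d * L * (δ * (m + 2 * Λ.card * (Fintype.card F : ℝ) ^ (d * N)) *
        Φ.canonicalHeight x) +
      L * (4 * Φ.moduleHeight * (Fintype.card F : ℝ) ^ d * (J + 1)) := by
    refine (Finset.sum_le_sum fun i _ => sum_avg_sizeBound_le hM (hptM i) S J).trans ?_
    rw [Finset.sum_add_distrib, Finset.sum_const, Finset.card_univ, hcard, nsmul_eq_mul,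
      ← Finset.mul_sum]
    -- This replaces `q ^ (d (J + 1))` by `q ^ d L`.
    have hJL' : ((Fintype.card F : ℝ) ^ d) ^ J ≤ L := by exact_mod_cast hJL
    refine add_le_add (mul_le_mul ?_ hsumh (Finset.sum_nonneg fun i _ =>
      Φ.canonicalHeight_nonneg _) (by positivity)) le_rfl
    rw [pow_succ']
    exact mul_le_mul_of_nonneg_left hJL' (by positivity)
  have hδr : (0 : ℝ) < δ := by exact_mod_cast hδ0
  have hLr : (L : ℝ) = (m + Λ.card) * δ := by
    rw [hL]
    push_cast
    ring
  have h4 : (δ * m ^ 2 : ℝ) * (J + avg S fun p : GPlace M =>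
      Real.logb (Fintype.card F) (Φ.bound p.val)) ≤ δ * m ^ 2 * (J + Φ.moduleHeight) := by
    gcongr
  refine le_of_mul_le_mul_left (a := (δ : ℝ)) ?_ hδr
  have e1 : (δ : ℝ) * (2 * (t * N * Λ.card / c : ℝ)) = 2 * (t * δ * (N / c)) * Λ.card := by ring
  rw [e1]
  have e2 : (L : ℝ) * (4 * Φ.moduleHeight * (Fintype.card F : ℝ) ^ d * (J + 1)) =
      δ * (4 * Φ.moduleHeight * (Fintype.card F : ℝ) ^ d * (J + 1) * (m + Λ.card)) := by
    rw [hLr]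
    ring
  rw [e2] at h3
  linarith

end DrinfeldModule

/-! ### Choice of the auxiliary parameters -/

lemma logb_le_self {q : ℕ} (hq : 2 ≤ q) {y : ℝ} (hy : 0 < y) : Real.logb q y ≤ y := by
  have hq' : (2 : ℝ) ≤ q := by exact_mod_cast hq
  have hlog2 : 0.6931471803 < Real.log 2 := Real.log_two_gt_d9
  have hlog2' : Real.log 2 < 0.6931471808 := Real.log_two_lt_d9
  have hlogq : Real.log 2 ≤ Real.log q := Real.log_le_log two_pos hq'
  rw [Real.logb, div_le_iff₀ (by linarith)]
  have h1 := Real.log_le_sub_one_of_pos (half_pos hy)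
  rw [Real.log_div hy.ne' two_ne_zero] at h1
  nlinarith

namespace DrinfeldModule

variable {F : Type*} [Field F] [Fintype F] {Ω : Type*} [Field Ω] [Algebra (RatFunc F) Ω]
  [Algebra.IsAlgebraic (RatFunc F) Ω] [IsAlgClosed Ω] [Algebra F Ω] [IsScalarTower F (RatFunc F) Ω]
  {d : ℕ} {Φ : DrinfeldModule F Ω d}

/-- Among sufficiently many primes with property RV there are many which are injective on the
conjugates of `x`. -/
lemma exists_finset_injOn {x : Ω} {N s : ℕ} (hs : 0 < s) (hcount : 2 * s ≤ Φ.rvCount N)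
    (hdrop : ∀ k : ℕ, 2 ^ k ≤ (Φ.conj x).card → k ≤ s) :
    ∃ Λ : Finset F[X], Λ.card = s ∧ (∀ l ∈ Λ, Φ.IsRVPrime l) ∧ (∀ l ∈ Λ, l.natDegree = N) ∧
      ∀ l ∈ Λ, Set.InjOn (Φ.action l) (Φ.conj x) := by
  classical
  obtain ⟨T, hT, hTcard⟩ := Set.exists_subset_card_eq hcount
  have hTfin : T.Finite := Set.finite_of_ncard_ne_zero (by omega)
  set T' := hTfin.toFinset with hT'
  have hT'card : T'.card = 2 * s := by rw [← hTcard, Set.ncard_eq_toFinset_card T hTfin]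
  have hmem : ∀ l ∈ T', l.natDegree = N ∧ Φ.IsRVPrime l := fun l hl =>
    hT ((Set.Finite.mem_toFinset _).1 hl)
  have h1 : (T'.filter fun l => ¬ Set.InjOn (Φ.action l) (Φ.conj x)).card ≤ s :=
    hdrop _ (Φ.two_pow_card_le _ (fun l hl => (hmem l (Finset.mem_filter.1 hl).1).2.irreducible)
      (fun l hl => (hmem l (Finset.mem_filter.1 hl).1).2.1)
      (fun l hl => (Finset.mem_filter.1 hl).2))
  have h2 := T'.card_filter_add_card_filter_not fun l => Set.InjOn (Φ.action l) (Φ.conj x)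
  obtain ⟨Λ, hΛ, hΛs⟩ := Finset.exists_subset_card_eq
    (show s ≤ (T'.filter fun l => Set.InjOn (Φ.action l) (Φ.conj x)).card by omega)
  refine ⟨Λ, hΛs, fun l hl => ?_, fun l hl => ?_, fun l hl => ?_⟩
  · exact (hmem l (Finset.mem_filter.1 (hΛ hl)).1).2
  · exact (hmem l (Finset.mem_filter.1 (hΛ hl)).1).1
  · exact (Finset.mem_filter.1 (hΛ hl)).2

lemma one_le_coeffDegree : 1 ≤ Φ.coeffDegree :=
  Nat.one_le_iff_ne_zero.2 (Module.finrank_pos (R := RatFunc F) (M := Φ.coeffField)).ne'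

/-- A lower bound for the canonical height, in terms of auxiliary parameters. -/
theorem le_canonicalHeight {x : Ω} (hx : ¬ Φ.IsTorsion x) {N s t : ℕ} {E : ℝ}
    (hN : 0 < N) (ht : 0 < t) (hcount : 2 * s ≤ Φ.rvCount N)
    (hdrop : ∀ k : ℕ, 2 ^ k ≤ (Φ.conj x).card → k ≤ s)
    (hE : ∀ J : ℕ, (Fintype.card F ^ d) ^ J ≤ (insepDegree F x * t + s) * (Φ.conj x).card →
      (J : ℝ) + 1 ≤ E)
    (htE : 32 * (Φ.moduleHeight * Φ.coeffDegree) * (Fintype.card F : ℝ) ^ d * E ≤ t)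
    (hsE : 2 * (Φ.moduleHeight * Φ.coeffDegree) * (insepDegree F x : ℝ) ^ 2 * t * E ≤ s) :
    (t * N : ℝ) ≤ 12 * Φ.coeffDegree * (Fintype.card F : ℝ) ^ d * (Φ.conj x).card * s *
      (Fintype.card F : ℝ) ^ (d * N) * Φ.canonicalHeight x := by
  have hh := Φ.one_le_moduleHeight
  have hc1 : (1 : ℝ) ≤ Φ.coeffDegree := by exact_mod_cast one_le_coeffDegree (Φ := Φ)
  have hP1 : (1 : ℝ) ≤ insepDegree F x := by exact_mod_cast insepDegree_pos (F := F) x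
  have ht1 : (1 : ℝ) ≤ t := by exact_mod_cast ht
  have hN1 : (1 : ℝ) ≤ N := by exact_mod_cast hN
  have hch := Φ.canonicalHeight_nonneg x
  have hqd : 1 < Fintype.card F ^ d := Nat.one_lt_pow Φ.rank_pos.ne' Fintype.one_lt_card
  set δ := (Φ.conj x).card with hδ
  have hδ0 : 0 < δ := Finset.card_pos.2 ⟨x, Φ.self_mem_conj x⟩
  set P := insepDegree F x with hP
  set c := (Φ.coeffDegree : ℝ) with hc
  set h := Φ.moduleHeight with hhdef
  have hm1 : 0 < P * t := Nat.mul_pos (insepDegree_pos x) ht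
  have hL0 : (P * t + s) * δ ≠ 0 := Nat.mul_ne_zero (by omega) hδ0.ne'
  -- The least `J` such that the digits in positions `0, …, J` represent `L`.
  set J := Nat.log (Fintype.card F ^ d) ((P * t + s) * δ) with hJ
  have hJL := Nat.pow_log_le_self (Fintype.card F ^ d) hL0
  have hLJ := Nat.lt_pow_succ_log_self hqd ((P * t + s) * δ)
  have hJE := hE J hJL
  have hE1 : 1 ≤ E := by
    have : (0 : ℝ) ≤ J := Nat.cast_nonneg J
    linarith
  have hα : 1 ≤ h * c := one_le_mul_of_one_le_of_one_le hh hc1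
  have hPt : (P * t : ℝ) ≤ s := by
    refine le_trans ?_ hsE
    calc (P * t : ℝ) = 1 * (1 * P) * t * 1 := by ring
      _ ≤ (2 * (h * c)) * (P * P) * t * E := by
        gcongr
        linarith
      _ = _ := by ring
  have hs0 : 0 < s := by
    have : (0 : ℝ) < s := lt_of_lt_of_le (by positivity) hPt
    exact_mod_cast this
  obtain ⟨Λ, hΛs, hRV, hΛN, hinj⟩ := exists_finset_injOn hs0 hcount hdrop
  have key := main_inequality hx hRV hΛN hinj (t := t) (J := J) rfl hδ
    (by rw [hΛs]) hJL hLJ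
  rw [hΛs, ← hhdef, ← hc] at key
  set q := (Fintype.card F : ℝ) with hq
  have hq1 : 1 ≤ q := by
    rw [hq]
    exact_mod_cast Fintype.one_lt_card (α := F).le
  have hs1 : (1 : ℝ) ≤ s := by exact_mod_cast hs0
  have hδ1 : (1 : ℝ) ≤ δ := by exact_mod_cast hδ0
  have hQ1 : 1 ≤ q ^ d := one_le_pow₀ hq1
  have hQN1 : 1 ≤ q ^ (d * N) := one_le_pow₀ hq1
  push_cast at key
  -- `t ≥ 32 α q ^ d E` makes the error from the size bounds at most a quarter of the gain `2 t N s
  -- / c`.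
  have h1 : 8 * h * q ^ d * (J + 1) * (P * t + s) ≤ 1 / 2 * (t * N * s / c) := by
    have e1 : 8 * h * q ^ d * (J + 1) * (P * t + s) ≤ 8 * h * q ^ d * E * (2 * s) := by
      gcongr
      linarith
    have e2 : 8 * h * q ^ d * E * (2 * s) = 1 / 2 * ((32 * (h * c) * q ^ d * E) * 1 * s / c) := by
      field_simp
      ring
    rw [e2] at e1
    refine e1.trans ?_
    gcongr
  -- `s ≥ 2 α P ^ 2 t E` makes the cost of coincidences at most another quarter, leaving half for
  -- the height term.
  have h2 : (P * t : ℝ) ^ 2 * (h + J) ≤ 1 / 2 * (t * N * s / c) := by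
    have e0 : h + J ≤ h * E := by nlinarith [Nat.cast_nonneg (α := ℝ) J]
    have e1 : (P * t : ℝ) ^ 2 * (h + J) ≤ (P * t : ℝ) ^ 2 * (h * E) := by gcongr
    have e2 : (P * t : ℝ) ^ 2 * (h * E) =
        1 / 2 * (t * 1 * (2 * (h * c) * (P : ℝ) ^ 2 * t * E) / c) := by
      field_simp
    rw [e2] at e1
    refine e1.trans ?_
    gcongr
  have h3 : t * N * s / c ≤ 2 * q ^ d * ((2 * s) * δ) * (3 * s * q ^ (d * N)) *
      Φ.canonicalHeight x := by
    have e1 : 2 * q ^ d * ((P * t + s) * δ) * (P * t + 2 * s * q ^ (d * N)) *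
        Φ.canonicalHeight x ≤ 2 * q ^ d * ((2 * s) * δ) * (3 * s * q ^ (d * N)) *
      Φ.canonicalHeight x := by
      gcongr
      · linarith
      · nlinarith
    linarith
  rw [div_le_iff₀ (by linarith)] at h3
  refine le_of_mul_le_mul_right (a := (s : ℝ)) ?_ (by linarith)
  refine h3.trans (le_of_eq ?_)
  ring

set_option maxHeartbeats 400000 in
/-- Bounds for the auxiliary parameters. -/
lemma exists_parameters (q d P δ D : ℕ) (hq : 2 ≤ q) (hd : 0 < d) (hP : 0 < P) (hδ : 0 < δ)
    (hD : δ * P ≤ D) {α ℓ : ℝ} (hα : 1 ≤ α) (hℓ : 1 ≤ ℓ) (hℓD : Real.logb q D ≤ ℓ) :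
    ∃ s t : ℕ, 0 < t ∧ (∀ k : ℕ, 2 ^ k ≤ δ → k ≤ s) ∧
      (∀ J : ℕ, (q ^ d) ^ J ≤ (P * t + s) * δ → (J : ℝ) + 1 ≤ 30 * α * ℓ) ∧
      32 * α * (q : ℝ) ^ d * (30 * α * ℓ) ≤ t ∧
      2 * α * (P : ℝ) ^ 2 * t * (30 * α * ℓ) ≤ s ∧
      (s : ℝ) ≤ 3 * α * (P : ℝ) ^ 2 * (30 * α * ℓ) * t ∧
      (s : ℝ) ≤ 89100 * α ^ 4 * (q : ℝ) ^ d * ℓ ^ 2 * (P : ℝ) ^ 2 := by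
  have hq' : (2 : ℝ) ≤ q := by exact_mod_cast hq
  have hq1 : (1 : ℝ) < q := by linarith
  have hQ1 : (1 : ℝ) ≤ (q : ℝ) ^ d := one_le_pow₀ hq1.le
  have hqQ : (q : ℝ) ≤ (q : ℝ) ^ d := le_self_pow₀ hq1.le hd.ne'
  have hP1 : (1 : ℝ) ≤ P := by exact_mod_cast hP
  have hδ1 : (1 : ℝ) ≤ δ := by exact_mod_cast hδ
  have hD' : (δ * P : ℝ) ≤ D := by exact_mod_cast hD
  have hD1 : (1 : ℝ) ≤ D := (one_le_mul_of_one_le_of_one_le hδ1 hP1).trans hD'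
  set E := 30 * α * ℓ with hE
  have hαℓ : 1 ≤ α * ℓ := one_le_mul_of_one_le_of_one_le hα hℓ
  have hE1 : 30 ≤ E := by rw [hE, mul_assoc]; linarith
  have hαQE : 1 ≤ α * (q : ℝ) ^ d * E :=
    one_le_mul_of_one_le_of_one_le (one_le_mul_of_one_le_of_one_le hα hQ1) (by linarith)
  set t := ⌈32 * α * (q : ℝ) ^ d * E⌉₊ with ht
  have ht1 : 32 * α * (q : ℝ) ^ d * E ≤ t := Nat.le_ceil _
  have ht2 : (t : ℝ) ≤ 33 * α * (q : ℝ) ^ d * E := by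
    have := (Nat.ceil_lt_add_one (show 0 ≤ 32 * α * (q : ℝ) ^ d * E by positivity)).le
    rw [← ht] at this
    nlinarith
  have ht32 : (32 : ℝ) ≤ t := by nlinarith
  set s := ⌈2 * α * (P : ℝ) ^ 2 * t * E⌉₊ with hs
  have hs1 : 2 * α * (P : ℝ) ^ 2 * t * E ≤ s := Nat.le_ceil _
  have hprod : 1 ≤ α * (P : ℝ) ^ 2 * t * E :=
    one_le_mul_of_one_le_of_one_le (one_le_mul_of_one_le_of_one_le
      (one_le_mul_of_one_le_of_one_le hα (one_le_pow₀ hP1)) (by linarith)) (by linarith)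
  have hs2 : (s : ℝ) ≤ 3 * α * (P : ℝ) ^ 2 * E * t := by
    have := (Nat.ceil_lt_add_one (show 0 ≤ 2 * α * (P : ℝ) ^ 2 * t * E by positivity)).le
    rw [← hs] at this
    nlinarith
  have hs3 : (s : ℝ) ≤ 89100 * α ^ 4 * (q : ℝ) ^ d * ℓ ^ 2 * (P : ℝ) ^ 2 := by
    calc (s : ℝ) ≤ 3 * α * (P : ℝ) ^ 2 * E * t := hs2
      _ ≤ 3 * α * (P : ℝ) ^ 2 * E * (33 * α * (q : ℝ) ^ d * E) := by gcongr
      _ = _ := by rw [hE]; ring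
  have hPts : (P * t : ℝ) ≤ s := by
    refine le_trans ?_ hs1
    calc (P * t : ℝ) = 1 * (1 * P) * t * 1 := by ring
      _ ≤ (2 * α) * (P * P) * t * E := by
        gcongr
        · linarith
        · linarith
      _ = _ := by ring
  -- At most `log₂ δ ≤ q ℓ` primes can fail to be injective on the conjugates; this ensures that `s`
  -- covers them.
  have hqs : (q : ℝ) * ℓ ≤ s := by
    refine le_trans ?_ hs1
    have hℓE : ℓ ≤ E := by rw [hE]; nlinarith
    have hqt : (q : ℝ) ≤ t := by
      refine hqQ.trans (le_trans ?_ ht1)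
      have : (1 : ℝ) ≤ 32 * α * E := by nlinarith
      nlinarith
    calc (q : ℝ) * ℓ = 1 * 1 * q * ℓ := by ring
      _ ≤ (2 * α) * (P : ℝ) ^ 2 * t * E := by
        gcongr
        · linarith
        · exact one_le_pow₀ hP1
      _ = _ := by ring
  have hlogα : Real.logb q α ≤ α := logb_le_self hq (by linarith)
  have hlogℓ : Real.logb q ℓ ≤ ℓ := logb_le_self hq (by linarith)
  refine ⟨s, t, ?_, fun k hk => ?_, fun J hJ => ?_, ht1, hs1, hs2, hs3⟩
  · have : (0 : ℝ) < t := by linarith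
    exact_mod_cast this
  · have h1 : (2 : ℝ) ^ k ≤ D := by
      have : (2 : ℝ) ^ k ≤ δ := by exact_mod_cast hk
      nlinarith
    have h2 : (k : ℝ) * Real.logb q 2 ≤ ℓ := by
      rw [← Real.logb_pow]
      exact (Real.logb_le_logb_of_le hq1 (by positivity) h1).trans hℓD
    have h3 : (1 : ℝ) ≤ q * Real.logb q 2 := by
      have h4 : Real.logb 2 q ≤ q := logb_le_self (q := 2) le_rfl (by linarith)
      have h5 : Real.logb q 2 = (Real.logb 2 q)⁻¹ := (Real.inv_logb 2 q).symm
      have h6 : 0 < Real.logb 2 q := Real.logb_pos one_lt_two hq1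
      rw [h5, ← div_eq_mul_inv, le_div_iff₀ h6]
      linarith
    have h7 : (k : ℝ) ≤ s := by
      refine le_trans ?_ hqs
      calc (k : ℝ) = k * 1 := by ring
        _ ≤ k * (q * Real.logb q 2) := by gcongr
        _ = q * (k * Real.logb q 2) := by ring
        _ ≤ _ := by gcongr
    exact_mod_cast h7
  -- Taking logarithms gives `J ≤ 19 + 4 α + 4 ℓ`, and `30 α ℓ` exceeds this by at least one. The
  -- constant is `178200 = 2 · 3 · 33 · 30 ^ 2`, at most `2 ^ 18`.
  · have hL : ((q : ℝ) ^ d) ^ J ≤ 178200 * α ^ 4 * (q : ℝ) ^ d * ℓ ^ 2 * (D : ℝ) ^ 2 := by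
      have h1 : ((q : ℝ) ^ d) ^ J ≤ (P * t + s) * δ := by exact_mod_cast hJ
      refine h1.trans ?_
      calc (P * t + s : ℝ) * δ ≤ (2 * (89100 * α ^ 4 * (q : ℝ) ^ d * ℓ ^ 2 * (P : ℝ) ^ 2)) * δ := by
            gcongr
            linarith
        _ = 178200 * α ^ 4 * (q : ℝ) ^ d * ℓ ^ 2 * (P * (δ * P)) := by ring
        _ ≤ 178200 * α ^ 4 * (q : ℝ) ^ d * ℓ ^ 2 * (D * D) := by
            gcongr
            nlinarith
        _ = _ := by ring
    have h2 := Real.logb_le_logb_of_le hq1 (by positivity) hL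
    rw [Real.logb_mul (by positivity) (by positivity), Real.logb_mul (by positivity) (by positivity),
      Real.logb_mul (by positivity) (by positivity), Real.logb_mul (by positivity) (by positivity),
      ← pow_mul, Real.logb_pow, Real.logb_pow, Real.logb_pow, Real.logb_pow, Real.logb_pow,
      Real.logb_self_eq_one hq1] at h2
    have h3 : Real.logb q 178200 ≤ 18 := by
      rw [Real.logb_le_iff_le_rpow hq1 (by norm_num)]
      calc (178200 : ℝ) ≤ 2 ^ (18 : ℕ) := by norm_num
        _ ≤ (q : ℝ) ^ (18 : ℕ) := by gcongr
        _ = _ := by norm_cast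
    push_cast at h2
    have hd1 : (1 : ℝ) ≤ d := by exact_mod_cast hd
    have h6 : 0 ≤ ((d : ℝ) - 1) * (18 + 4 * α + 4 * ℓ) :=
      mul_nonneg (by linarith) (by linarith)
    have h4 : (d : ℝ) * J ≤ d * (19 + 4 * α + 4 * ℓ) := by linarith
    have h5 : (J : ℝ) ≤ 19 + 4 * α + 4 * ℓ := le_of_mul_le_mul_left h4 (by linarith)
    have h7 : α ≤ α * ℓ := le_mul_of_one_le_right (by linarith) hℓ
    have h8 : ℓ ≤ α * ℓ := le_mul_of_one_le_left (by linarith) hα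
    rw [hE, mul_assoc]
    linarith

end DrinfeldModule

/-- The least `N ≥ N₀` for which `q ^ (r N) / (2 r N)` is large. -/
lemma exists_least_degree {q : ℕ} (hq : 2 ≤ q) {r : ℝ} (hr : 0 < r) (hr' : r ≤ 1) {N₀ s : ℕ}
    (hN₀ : 0 < N₀) (hs : 0 < s) :
    ∃ N : ℕ, N₀ ≤ N ∧ (2 * s : ℝ) ≤ 1 / (2 * r) * ((q : ℝ) ^ (r * N) / N) ∧
      (q : ℝ) ^ (r * N) ≤ (q : ℝ) ^ (r * N₀) * (4 * s * N) := by
  classical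
  have hq1 : (1 : ℝ) < q := by exact_mod_cast hq
  have hq0 : (0 : ℝ) < q := by linarith
  have hs1 : (1 : ℝ) ≤ s := by exact_mod_cast hs
  have hex : ∃ N : ℕ, N₀ ≤ N ∧ 4 * r * s * N ≤ (q : ℝ) ^ (r * N) := by
    have h1 := tendsto_pow_const_div_const_pow_of_one_lt 1 (Real.one_lt_rpow hq1 hr)
    have h2 := (h1.eventually_lt_const (show 0 < 1 / (4 * r * s) by positivity)).and
      (Filter.eventually_ge_atTop N₀)
    obtain ⟨N, hN, hNN⟩ := h2.exists
    refine ⟨N, hNN, ?_⟩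
    rw [div_lt_div_iff₀ (by positivity) (by positivity), ← Real.rpow_mul_natCast hq0.le] at hN
    linarith [hN]
  obtain ⟨hN, hle⟩ := Nat.find_spec hex
  set N := Nat.find hex with hNdef
  have hN1 : (1 : ℝ) ≤ N := by exact_mod_cast hN₀.trans_le hN
  refine ⟨N, hN, ?_, ?_⟩
  · rw [div_mul_div_comm, one_mul, le_div_iff₀ (by positivity)]
    linarith
  · rcases hN.eq_or_lt with h | h
    · rw [← h] at hN1 ⊢
      exact le_mul_of_one_le_right (by positivity) (by nlinarith)
    -- If `N > N₀`, the defining inequality fails at `N - 1`; passing to `N` costs a factor `q ^ r`.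
    · have hmin := Nat.find_min hex (m := N - 1) (by omega)
      push Not at hmin
      have h1 := (hmin (by omega)).le
      rw [Nat.cast_sub (by omega), Nat.cast_one, mul_sub, mul_one, Real.rpow_sub hq0,
        div_le_iff₀ (by positivity)] at h1
      refine h1.trans ?_
      rw [mul_comm]
      have h2 : (q : ℝ) ^ r ≤ (q : ℝ) ^ (r * N₀) := by
        refine Real.rpow_le_rpow_of_exponent_le hq1.le (le_mul_of_one_le_right hr.le ?_)
        exact_mod_cast hN₀
      have h3 : 4 * r * s * ((N : ℝ) - 1) ≤ 4 * s * N := by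
        calc 4 * r * s * ((N : ℝ) - 1) ≤ 4 * 1 * s * N := by
              gcongr
              linarith
          _ = _ := by ring
      have h4 : (0 : ℝ) ≤ 4 * s * N := by positivity
      calc (q : ℝ) ^ r * (4 * r * s * ((N : ℝ) - 1)) ≤ (q : ℝ) ^ r * (4 * s * N) := by gcongr
        _ ≤ _ := by gcongr

/-- After splitting `4 s N = (8 s / r) (r N / 2)` and taking logarithms, `log (r N / 2) ≤ r N / 2`
is absorbed by the left side. -/
lemma degree_le_of_rpow_le {q : ℕ} (hq : 2 ≤ q) {r : ℝ} (hr : 0 < r) {N₀ N s : ℕ}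
    (hN : 0 < N) (hs : 0 < s) (h : (q : ℝ) ^ (r * N) ≤ (q : ℝ) ^ (r * N₀) * (4 * s * N)) :
    (N : ℝ) ≤ 2 * N₀ + 2 / r * Real.logb q (8 * s / r) := by
  have hq1 : (1 : ℝ) < q := by exact_mod_cast hq
  have hq0 : (0 : ℝ) < q := by linarith
  have hs0 : (0 : ℝ) < s := by exact_mod_cast hs
  have hN0 : (0 : ℝ) < N := by exact_mod_cast hN
  have h1 := Real.logb_le_logb_of_le hq1 (by positivity) h
  have h2 : (4 * s * N : ℝ) = 8 * s / r * (r * N / 2) := by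
    field_simp
    ring
  rw [h2, Real.logb_mul (by positivity) (by positivity), Real.logb_mul (by positivity)
    (by positivity), Real.logb_rpow hq0 hq1.ne', Real.logb_rpow hq0 hq1.ne'] at h1
  have h3 := logb_le_self hq (show 0 < r * N / 2 by positivity)
  have h4 : r * N ≤ r * (2 * N₀ + 2 / r * Real.logb q (8 * s / r)) := by
    have : r * (2 * N₀ + 2 / r * Real.logb q (8 * s / r)) =
        2 * (r * N₀ + Real.logb q (8 * s / r)) := by
      field_simp
    linarith
  exact le_of_mul_le_mul_left h4 hr

lemma logb_eight_mul_div_le {q d s P : ℕ} (hq : 2 ≤ q) (hd : 0 < d) (hs : 0 < s) (hP : 0 < P)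
    {r α ℓ : ℝ} (hr : 0 < r) (hα : 1 ≤ α) (hℓ : 1 ≤ ℓ) (hPℓ : Real.logb q P ≤ ℓ)
    (h : (s : ℝ) ≤ 89100 * α ^ 4 * (q : ℝ) ^ d * ℓ ^ 2 * (P : ℝ) ^ 2) :
    Real.logb q (8 * s / r) ≤ 29 * d * α * ℓ + Real.logb q (1 / r) := by
  have hq1 : (1 : ℝ) < q := by exact_mod_cast hq
  have hq0 : (0 : ℝ) < q := by linarith
  have hq2 : (2 : ℝ) ≤ q := by exact_mod_cast hq
  have hs0 : (0 : ℝ) < s := by exact_mod_cast hs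
  have hP0 : (0 : ℝ) < P := by exact_mod_cast hP
  have hd1 : (1 : ℝ) ≤ d := by exact_mod_cast hd
  have h1 : (8 * s / r : ℝ) ≤ 712800 * α ^ 4 * (q : ℝ) ^ d * ℓ ^ 2 * (P : ℝ) ^ 2 * (1 / r) := by
    rw [div_eq_mul_one_div]
    exact mul_le_mul_of_nonneg_right (by linarith) (by positivity)
  have h2 := Real.logb_le_logb_of_le hq1 (by positivity) h1
  rw [Real.logb_mul (by positivity) (by positivity), Real.logb_mul (by positivity) (by positivity),
      Real.logb_mul (by positivity) (by positivity), Real.logb_mul (by positivity) (by positivity),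
      Real.logb_mul (by positivity) (by positivity),
      Real.logb_pow, Real.logb_pow, Real.logb_pow, Real.logb_pow, Real.logb_self_eq_one hq1] at h2
  have h3 : Real.logb q 712800 ≤ 20 := by
    rw [Real.logb_le_iff_le_rpow hq1 (by norm_num)]
    calc (712800 : ℝ) ≤ 2 ^ (20 : ℕ) := by norm_num
      _ ≤ (q : ℝ) ^ (20 : ℕ) := by gcongr
      _ = _ := by norm_cast
  have hlogα : Real.logb q α ≤ α := logb_le_self hq (by linarith)
  have hlogℓ : Real.logb q ℓ ≤ ℓ := logb_le_self hq (by linarith)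
  push_cast at h2
  have hdα : 1 ≤ d * α := one_le_mul_of_one_le_of_one_le hd1 hα
  have hdℓ : 1 ≤ d * ℓ := one_le_mul_of_one_le_of_one_le hd1 hℓ
  have hαℓ : 1 ≤ α * ℓ := one_le_mul_of_one_le_of_one_le hα hℓ
  have e1 : α ≤ d * α * ℓ := by nlinarith
  have e2 : ℓ ≤ d * α * ℓ := by nlinarith
  have e3 : (d : ℝ) ≤ d * α * ℓ := by nlinarith
  linarith

lemma logLogPlus_le_logPlus {q D : ℕ} (hq : 2 ≤ q) (hD : 0 < D) :
    logLogPlus q D ≤ logPlus q D := by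
  have hq1 : (1 : ℝ) < q := by exact_mod_cast hq
  refine max_le_max ?_ le_rfl
  have h0 : 0 ≤ Real.logb q D := Real.logb_nonneg hq1 (by exact_mod_cast hD)
  rcases h0.eq_or_lt with h | h
  · rw [← h]
    simp
  · exact logb_le_self hq h

/-- Apply `log t ≤ t` to `t = y ^ (1 / B)`, with `y = log D`: this gives `log y ≤ B y ^ (1 / B)`,
which is raised to the power `B`. -/
lemma logLogPlus_rpow_le {q D : ℕ} (hq : 2 ≤ q) (hD : 0 < D) {B : ℝ} (hB : 1 ≤ B) :
    logLogPlus q D ^ B ≤ B ^ B * logPlus q D := by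
  have hq1 : (1 : ℝ) < q := by exact_mod_cast hq
  have hℓ1 : 1 ≤ logPlus q D := le_max_right _ _
  have hBB : 1 ≤ B ^ B := Real.one_le_rpow hB (by linarith)
  have h0 : 0 ≤ Real.logb q D := Real.logb_nonneg hq1 (by exact_mod_cast hD)
  rcases le_total (Real.logb q (Real.logb q D)) 1 with h | h
  · rw [logLogPlus, max_eq_right h, Real.one_rpow]
    exact one_le_mul_of_one_le_of_one_le hBB hℓ1
  · rw [logLogPlus, max_eq_left h]
    have hy : 0 < Real.logb q D := by
      rcases h0.eq_or_lt with h' | h'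
      · rw [← h'] at h
        norm_num at h
      · exact h'
    set y := Real.logb q D with hydef
    have h1 : Real.logb q y ≤ B * y ^ (1 / B) := by
      have h2 := logb_le_self hq (Real.rpow_pos_of_pos hy (1 / B))
      rw [Real.logb_rpow_eq_mul_logb_of_pos hy, one_div, inv_mul_le_iff₀ (by linarith)] at h2
      rwa [one_div]
    calc Real.logb q y ^ B ≤ (B * y ^ (1 / B)) ^ B :=
          Real.rpow_le_rpow (by linarith) h1 (by linarith)
      _ = B ^ B * y := by
          rw [Real.mul_rpow (by linarith) (by positivity), ← Real.rpow_mul hy.le,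
            one_div_mul_cancel (by linarith), Real.rpow_one]
      _ ≤ _ := by
          gcongr
          exact le_max_left _ _

/-- The comparison of the constant obtained for type RV(r) with the second entry of `C₀`. -/
lemma explicit_constant_le {d b r α c Q ν X : ℝ} (hd : 1 ≤ d) (hr : 0 < r) (hr' : r ≤ 1)
    (hb : b = d / r) (hα : 1 ≤ α) (hc : 1 ≤ c) (hcα : c ≤ α) (hQ : 1 ≤ Q) (hν : 0 < ν)
    (hν' : ν ≤ 64 * α * b) (hX : 35000 * d * α ^ 3 * Q ≤ X) (hXb : 17500 * b ≤ X) :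
    α / (384 * r * Q * X ^ (4 * α * b + 1)) ≤
      ν ^ (1 - b) / (1080 * α ^ 2 * c * Q * Q * (356400 * α ^ 4 * Q) ^ b) / (2 + b) ^ (2 + b) := by
  have hdb : d = r * b := by rw [hb]; field_simp
  have hb1 : 1 ≤ b := by rw [hb, le_div_iff₀ hr]; linarith
  have hα3 : 1 ≤ α ^ 3 := one_le_pow₀ hα
  have hdα : 1 ≤ d * α ^ 3 * Q :=
    one_le_mul_of_one_le_of_one_le (one_le_mul_of_one_le_of_one_le hd hα3) hQ
  have hX1 : 1 ≤ X := by linarith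
  have hX0 : 0 < X := by linarith
  have hB : (2 + b) ^ (2 + b) ≤ 9 * b ^ 2 * (3 * b) ^ b := by
    calc (2 + b) ^ (2 + b) ≤ (3 * b) ^ (2 + b) :=
          Real.rpow_le_rpow (by linarith) (by linarith) (by linarith)
      _ = (3 * b) ^ (2 : ℝ) * (3 * b) ^ b := Real.rpow_add (by linarith) _ _
      _ = _ := by rw [Real.rpow_two]; ring
  -- The exponent `1 - b` is nonpositive, so an upper bound for `ν` bounds `ν ^ (1 - b)` from below.
  have hνb : 64 * α * b ≤ ν ^ (1 - b) * (64 * α * b) ^ b := by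
    have h1 : (64 * α * b) ^ (1 - b) ≤ ν ^ (1 - b) :=
      Real.rpow_le_rpow_of_nonpos hν hν' (by linarith)
    calc 64 * α * b = (64 * α * b) ^ (1 - b) * (64 * α * b) ^ b := by
          rw [← Real.rpow_add (by positivity), sub_add_cancel, Real.rpow_one]
      _ ≤ _ := by gcongr
  have hb2 : b ^ 2 ≤ 4 ^ b := by
    have h1 := one_add_mul_self_le_rpow_one_add (s := 1) (by norm_num) hb1
    have h2 : b ≤ 2 ^ b := by
      norm_num at h1
      linarith
    calc b ^ 2 ≤ (2 ^ b) ^ 2 := by gcongr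
      _ = 4 ^ b := by
        rw [← Real.rpow_mul_natCast two_pos.le, mul_comm, Real.rpow_mul two_pos.le]
        norm_num
  have hQX : 35000 * (α ^ 3 * Q) ≤ X := by
    refine le_trans ?_ hX
    have : α ^ 3 * Q ≤ d * (α ^ 3 * Q) := le_mul_of_one_le_left (by positivity) hd
    linarith
  -- All quantities raised to the power `b`, together with the `4` from `b ^ 2 ≤ 4 ^ b`, fit into `X
  -- ^ 4`; this is the source of the exponent `4 α b`.
  have hY : 4 * ((3 * b) * (356400 * α ^ 4 * Q) * (64 * α * b)) ≤ X ^ 4 := by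
    calc 4 * ((3 * b) * (356400 * α ^ 4 * Q) * (64 * α * b))
        = 273715200 * (b ^ 2 * (α ^ 5 * Q)) := by ring
      _ ≤ 273715200 * (b ^ 2 * (α ^ 6 * Q ^ 2)) := by
          have h5 : α ^ 5 ≤ α ^ 6 := pow_le_pow_right₀ hα (by norm_num)
          have h6 : Q ≤ Q ^ 2 := le_self_pow₀ hQ (by norm_num)
          gcongr
      _ ≤ (17500 * b) ^ 2 * (35000 * (α ^ 3 * Q)) ^ 2 := by
          have : 0 ≤ b ^ 2 * (α ^ 6 * Q ^ 2) := by positivity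
          calc _ ≤ 375156250000000000 * (b ^ 2 * (α ^ 6 * Q ^ 2)) := by gcongr; norm_num
            _ = _ := by ring
      _ ≤ X ^ 2 * X ^ 2 := by gcongr
      _ = _ := by ring
  have hYb : b ^ 2 * ((3 * b) ^ b * (356400 * α ^ 4 * Q) ^ b * (64 * α * b) ^ b) ≤
      X ^ (4 * α * b) := by
    calc _ ≤ 4 ^ b * ((3 * b) ^ b * (356400 * α ^ 4 * Q) ^ b * (64 * α * b) ^ b) := by gcongr
      _ = (4 * ((3 * b) * (356400 * α ^ 4 * Q) * (64 * α * b))) ^ b := by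
          rw [Real.mul_rpow (x := 4) (by positivity) (by positivity),
            Real.mul_rpow (x := 3 * b * (356400 * α ^ 4 * Q)) (by positivity) (by positivity),
            Real.mul_rpow (x := 3 * b) (by positivity) (by positivity)]
      _ ≤ (X ^ 4) ^ b := Real.rpow_le_rpow (by positivity) hY (by linarith)
      _ = X ^ (4 * b) := by
          rw [← Real.rpow_natCast_mul hX0.le]
          norm_num
      _ ≤ _ := by
          refine Real.rpow_le_rpow_of_exponent_le hX1 ?_
          nlinarith
  have hpos : 0 < (64 * α * b) ^ b := by positivity
  rw [div_div, div_le_div_iff₀ (by positivity) (by positivity)]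
  refine le_of_mul_le_mul_right ?_ hpos
  rw [Real.rpow_add hX0, Real.rpow_one]
  have hXb0 : 0 < X ^ (4 * α * b) := by positivity
  calc α * (1080 * α ^ 2 * c * Q * Q * (356400 * α ^ 4 * Q) ^ b * (2 + b) ^ (2 + b)) *
        (64 * α * b) ^ b
      ≤ α * (1080 * α ^ 2 * α * Q * Q * (356400 * α ^ 4 * Q) ^ b *
          (9 * b ^ 2 * (3 * b) ^ b)) * (64 * α * b) ^ b := by gcongr
    _ = 9720 * α * Q * (α ^ 3 * Q) *
        (b ^ 2 * ((3 * b) ^ b * (356400 * α ^ 4 * Q) ^ b * (64 * α * b) ^ b)) := by ring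
    _ ≤ 9720 * α * Q * X * X ^ (4 * α * b) := by
        gcongr
        linarith [mul_pos (pow_pos (zero_lt_one.trans_le hα) 3) (zero_lt_one.trans_le hQ)]
    _ ≤ (384 * 64 * α * Q * X * X ^ (4 * α * b)) * d := by
        have : 0 < α * Q * X * X ^ (4 * α * b) := by positivity
        nlinarith
    _ = 64 * α * b * (384 * r * Q * (X ^ (4 * α * b) * X)) := by rw [hdb]; ring
    _ ≤ (ν ^ (1 - b) * (64 * α * b) ^ b) * (384 * r * Q * (X ^ (4 * α * b) * X)) := by gcongr
    _ = _ := by ring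

/-! ### The lower bound with its constants -/

namespace DrinfeldModule

variable {F : Type*} [Field F] [Fintype F] {Ω : Type*} [Field Ω] [Algebra (RatFunc F) Ω]
  [Algebra.IsAlgebraic (RatFunc F) Ω] [IsAlgClosed Ω] [Algebra F Ω] [IsScalarTower F (RatFunc F) Ω]
  {d : ℕ} (Φ : DrinfeldModule F Ω d)

/-- `ν ℓ` bounds the degree of the auxiliary primes, where `ℓ = log₊ D`. -/
def degreeFactor (r : ℝ) (N₀ : ℕ) : ℝ :=
  2 * N₀ + 2 / r * (29 * d * (Φ.moduleHeight * Φ.coeffDegree) + Real.logb (Fintype.card F) (1 / r))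

/-- The constant in the lower bound for the canonical height, when there are many RV primes in each
degree `≥ N₀`. -/
def heightConstant (r : ℝ) (N₀ : ℕ) : ℝ :=
  Φ.degreeFactor r N₀ ^ (1 - d / r) /
    (1080 * (Φ.moduleHeight * Φ.coeffDegree) ^ 2 * Φ.coeffDegree * (Fintype.card F : ℝ) ^ d *
      (Fintype.card F : ℝ) ^ (d * N₀) *
      (356400 * (Φ.moduleHeight * Φ.coeffDegree) ^ 4 * (Fintype.card F : ℝ) ^ d) ^ (d / r))

variable {Φ}

lemma one_le_height_mul_degree : 1 ≤ Φ.moduleHeight * Φ.coeffDegree :=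
  one_le_mul_of_one_le_of_one_le Φ.one_le_moduleHeight
    (by exact_mod_cast one_le_coeffDegree (Φ := Φ))

lemma degreeFactor_pos {r : ℝ} (hr : 0 < r) (hr' : r ≤ 1) {N₀ : ℕ} (hN₀ : 0 < N₀) :
    0 < Φ.degreeFactor r N₀ := by
  have hq1 : (1 : ℝ) < Fintype.card F := by exact_mod_cast Fintype.one_lt_card (α := F)
  have h1 : 0 ≤ Real.logb (Fintype.card F) (1 / r) :=
    Real.logb_nonneg hq1 (by rw [le_div_iff₀ hr]; linarith)
  have hα := one_le_height_mul_degree (Φ := Φ)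
  rw [degreeFactor]
  positivity

lemma heightConstant_pos {r : ℝ} (hr : 0 < r) (hr' : r ≤ 1) {N₀ : ℕ} (hN₀ : 0 < N₀) :
    0 < Φ.heightConstant r N₀ := by
  have hν := degreeFactor_pos (Φ := Φ) hr hr' hN₀
  have hα := one_le_height_mul_degree (Φ := Φ)
  have hc : (1 : ℝ) ≤ Φ.coeffDegree := by exact_mod_cast one_le_coeffDegree (Φ := Φ)
  have hq1 : (1 : ℝ) < Fintype.card F := by exact_mod_cast Fintype.one_lt_card (α := F)
  rw [heightConstant]
  positivity

/-- The lower bound for the canonical height. -/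
theorem heightConstant_le {r : ℝ} (hr : 0 < r) (hr' : r ≤ 1) {N₀ : ℕ} (hN₀ : 0 < N₀)
    (hRV : ∀ N : ℕ, N₀ ≤ N →
      1 / (2 * r) * ((Fintype.card F : ℝ) ^ (r * N) / N) ≤ Φ.rvCount N)
    {x : Ω} (hx : ¬ Φ.IsTorsion x) :
    Φ.heightConstant r N₀ ≤ degree F x * (insepDegree F x : ℝ) ^ (1 + 2 * (d / r)) *
      logPlus (Fintype.card F) (degree F x) ^ (3 * (d / r)) * Φ.canonicalHeight x := by
  have hq : 2 ≤ Fintype.card F := Fintype.one_lt_card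
  have hα := one_le_height_mul_degree (Φ := Φ)
  have hν := degreeFactor_pos (Φ := Φ) hr hr' hN₀
  have hδ0 : 0 < (Φ.conj x).card := Finset.card_pos.2 ⟨x, Φ.self_mem_conj x⟩
  have hP0 := insepDegree_pos (F := F) x
  have hδP := Φ.card_conj_mul_insepDegree_le x
  have hℓ : 1 ≤ logPlus (Fintype.card F) (degree F x) := le_max_right _ _
  have hℓD : Real.logb (Fintype.card F) (degree F x) ≤ logPlus (Fintype.card F) (degree F x) :=
    le_max_left _ _
  have hch := Φ.canonicalHeight_nonneg x
  have hd := Φ.rank_pos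
  obtain ⟨s, t, ht, hdrop, hE, htE, hsE, hst, hs⟩ := exists_parameters (Fintype.card F) d
    (insepDegree F x) (Φ.conj x).card (degree F x) hq hd hP0 hδ0 hδP hα hℓ hℓD
  rw [heightConstant]
  set ν := Φ.degreeFactor r N₀ with hνdef
  set α := Φ.moduleHeight * Φ.coeffDegree with hαdef
  set ℓ := logPlus (Fintype.card F) (degree F x) with hℓdef
  have ht0 : (0 : ℝ) < t := by exact_mod_cast ht
  have hP1 : (1 : ℝ) ≤ insepDegree F x := by exact_mod_cast hP0
  have hs0 : 0 < s := by
    have : (0 : ℝ) < s := lt_of_lt_of_le (by positivity) hsE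
    exact_mod_cast this
  have hs0' : (0 : ℝ) < s := by exact_mod_cast hs0
  obtain ⟨N, hN₀N, hNs, hNle⟩ := exists_least_degree hq hr hr' hN₀ hs0
  have hN : 0 < N := hN₀.trans_le hN₀N
  have hN0 : (0 : ℝ) < N := by exact_mod_cast hN
  have hcount : 2 * s ≤ Φ.rvCount N := by exact_mod_cast hNs.trans (hRV N hN₀N)
  have key := le_canonicalHeight hx hN ht hcount hdrop hE htE hsE
  have hq1 : (1 : ℝ) < Fintype.card F := by exact_mod_cast hq
  have hPD : (insepDegree F x : ℝ) ≤ degree F x := by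
    exact_mod_cast (Nat.le_mul_of_pos_left _ hδ0).trans hδP
  have hNν : (N : ℝ) ≤ ν * ℓ := by
    have hPℓ : Real.logb (Fintype.card F) (insepDegree F x) ≤ ℓ :=
      (Real.logb_le_logb_of_le hq1 (by linarith) hPD).trans hℓD
    have h1 := logb_eight_mul_div_le hq hd hs0 hP0 hr hα hℓ hPℓ hs
    have h2 := degree_le_of_rpow_le hq hr hN hs0 hNle
    have h3 : 0 ≤ Real.logb (Fintype.card F) (1 / r) :=
      Real.logb_nonneg hq1 (by rw [le_div_iff₀ hr]; linarith)
    calc (N : ℝ) ≤ 2 * N₀ + 2 / r * Real.logb (Fintype.card F) (8 * s / r) := h2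
      _ ≤ 2 * N₀ * ℓ + 2 / r *
          (29 * d * α * ℓ + Real.logb (Fintype.card F) (1 / r) * ℓ) := by
          refine add_le_add (le_mul_of_one_le_right (by positivity) hℓ)
            (mul_le_mul_of_nonneg_left (h1.trans ?_) (by positivity))
          gcongr
          exact le_mul_of_one_le_right h3 hℓ
      _ = ν * ℓ := by rw [hνdef, degreeFactor, hαdef]; ring
  clear htE hsE hE hdrop hcount hNs hRV
  have hδP' : ((Φ.conj x).card * insepDegree F x : ℝ) ≤ degree F x := by exact_mod_cast hδP
  set q := (Fintype.card F : ℝ) with hqdef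
  have hq0 : 0 < q := by linarith
  set P := (insepDegree F x : ℝ) with hPdef
  set c := (Φ.coeffDegree : ℝ) with hcdef
  have hc : (1 : ℝ) ≤ c := by rw [hcdef]; exact_mod_cast one_le_coeffDegree (Φ := Φ)
  set δ := ((Φ.conj x).card : ℝ) with hδdef
  have hδpos : 0 < δ := by rw [hδdef]; exact_mod_cast hδ0
  set ĥ := Φ.canonicalHeight x
  set D := (degree F x : ℝ)
  set b := (d / r : ℝ) with hb
  have hb1 : 1 ≤ b := by
    rw [hb, le_div_iff₀ hr]
    have : (1 : ℝ) ≤ d := by exact_mod_cast hd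
    linarith
  have hb0 : 0 ≤ b := by linarith
  have hP0' : 0 < P := by linarith
  have hℓ0 : 0 < ℓ := by linarith
  -- Raising to the power `b = d / r` converts the count of RV primes, which grows like `q ^ (r N)`,
  -- into the height growth `q ^ (d N)` under `Φ(l)`.
  have hrb : ∀ n : ℕ, (q ^ (r * n)) ^ b = q ^ (d * n) := fun n => by
    rw [← Real.rpow_mul hq0.le, ← Real.rpow_natCast q (d * n)]
    congr 1
    rw [hb]
    push_cast
    field_simp
  have hqdN : q ^ (d * N) ≤ q ^ (d * N₀) * ((356400 * α ^ 4 * q ^ d) ^ b *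
      (ℓ ^ (2 * b) * P ^ (2 * b)) * N ^ b) := by
    calc q ^ (d * N) = (q ^ (r * N)) ^ b := (hrb N).symm
      _ ≤ (q ^ (r * N₀) * ((356400 * α ^ 4 * q ^ d) * (ℓ ^ 2 * P ^ 2) * N)) ^ b := by
          refine Real.rpow_le_rpow (by positivity) (hNle.trans ?_) hb0
          refine mul_le_mul_of_nonneg_left (mul_le_mul_of_nonneg_right ?_ hN0.le) (by positivity)
          linarith
      _ = _ := by
          rw [Real.mul_rpow (x := q ^ (r * N₀)) (by positivity) (by positivity),
            Real.mul_rpow (y := (N : ℝ)) (by positivity) (by positivity),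
            Real.mul_rpow (y := ℓ ^ 2 * P ^ 2) (by positivity) (by positivity),
            Real.mul_rpow (x := ℓ ^ 2) (by positivity) (by positivity), hrb,
            ← Real.rpow_natCast_mul hℓ0.le, ← Real.rpow_natCast_mul hP0'.le]
          norm_num
  set G := (356400 * α ^ 4 * q ^ d) ^ b with hG
  have hG0 : 0 < G := by positivity
  have hc0 : 0 ≤ 12 * c * q ^ d * δ := by positivity
  have hNb : (N : ℝ) = N ^ (1 - b) * N ^ b := by
    rw [← Real.rpow_add hN0, sub_add_cancel, Real.rpow_one]
  -- Here `t` cancels, `δ P ≤ D`, and `1080 = 12 · 3 · 30`.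
  have h1 : (N : ℝ) ^ (1 - b) ≤ 1080 * α ^ 2 * c * q ^ d * q ^ (d * N₀) * G *
      (D * (P * P ^ (2 * b)) * (ℓ * ℓ ^ (2 * b)) * ĥ) := by
    have hpos : 0 < t * (N : ℝ) ^ b := by positivity
    refine le_of_mul_le_mul_right ?_ hpos
    calc (N : ℝ) ^ (1 - b) * (t * N ^ b) = t * N := by
          rw [mul_left_comm, ← hNb]
      _ ≤ 12 * c * q ^ d * δ * s * q ^ (d * N) * ĥ := key
      _ ≤ 12 * c * q ^ d * δ * (3 * α * P ^ 2 * (30 * α * ℓ) * t) *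
          (q ^ (d * N₀) * (G * (ℓ ^ (2 * b) * P ^ (2 * b)) * N ^ b)) * ĥ :=
          mul_le_mul_of_nonneg_right (mul_le_mul (mul_le_mul_of_nonneg_left hst hc0)
            hqdN (pow_nonneg hq0.le _) (mul_nonneg hc0 (hs0'.le.trans hst))) hch
      _ = 1080 * α ^ 2 * c * q ^ d * q ^ (d * N₀) * G *
          ((δ * P) * (P * P ^ (2 * b)) * (ℓ * ℓ ^ (2 * b)) * ĥ) * (t * N ^ b) := by ring
      _ ≤ _ := by gcongr
  -- Since `1 - b ≤ 0`, the bound `N ≤ ν ℓ` is used in the reverse direction; the extra `ℓ ^ (b -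
  -- 1)` raises the exponent of `ℓ` from `1 + 2 b` to `3 b`.
  have h2 : ν ^ (1 - b) ≤ N ^ (1 - b) * ℓ ^ (b - 1) := by
    have h3 : (ν * ℓ) ^ (1 - b) ≤ (N : ℝ) ^ (1 - b) :=
      Real.rpow_le_rpow_of_nonpos hN0 hNν (by linarith)
    calc ν ^ (1 - b) = (ν * ℓ) ^ (1 - b) * ℓ ^ (b - 1) := by
          rw [Real.mul_rpow hν.le hℓ0.le, mul_assoc, ← Real.rpow_add hℓ0]
          norm_num
      _ ≤ _ := by gcongr
  have hℓ3 : ℓ ^ (3 * b) = ℓ * ℓ ^ (2 * b) * ℓ ^ (b - 1) := by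
    nth_rw 2 [← Real.rpow_one ℓ]
    rw [← Real.rpow_add hℓ0, ← Real.rpow_add hℓ0]
    congr 1
    ring
  have hP3 : P ^ (1 + 2 * b) = P * P ^ (2 * b) := by
    rw [Real.rpow_add hP0', Real.rpow_one]
  rw [div_le_iff₀ (by positivity), hℓ3, hP3]
  calc ν ^ (1 - b) ≤ N ^ (1 - b) * ℓ ^ (b - 1) := h2
    _ ≤ (1080 * α ^ 2 * c * q ^ d * q ^ (d * N₀) * G *
      (D * (P * P ^ (2 * b)) * (ℓ * ℓ ^ (2 * b)) * ĥ)) * ℓ ^ (b - 1) := by gcongr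
    _ = _ := by ring

lemma degree_pos (x : Ω) : 0 < degree F x := by
  have : FiniteDimensional (RatFunc F) (IntermediateField.adjoin (RatFunc F) {x}) :=
    IntermediateField.adjoin.finiteDimensional (Algebra.IsIntegral.isIntegral x)
  exact Module.finrank_pos

/-- Put `ε = b (α - 1) ≥ 0`. In the exponents of the theorem, `ε` adds `P ^ (2 ε) ≥ 1` and `ℓ ^ (3
ε)` to the denominator, the latter outweighing `(loglog₊ D) ^ ε`. The one further factor `ℓ` absorbs
`(loglog₊ D) ^ (2 + b)` up to `(2 + b) ^ (2 + b)`. -/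
lemma heightBound_mul_le {r : ℝ} (hr : 0 < r) (hr' : r ≤ 1) (x : Ω) :
    heightBound Φ r x * (degree F x * (insepDegree F x : ℝ) ^ (1 + 2 * (d / r)) *
      logPlus (Fintype.card F) (degree F x) ^ (3 * (d / r))) ≤
      (2 + d / r : ℝ) ^ (2 + d / r : ℝ) := by
  have hq : 2 ≤ Fintype.card F := Fintype.one_lt_card
  have hα := one_le_height_mul_degree (Φ := Φ)
  have hP1 : (1 : ℝ) ≤ insepDegree F x := by exact_mod_cast insepDegree_pos (F := F) x
  have hD0 : (0 : ℝ) < degree F x := by exact_mod_cast degree_pos x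
  have hd : (1 : ℝ) ≤ d := by exact_mod_cast Φ.rank_pos
  have hℓ : 1 ≤ logPlus (Fintype.card F) (degree F x) := le_max_right _ _
  have hℓℓ : 1 ≤ logLogPlus (Fintype.card F) (degree F x) := le_max_right _ _
  have hle := logLogPlus_le_logPlus hq (degree_pos (F := F) x)
  have hb1 : (1 : ℝ) ≤ d / r := by
    rw [le_div_iff₀ hr]
    linarith
  have hB := logLogPlus_rpow_le hq (degree_pos (F := F) x) (show (1 : ℝ) ≤ 2 + d / r by linarith)
  have eμ : μ Φ r = (2 + d / r) + d / r * (Φ.moduleHeight * Φ.coeffDegree - 1) := by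
    rw [μ]; ring
  have eκ : κ Φ r = 3 * (d / r) + (1 + 3 * (d / r * (Φ.moduleHeight * Φ.coeffDegree - 1))) := by
    rw [κ]; ring
  have elam : lam Φ r = (1 + 2 * (d / r)) + 2 * (d / r * (Φ.moduleHeight * Φ.coeffDegree - 1)) := by
    rw [lam]; ring
  rw [heightBound, eμ, eκ, elam]
  set P := (insepDegree F x : ℝ)
  set D := (degree F x : ℝ)
  set b := (d / r : ℝ)
  set ε := b * (Φ.moduleHeight * Φ.coeffDegree - 1)
  have hε : 0 ≤ ε := mul_nonneg (by linarith) (by linarith)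
  set ℓ := logPlus (Fintype.card F) D
  set m := logLogPlus (Fintype.card F) D
  have hℓ0 : 0 < ℓ := by linarith
  have hP0 : 0 < P := by linarith
  have hm0 : 0 < m := by linarith
  have h1 : m ^ ε ≤ ℓ ^ (3 * ε) :=
    (Real.rpow_le_rpow hm0.le hle hε).trans
      (Real.rpow_le_rpow_of_exponent_le hℓ (by linarith))
  have h2 : 1 ≤ P ^ (2 * ε) := Real.one_le_rpow hP1 (by linarith)
  rw [div_mul_eq_mul_div, div_le_iff₀ (by positivity), Real.rpow_add hm0, Real.rpow_add hP0 (1 + 2 * b),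
    Real.rpow_add hℓ0, Real.rpow_add hℓ0, Real.rpow_one]
  calc m ^ (2 + b) * m ^ ε * (D * P ^ (1 + 2 * b) * ℓ ^ (3 * b))
      ≤ ((2 + b) ^ (2 + b) * ℓ) * ℓ ^ (3 * ε) * (D * (P ^ (1 + 2 * b) * P ^ (2 * ε)) * ℓ ^ (3 * b)) := by
        gcongr
        exact le_mul_of_one_le_right (by positivity) h2
    _ = _ := by ring

lemma heightBound_nonneg {r : ℝ} (x : Ω) : 0 ≤ heightBound Φ r x := by
  have hℓ : 0 < logPlus (Fintype.card F) (degree F x) :=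
    zero_lt_one.trans_le (le_max_right _ _)
  have hℓℓ : 0 < logLogPlus (Fintype.card F) (degree F x) :=
    zero_lt_one.trans_le (le_max_right _ _)
  rw [heightBound]
  positivity

theorem heightConstant_mul_heightBound_le {r : ℝ} (hr : 0 < r) (hr' : r ≤ 1) {N₀ : ℕ} (hN₀ : 0 < N₀)
    (hRV : ∀ N : ℕ, N₀ ≤ N →
      1 / (2 * r) * ((Fintype.card F : ℝ) ^ (r * N) / N) ≤ Φ.rvCount N)
    {x : Ω} (hx : ¬ Φ.IsTorsion x) :
    Φ.heightConstant r N₀ / (2 + d / r : ℝ) ^ (2 + d / r : ℝ) * heightBound Φ r x ≤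
      Φ.canonicalHeight x := by
  have h1 := heightConstant_le hr hr' hN₀ hRV hx
  have h2 := heightBound_mul_le (Φ := Φ) hr hr' x
  have hB : 0 < (2 + d / r : ℝ) ^ (2 + d / r : ℝ) := by positivity
  have hhb := heightBound_nonneg (Φ := Φ) (r := r) x
  have hch := Φ.canonicalHeight_nonneg x
  rw [div_mul_eq_mul_div, div_le_iff₀ hB]
  calc _ ≤ (degree F x * (insepDegree F x : ℝ) ^ (1 + 2 * (d / r)) *
        logPlus (Fintype.card F) (degree F x) ^ (3 * (d / r)) * Φ.canonicalHeight x) *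
        heightBound Φ r x := by gcongr
    _ = Φ.canonicalHeight x * (heightBound Φ r x * (degree F x *
        (insepDegree F x : ℝ) ^ (1 + 2 * (d / r)) *
        logPlus (Fintype.card F) (degree F x) ^ (3 * (d / r)))) := by ring
    _ ≤ _ := by gcongr

lemma rvCount_one_le : Φ.rvCount 1 ≤ Fintype.card F := by
  have hsub : {l : F[X] | l.natDegree = 1 ∧ Φ.IsRVPrime l} ⊆
      (fun a : F => Polynomial.X + Polynomial.C a) '' Set.univ := by
    rintro l ⟨h1, h2⟩
    exact ⟨l.coeff 0, trivial, (h2.1.eq_X_add_C h1).symm⟩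
  calc Φ.rvCount 1 ≤ ((fun a : F => Polynomial.X + Polynomial.C a) '' Set.univ).ncard :=
        Set.ncard_le_ncard hsub (Set.toFinite _)
    _ ≤ (Set.univ : Set F).ncard := Set.ncard_image_le
    _ = Fintype.card F := by rw [Set.ncard_univ, Nat.card_eq_fintype_card]

/-- Only the second entry of the minimum is needed. The RV condition in degree one, compared with
the `q` monic linear polynomials, forces `1 / r ≤ 2 q`. This controls `log (1 / r)` and `d / r` in
terms of the data in `c₀`. -/
lemma C₀_le_heightConstant {r : ℝ} (hr : 0 < r) (hr' : r ≤ 1) (hRV : Φ.IsRV r) :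
    C₀ Φ r ≤ Φ.heightConstant r 1 / (2 + d / r : ℝ) ^ (2 + d / r : ℝ) := by
  have hq : 2 ≤ Fintype.card F := Fintype.one_lt_card
  have hq2 : (2 : ℝ) ≤ Fintype.card F := by exact_mod_cast hq
  have hα := one_le_height_mul_degree (Φ := Φ)
  have hh := Φ.one_le_moduleHeight
  have hc : (1 : ℝ) ≤ Φ.coeffDegree := by exact_mod_cast one_le_coeffDegree (Φ := Φ)
  have hd : (1 : ℝ) ≤ d := by exact_mod_cast Φ.rank_pos
  have hν := degreeFactor_pos (Φ := Φ) hr hr' one_pos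
  have hrq : 1 / r ≤ 2 * Fintype.card F := by
    have h1 := hRV 1 one_pos
    have h2 : (Φ.rvCount 1 : ℝ) ≤ Fintype.card F := by exact_mod_cast rvCount_one_le (Φ := Φ)
    have h3 : (1 : ℝ) ≤ (Fintype.card F : ℝ) ^ r := Real.one_le_rpow (by linarith) hr.le
    rw [Nat.cast_one, mul_one, div_one] at h1
    have h4 : 1 / (2 * r) * 1 ≤ (Fintype.card F : ℝ) :=
      (mul_le_mul_of_nonneg_left h3 (by positivity)).trans (h1.trans h2)
    have h5 : 1 / r = 2 * (1 / (2 * r) * 1) := by field_simp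
    linarith
  have hν' : Φ.degreeFactor r 1 ≤ 64 * (Φ.moduleHeight * Φ.coeffDegree) * (d / r) := by
    have h1 : Real.logb (Fintype.card F) (1 / r) ≤ 2 := by
      rw [Real.logb_le_iff_le_rpow (by linarith) (by positivity), Real.rpow_two]
      nlinarith
    have h2 : 1 ≤ d / r := by rw [le_div_iff₀ hr]; linarith
    have h3 : d / r ≤ Φ.moduleHeight * Φ.coeffDegree * (d / r) :=
      le_mul_of_one_le_left (by positivity) hα
    have h4 : 2 / r * 2 ≤ 4 * (d / r) := by
      rw [div_mul_eq_mul_div, ← mul_div_assoc]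
      exact div_le_div_of_nonneg_right (by linarith) hr.le
    have h5 : 2 / r * Real.logb (Fintype.card F) (1 / r) ≤ 2 / r * 2 := by gcongr
    have h6 : 2 / r * (29 * d * (Φ.moduleHeight * Φ.coeffDegree)) =
        58 * (Φ.moduleHeight * Φ.coeffDegree * (d / r)) := by ring
    rw [degreeFactor, mul_add, Nat.cast_one, h6]
    linarith
  have hqQ : (Fintype.card F : ℝ) ≤ (Fintype.card F : ℝ) ^ d :=
    le_self_pow₀ (by linarith) Φ.rank_pos.ne'
  have hX : 35000 * d * (Φ.moduleHeight * Φ.coeffDegree) ^ 3 * (Fintype.card F : ℝ) ^ d ≤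
      c₀ Φ r := by
    rw [c₀, Real.rpow_add (by linarith), Real.rpow_natCast, mul_pow]
    have h1 : 1 ≤ (Fintype.card F : ℝ) ^ (r * Φ.moduleHeight * Φ.coeffDegree) :=
      Real.one_le_rpow (by linarith) (by positivity)
    calc _ = 35000 * d * Φ.moduleHeight ^ 3 * (Φ.coeffDegree : ℝ) ^ 3 *
          ((Fintype.card F : ℝ) ^ d * 1) := by ring
      _ ≤ _ := by gcongr
  have hXb : 17500 * (d / r) ≤ c₀ Φ r := by
    refine le_trans ?_ hX
    calc 17500 * (d / r) = 17500 * d * 1 * (1 / r) := by ring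
      _ ≤ 17500 * d * (Φ.moduleHeight * Φ.coeffDegree) ^ 3 * (2 * (Fintype.card F : ℝ) ^ d) := by
          gcongr
          · exact one_le_pow₀ hα
          · linarith
      _ = _ := by ring
  have key := explicit_constant_le hd hr hr' rfl hα hc (le_mul_of_one_le_left (by linarith) hh)
    (one_le_pow₀ (by linarith)) hν hν' hX hXb
  rw [heightConstant, mul_one, C₀]
  refine (min_le_right _ _).trans (le_of_eq_of_le ?_ key)
  congr 4
  ring

lemma C₀_pos {r : ℝ} (hr : 0 < r) : 0 < C₀ Φ r := by
  have hh := Φ.one_le_moduleHeight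
  have hc : (1 : ℝ) ≤ Φ.coeffDegree := by exact_mod_cast one_le_coeffDegree (Φ := Φ)
  have hd : (1 : ℝ) ≤ d := by exact_mod_cast Φ.rank_pos
  have hq1 : (0 : ℝ) < Fintype.card F := by exact_mod_cast Fintype.card_pos (α := F)
  have hX : 0 < c₀ Φ r := by
    rw [c₀]
    positivity
  rw [C₀]
  refine lt_min (by positivity) (by positivity)

end DrinfeldModule

end DrinfeldLehmer

end


theorem mainTheorem2 {F : Type*} [Field F] [Fintype F] {Ω : Type*} [Field Ω]
    [Algebra (RatFunc F) Ω] [IsAlgClosure (RatFunc F) Ω] [Algebra F Ω]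
    [IsScalarTower F (RatFunc F) Ω] {d : ℕ} (Φ : DrinfeldLehmer.DrinfeldModule F Ω d)
    (r : ℝ) (hr : 0 < r) (hr' : r ≤ 1) :
    (Φ.IsRV r → ∀ x : Ω, ¬ Φ.IsTorsion x → 1 < DrinfeldLehmer.insepDegree F x →
      DrinfeldLehmer.C₀ Φ r * DrinfeldLehmer.heightBound Φ r x ≤ Φ.canonicalHeight x) ∧
    (Φ.IsRVStar r → ∃ C : ℝ, 0 < C ∧ C ≤ DrinfeldLehmer.C₀ Φ r ∧
      ∀ x : Ω, ¬ Φ.IsTorsion x → 1 < DrinfeldLehmer.insepDegree F x →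
        C * DrinfeldLehmer.heightBound Φ r x ≤ Φ.canonicalHeight x) := by
  have : IsAlgClosed Ω := IsAlgClosure.isAlgClosed (RatFunc F)
  have : Algebra.IsAlgebraic (RatFunc F) Ω := IsAlgClosure.isAlgebraic
  constructor
  · intro hRV x hx _
    refine le_trans (mul_le_mul_of_nonneg_right
      (DrinfeldLehmer.DrinfeldModule.C₀_le_heightConstant hr hr' hRV)
      (DrinfeldLehmer.DrinfeldModule.heightBound_nonneg x))
      (DrinfeldLehmer.DrinfeldModule.heightConstant_mul_heightBound_le hr hr' one_pos
        (fun N hN => hRV N hN) hx)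
  · rintro ⟨N₀, hN₀, hRV⟩
    -- The constant depends on the degree `N₀` from which RV primes are abundant, hence on `Φ` and
    -- `r` but not on `x`.
    refine ⟨min (DrinfeldLehmer.C₀ Φ r) (Φ.heightConstant r N₀ / (2 + d / r : ℝ) ^ (2 + d / r : ℝ)),
      lt_min (DrinfeldLehmer.DrinfeldModule.C₀_pos hr)
        (div_pos (DrinfeldLehmer.DrinfeldModule.heightConstant_pos hr hr' hN₀) (by positivity)),
      min_le_left _ _, fun x hx _ => ?_⟩
    exact le_trans (mul_le_mul_of_nonneg_right (min_le_right _ _)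
      (DrinfeldLehmer.DrinfeldModule.heightBound_nonneg x))
      (DrinfeldLehmer.DrinfeldModule.heightConstant_mul_heightBound_le hr hr' hN₀ hRV hx)
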